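/- **Theorem (Aharonov–Bohm magnetic virial theorem and absence of large eigenvalues).** Let $B_0\in\mathbb R$ and let $A^{ab}(x,y)=B_0\,\frac{(-y,x)}{r^2}$, $r=(x^2+y^2)^{1/2}$, be the Aharonov–Bohm vector potential on $\mathbb R^2\setminus\{0\}$; put $P=-i\nabla$. Let $P-A^{ab}$, with domain $\mathcal D(P-A^{ab})\subset L^2(\mathbb R^2)$, be the closure of its restriction to $\mathcal C_0^\infty(\mathbb R^2\setminus\{0\})$. A real measurable function $W$ on $\mathbb R^2$ is called *form bounded* if $\int |W||\varphi|^2<\infty$ for all $\varphi\in\mathcal D(P-A^{ab})$ and there are constants $a,b$ with $$|\langle\varphi,W\varphi\rangle|\le a\|(P-A^{ab})\varphi\|_2^2+b\|\varphi\|_2^2\qquad\text{for all }\varphi\in\mathcal D(P-A^{ab}),$$ and *form small* if one can take $a<1$. Form boundedness of a quadratic form on $\mathcal D(P-A^{ab})$ is defined by the same inequality. Let $V$ be form small, put $$q_{ab,V}(\varphi,\psi)=\langle(P-A^{ab})\varphi,(P-A^{ab})\psi\rangle+\langle\varphi,V\psi\rangle,\qquad \varphi,\psi\in\mathcal D(P-A^{ab}),$$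 and let $H^{ab}_V$ be the self-adjoint operator associated with this form. For a potential $W$, the distribution $x\cdot\nabla W$ is given on $\varphi\in\mathcal C_0^\infty(\mathbb R^2\setminus\{0\})$ by $\langle\varphi,x\cdot\nabla W\,\varphi\rangle=-2\langle\varphi,W\varphi\rangle-2\operatorname{Re}\langle W\varphi,x\cdot\nabla\varphi\rangle$. Let $(U_t\varphi)(x)=e^{t}\varphi(e^tx)$ and $iD_t=\frac{U_t-U_{-t}}{2t}$. (a) Assume that $x\cdot\nabla V$ extends to a form bounded quadratic form on $\mathcal D(P-A^{ab})$, again denoted by $\langle\varphi,x\cdot\nabla V\,\varphi\rangle$. Then for every $\varphi\in\mathcal D(P-A^{ab})$ one has $iD_t\varphi\in\mathcal D(P-A^{ab})$ for all $t\ne0$, the limit below exists, and $$\lim_{t\to0}2\operatorname{Re}q_{ab,V}(\varphi,iD_t\varphi)=2\|(P-A^{ab})\varphi\|_2^2-\langle\varphi,x\cdot\nabla V\,\varphi\rangle .$$ (b) Assume that $V=V_1+V_2$ with $V_1$, $V_2$ real measurable, where $V_1$, $|x|^2V_1^2$ and $x\cdot\nabla V_2$ are form bounded (the last one meaning that the distribution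 extends to a form bounded quadratic form on $\mathcal D(P-A^{ab})$). Assume that $V$ and $V_1$ vanish at infinity: for $W=V$ and for $W=V_1$ there are $R_0>0$ and positive $\alpha_R,\gamma_R$ ($R\ge R_0$) with $\alpha_R,\gamma_R\to0$ as $R\to\infty$ and $|\langle\varphi,W\varphi\rangle|\le\alpha_R\|(P-A^{ab})\varphi\|_2^2+\gamma_R\|\varphi\|_2^2$ for all $\varphi\in\mathcal D(P-A^{ab})$ supported in $\{|x|\ge R\}$. Assume finally that there are positive sequences $\varepsilon_j\to0$, $R_j\to\infty$, $\omega_{1,j}\to\omega_1$, $\omega_{2,j}\to\omega_2$ such that, for all $j$ and all $\varphi\in\mathcal D(P-A^{ab})$ supported in $\{|x|\ge R_j\}$, $$\||x|V_1\varphi\|_2^2\le\varepsilon_j\|(P-A^{ab})\varphi\|_2^2+\omega_{1,j}^2\|\varphi\|_2^2,\qquad \langle\varphi,x\cdot\nabla V_2\,\varphi\rangle\le\varepsilon_j\|(P-A^{ab})\varphi\|_2^2+\omega_{2,j}\|\varphi\|_2^2 .$$ Then $H^{ab}_V$ has no eigenvalue $E$ with $$E>\frac14\Big(\omega_1+\sqrt{\omega_1^2+2\omega_2}\Big)^2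 .$$ -/

import Mathlib

open MeasureTheory Filter Topology
open scoped ContDiff ComplexConjugate

namespace AharonovBohm

/-- The Euclidean plane. -/
abbrev Plane : Type := EuclideanSpace ℝ (Fin 2)

/-- The Hilbert space of square integrable complex valued functions on the plane. -/
abbrev L2 : Type := Lp ℂ 2 (volume : Measure Plane)

/-- The Hilbert space of square integrable `ℂ²`-valued vector fields on the plane. -/
abbrev L2Vec : Type := Lp (EuclideanSpace ℂ (Fin 2)) 2 (volume : Measure Plane)

/-- The Aharonov-Bohm vector potential `B₀ (-y, x) / r²`. -/
noncomputable def abPotential (B₀ : ℝ) (x : Plane) : Plane :=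
  (B₀ / ‖x‖ ^ 2) • !₂[-x 1, x 0]

/-- Test functions: smooth complex functions with compact support in the punctured plane. -/
structure IsTest (η : Plane → ℂ) : Prop where
  smooth : ContDiff ℝ ∞ η
  compact : HasCompactSupport η
  away : (0 : Plane) ∉ tsupport η

/-- The vector field `(P - A) η` with `P = -i ∇`, for a differentiable function `η`. -/
noncomputable def momentumTest (B₀ : ℝ) (η : Plane → ℂ) (x : Plane) : EuclideanSpace ℂ (Fin 2) :=
  WithLp.toLp 2 fun j =>
    -Complex.I * fderiv ℝ η x (EuclideanSpace.single j 1) - (abPotential B₀ x j : ℂ) * η x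

theorem IsTest.differentiable {η : Plane → ℂ} (h : IsTest η) : Differentiable ℝ η :=
  h.smooth.differentiable (by simp)

theorem IsTest.zero : IsTest (fun _ => 0) :=
  ⟨contDiff_const, HasCompactSupport.zero, by
    rw [notMem_tsupport_iff_eventuallyEq]; rfl⟩

theorem IsTest.add {η ξ : Plane → ℂ} (h : IsTest η) (k : IsTest ξ) :
    IsTest (fun x => η x + ξ x) :=
  ⟨h.smooth.add k.smooth, h.compact.add k.compact, by
    have h1 := h.away
    have h2 := k.away
    rw [notMem_tsupport_iff_eventuallyEq] at h1 h2 ⊢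
    filter_upwards [h1, h2] with x hx hy
    simp [hx, hy]⟩

theorem IsTest.smul {η : Plane → ℂ} (c : ℂ) (h : IsTest η) : IsTest (fun x => c * η x) :=
  ⟨contDiff_const.mul h.smooth, h.compact.mul_left, by
    have h1 := h.away
    rw [notMem_tsupport_iff_eventuallyEq] at h1 ⊢
    filter_upwards [h1] with x hx
    simp [hx]⟩

theorem momentumTest_zero (B₀ : ℝ) (x : Plane) : momentumTest B₀ (fun _ => 0) x = 0 := by
  ext j; simp [momentumTest]

theorem momentumTest_add (B₀ : ℝ) {η ξ : Plane → ℂ} (h : IsTest η) (k : IsTest ξ) (x : Plane) :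
    momentumTest B₀ (fun x => η x + ξ x) x = momentumTest B₀ η x + momentumTest B₀ ξ x := by
  ext j
  have : fderiv ℝ (fun x => η x + ξ x) x = fderiv ℝ η x + fderiv ℝ ξ x :=
    fderiv_add (h.differentiable x) (k.differentiable x)
  simp only [momentumTest, this, PiLp.add_apply, add_apply]
  ring

theorem momentumTest_smul (B₀ : ℝ) {η : Plane → ℂ} (c : ℂ) (h : IsTest η) (x : Plane) :
    momentumTest B₀ (fun x => c * η x) x = c • momentumTest B₀ η x := by
  ext j
  have : fderiv ℝ (fun x => c * η x) x = c • fderiv ℝ η x :=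
    fderiv_const_mul (h.differentiable x) c
  simp only [momentumTest, this, PiLp.smul_apply, smul_apply, smul_eq_mul]
  ring

/-- The graph of `P - A` on test functions, as a subspace of `L² × L²`. -/
noncomputable def coreGraph (B₀ : ℝ) : Submodule ℂ (L2 × L2Vec) where
  carrier := {p | ∃ η : Plane → ℂ, IsTest η ∧ p.1 =ᵐ[volume] η ∧
    p.2 =ᵐ[volume] momentumTest B₀ η}
  zero_mem' := ⟨fun _ => 0, IsTest.zero, Lp.coeFn_zero _ _ _, by
    filter_upwards [Lp.coeFn_zero (EuclideanSpace ℂ (Fin 2)) 2 (volume : Measure Plane)] with x hx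
    rw [momentumTest_zero, Prod.snd_zero, hx, Pi.zero_apply]⟩
  add_mem' := by
    rintro p q ⟨η, hη, h1, h2⟩ ⟨ξ, hξ, k1, k2⟩
    refine ⟨fun x => η x + ξ x, hη.add hξ, ?_, ?_⟩
    · filter_upwards [Lp.coeFn_add p.1 q.1, h1, k1] with x hx a b
      rw [Prod.fst_add, hx, Pi.add_apply, a, b]
    · filter_upwards [Lp.coeFn_add p.2 q.2, h2, k2] with x hx a b
      rw [Prod.snd_add, hx, Pi.add_apply, a, b, momentumTest_add B₀ hη hξ]
  smul_mem' := by
    rintro c p ⟨η, hη, h1, h2⟩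
    refine ⟨fun x => c * η x, hη.smul c, ?_, ?_⟩
    · filter_upwards [Lp.coeFn_smul c p.1, h1] with x hx a
      rw [Prod.smul_fst, hx, Pi.smul_apply, a, smul_eq_mul]
    · filter_upwards [Lp.coeFn_smul c p.2, h2] with x hx a
      rw [Prod.smul_snd, hx, Pi.smul_apply, a, momentumTest_smul B₀ c hη]

theorem IsTest.ne_zero {η : Plane → ℂ} (h : IsTest η) {x : Plane} (hx : x ∈ tsupport η) : x ≠ 0 := by
  rintro rfl; exact h.away hx

theorem continuous_abPotential_mul (B₀ : ℝ) {η : Plane → ℂ} (h : IsTest η) (j : Fin 2) :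
    Continuous (fun x => (abPotential B₀ x j : ℂ) * η x) := by
  rw [continuous_iff_continuousAt]
  intro x
  by_cases hx : x ∈ tsupport η
  · have hx0 := h.ne_zero hx
    have hn : ‖x‖ ^ 2 ≠ 0 := by simpa using hx0
    have hA : ContinuousAt (fun x : Plane => abPotential B₀ x j) x := by
      have h1 : ContinuousAt (fun x : Plane => B₀ / ‖x‖ ^ 2) x := by fun_prop (disch := assumption)
      have h2 : Continuous (fun x : Plane => (!₂[-x 1, x 0] : Plane) j) := by
        fin_cases j <;> simp <;> fun_prop
      have h3 := ContinuousAt.fun_mul h1 h2.continuousAt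
      simpa [abPotential] using h3
    exact (Complex.continuous_ofReal.continuousAt.comp hA).mul h.smooth.continuous.continuousAt
  · have h0 : (fun x => (abPotential B₀ x j : ℂ) * η x) =ᶠ[𝓝 x] fun _ => 0 := by
      filter_upwards [notMem_tsupport_iff_eventuallyEq.1 hx] with y hy
      simp [hy]
    exact h0.continuousAt

theorem continuous_fderiv_test {η : Plane → ℂ} (h : IsTest η) (v : Plane) :
    Continuous (fun x => fderiv ℝ η x v) :=
  (h.smooth.continuous_fderiv (by simp)).clm_apply continuous_const

/-- Integration by parts for `P - A` on test functions. -/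
theorem integral_mul_momentumTest (B₀ : ℝ) {η ξ : Plane → ℂ} (h : IsTest η) (k : IsTest ξ)
    (j : Fin 2) :
    ∫ x, ξ x * momentumTest B₀ η x j =
      ∫ x, (Complex.I * fderiv ℝ ξ x (EuclideanSpace.single j 1)
        - (abPotential B₀ x j : ℂ) * ξ x) * η x := by
  set v : Plane := EuclideanSpace.single j 1
  have i1 : Integrable (fun x => fderiv ℝ ξ x v * η x) :=
    ((continuous_fderiv_test k v).mul h.smooth.continuous).integrable_of_hasCompactSupport
      h.compact.mul_left
  have i2 : Integrable (fun x => ξ x * fderiv ℝ η x v) :=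
    (k.smooth.continuous.mul (continuous_fderiv_test h v)).integrable_of_hasCompactSupport
      k.compact.mul_right
  have i3 : Integrable (fun x => ξ x * η x) :=
    (k.smooth.continuous.mul h.smooth.continuous).integrable_of_hasCompactSupport
      k.compact.mul_right
  have i4 : Integrable (fun x => (abPotential B₀ x j : ℂ) * ξ x * η x) :=
    ((continuous_abPotential_mul B₀ k j).mul h.smooth.continuous).integrable_of_hasCompactSupport
      h.compact.mul_left
  have ibp := integral_mul_fderiv_eq_neg_fderiv_mul_of_integrable (μ := volume) i1 i2 i3
    (fun x _ => k.differentiable x) (fun x _ => h.differentiable x)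
  have e1 : (fun x => ξ x * momentumTest B₀ η x j) = fun x =>
      -Complex.I * (ξ x * fderiv ℝ η x v) - (abPotential B₀ x j : ℂ) * ξ x * η x := by
    funext x; simp only [momentumTest]; ring
  have e2 : (fun x => (Complex.I * fderiv ℝ ξ x v - (abPotential B₀ x j : ℂ) * ξ x) * η x) =
      fun x => Complex.I * (fderiv ℝ ξ x v * η x) - (abPotential B₀ x j : ℂ) * ξ x * η x := by
    funext x; ring
  rw [e1, e2, integral_sub (i2.const_mul _) i4, integral_sub (i1.const_mul _) i4,
    integral_const_mul, integral_const_mul, ibp]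
  ring

/-- `P - A` on test functions is closable, so `momentum` is the closed operator whose graph is the
closure of `coreGraph`. -/
theorem coreGraph_closable (B₀ : ℝ) :
    ∀ p ∈ (coreGraph B₀).topologicalClosure, p.1 = 0 → p.2 = 0 := by
  intro p hp hp1
  have key : ∀ (ξ : Plane → ℂ), IsTest ξ → ∀ j : Fin 2, ∫ x, ξ x * p.2 x j = 0 := by
    intro ξ hξ j
    set v : Plane := EuclideanSpace.single j 1
    have c1 : Continuous (fun x => conj (Complex.I * fderiv ℝ ξ x v
        - (abPotential B₀ x j : ℂ) * ξ x)) :=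
      Complex.continuous_conj.comp
        ((continuous_const.mul (continuous_fderiv_test hξ v)).sub
          (continuous_abPotential_mul B₀ hξ j))
    have s1 : HasCompactSupport (fun x => conj (Complex.I * fderiv ℝ ξ x v
        - (abPotential B₀ x j : ℂ) * ξ x)) := by
      refine HasCompactSupport.comp_left (g := conj) ?_ (by simp)
      refine HasCompactSupport.sub ?_ hξ.compact.mul_left
      exact (hξ.compact.fderiv_apply (𝕜 := ℝ) v).mul_left
    have c2 : Continuous (fun x => EuclideanSpace.single j (conj (ξ x))) := by
      have := hξ.smooth.continuous
      refine (PiLp.continuous_toLp 2 _).comp (continuous_pi fun i => ?_)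
      by_cases hij : i = j
      · subst hij; simpa [Function.comp_def] using Complex.continuous_conj.comp this
      · simpa [hij] using continuous_const
    have s2 : HasCompactSupport (fun x => EuclideanSpace.single j (conj (ξ x))) :=
      hξ.compact.comp_left (g := fun z => EuclideanSpace.single j (conj z)) (by simp)
    have m1 := c1.memLp_of_hasCompactSupport (p := 2) (μ := volume) s1
    have m2 := c2.memLp_of_hasCompactSupport (p := 2) (μ := volume) s2
    have f2 : ∀ q : L2Vec, inner ℂ (m2.toLp _) q = ∫ x, ξ x * q x j := by
      intro q
      rw [MeasureTheory.L2.inner_def]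
      refine integral_congr_ae ?_
      filter_upwards [m2.coeFn_toLp] with x hx
      rw [hx, EuclideanSpace.inner_single_left]
      simp
    have f1 : ∀ q : L2, inner ℂ (m1.toLp _) q = ∫ x, (Complex.I * fderiv ℝ ξ x v
        - (abPotential B₀ x j : ℂ) * ξ x) * q x := by
      intro q
      rw [MeasureTheory.L2.inner_def]
      refine integral_congr_ae ?_
      filter_upwards [m1.coeFn_toLp] with x hx
      rw [hx, RCLike.inner_apply, Complex.conj_conj, mul_comm]
    have hcl : IsClosed {q : L2 × L2Vec | inner ℂ (m2.toLp _) q.2 = inner ℂ (m1.toLp _) q.1} :=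
      isClosed_eq (by fun_prop) (by fun_prop)
    have hsub : (coreGraph B₀ : Set (L2 × L2Vec)) ⊆
        {q : L2 × L2Vec | inner ℂ (m2.toLp _) q.2 = inner ℂ (m1.toLp _) q.1} := by
      rintro q ⟨η, hη, h1, h2⟩
      have a1 : ∫ x, ξ x * q.2 x j = ∫ x, ξ x * momentumTest B₀ η x j :=
        integral_congr_ae (by filter_upwards [h2] with x hx; rw [hx])
      have a2 : ∫ x, (Complex.I * fderiv ℝ ξ x v - (abPotential B₀ x j : ℂ) * ξ x) * q.1 x =
          ∫ x, (Complex.I * fderiv ℝ ξ x v - (abPotential B₀ x j : ℂ) * ξ x) * η x :=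
        integral_congr_ae (by filter_upwards [h1] with x hx; rw [hx])
      rw [Set.mem_ofPred_eq, f1, f2, a1, a2]
      exact integral_mul_momentumTest B₀ hη hξ j
    have hp' : inner ℂ (m2.toLp _) p.2 = inner ℂ (m1.toLp _) p.1 :=
      closure_minimal hsub hcl hp
    rw [← f2, hp', hp1, inner_zero_right]
  have comp : ∀ j : Fin 2, ∀ᵐ x : Plane, p.2 x j = 0 := by
    intro j
    have hm : MemLp (fun x => p.2 x j) 2 (volume : Measure Plane) :=
      (Lp.memLp p.2).continuousLinearMap_comp
        (EuclideanSpace.proj j : EuclideanSpace ℂ (Fin 2) →L[ℂ] ℂ)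
    have hz := IsOpen.ae_eq_zero_of_integral_contDiff_smul_eq_zero (μ := volume)
      (U := ({0}ᶜ : Set Plane)) isOpen_compl_singleton
      ((hm.locallyIntegrable (by norm_num)).locallyIntegrableOn _) (by
        intro g hg hgc hgs
        have hsup : tsupport (fun x => (g x : ℂ)) ⊆ tsupport g :=
          closure_mono fun x hx => by
            rw [Function.mem_support] at hx ⊢
            exact_mod_cast hx
        have ht : IsTest (fun x => (g x : ℂ)) :=
          ⟨Complex.ofRealCLM.contDiff.comp hg, hgc.comp_left (g := Complex.ofReal) (by simp),
            fun h0 => hgs (hsup h0) rfl⟩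
        simpa using key _ ht j)
    have h0 : ∀ᵐ x : Plane, x ≠ 0 := Measure.ae_ne volume 0
    filter_upwards [hz, h0] with x hx hx0
    exact hx hx0
  refine (Lp.eq_zero_iff_ae_eq_zero).2 ?_
  filter_upwards [comp 0, comp 1] with x h0 h1
  ext j
  fin_cases j
  · exact h0
  · exact h1

/-- The operator `P - A` with its domain `𝒟(P - A)`: the closure of `P - A` on test functions.
Its graph is the closure of `coreGraph`. -/
noncomputable def momentum (B₀ : ℝ) : L2 →ₗ.[ℂ] L2Vec :=
  (coreGraph B₀).topologicalClosure.toLinearPMap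

/-- The form domain `𝒟(P - A)`. -/
noncomputable abbrev Dom (B₀ : ℝ) : Submodule ℂ L2 := (momentum B₀).domain

/-- `⟨φ, V φ⟩ = ∫ V |φ|²`. -/
noncomputable def potentialQuad (V : Plane → ℝ) (φ : L2) : ℝ := ∫ x, V x * ‖φ x‖ ^ 2

/-- The form domain of the potential `V` contains `𝒟(P - A)`. -/
def FormDomainContains (B₀ : ℝ) (V : Plane → ℝ) : Prop :=
  ∀ φ : Dom B₀, Integrable (fun x => V x * ‖(φ : L2) x‖ ^ 2)

/-- `V` is form bounded with respect to `(P - A)²`. -/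
def IsFormBounded (B₀ : ℝ) (V : Plane → ℝ) : Prop :=
  FormDomainContains B₀ V ∧ ∃ a b : ℝ, ∀ φ : Dom B₀,
    |potentialQuad V φ| ≤ a * ‖momentum B₀ φ‖ ^ 2 + b * ‖(φ : L2)‖ ^ 2

/-- `V` is form small with respect to `(P - A)²`: form bounded with relative bound `< 1`. -/
def IsFormSmall (B₀ : ℝ) (V : Plane → ℝ) : Prop :=
  FormDomainContains B₀ V ∧ ∃ a b : ℝ, a < 1 ∧ ∀ φ : Dom B₀,
    |potentialQuad V φ| ≤ a * ‖momentum B₀ φ‖ ^ 2 + b * ‖(φ : L2)‖ ^ 2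

/-- The sesquilinear form `q(φ, ψ) = ⟨(P - A) φ, (P - A) ψ⟩ + ⟨φ, V ψ⟩` on `𝒟(P - A)`. -/
noncomputable def form (B₀ : ℝ) (V : Plane → ℝ) (φ ψ : Dom B₀) : ℂ :=
  inner ℂ (momentum B₀ φ) (momentum B₀ ψ) +
    ∫ x, conj ((φ : L2) x) * (V x : ℂ) * (ψ : L2) x

/-- The distribution `x · ∇V` on the punctured plane, as a quadratic form on test functions:
`⟨η, x · ∇V η⟩ = -2 ⟨η, V η⟩ - 2 Re ⟨V η, x · ∇η⟩`. -/
noncomputable def virialTest (V : Plane → ℝ) (η : Plane → ℂ) : ℝ :=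
  -2 * (∫ x, V x * ‖η x‖ ^ 2) - 2 * (∫ x, (V x : ℂ) * conj (η x) * fderiv ℝ η x x).re

/-- The sesquilinear form `W` on `𝒟(P - A)` is an extension of the distribution `x · ∇V` that is
form bounded with respect to `(P - A)²`. Test functions being dense in `𝒟(P - A)`, there is at most
one such `W`. -/
structure IsVirial (B₀ : ℝ) (V : Plane → ℝ) (W : Dom B₀ →ₗ⋆[ℂ] Dom B₀ →ₗ[ℂ] ℂ) : Prop where
  extend : ∀ (η : Plane → ℂ), IsTest η → ∀ φ : Dom B₀, (φ : L2) =ᵐ[volume] η →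
    W φ φ = (virialTest V η : ℂ)
  bounded : ∃ a b : ℝ, ∀ φ : Dom B₀,
    ‖W φ φ‖ ≤ a * ‖momentum B₀ φ‖ ^ 2 + b * ‖(φ : L2)‖ ^ 2

/-- `φ` is supported in `{|x| ≥ R}`. -/
def SupportedOutside (R : ℝ) (φ : L2) : Prop :=
  ∀ᵐ x : Plane, ‖x‖ < R → φ x = 0

/-- `V` vanishes at infinity with respect to `(P - A)²`. -/
def VanishesAtInfinity (B₀ : ℝ) (V : Plane → ℝ) : Prop :=
  ∃ (R₀ : ℝ) (α γ : ℝ → ℝ), 0 < R₀ ∧ Tendsto α atTop (𝓝 0) ∧ Tendsto γ atTop (𝓝 0) ∧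
    ∀ R ≥ R₀, 0 < α R ∧ 0 < γ R ∧ ∀ φ : Dom B₀, SupportedOutside R φ →
      Integrable (fun x => V x * ‖(φ : L2) x‖ ^ 2) ∧
      |potentialQuad V φ| ≤ α R * ‖momentum B₀ φ‖ ^ 2 + γ R * ‖(φ : L2)‖ ^ 2

/-- `ω₁` bounds `|x| V₁` and `ω₂` bounds the form `W₂` of `x · ∇V₂` from above, at infinity and
relative to `(P - A)²`. -/
def HasAsymptoticBounds (B₀ : ℝ) (V₁ : Plane → ℝ) (W₂ : Dom B₀ →ₗ⋆[ℂ] Dom B₀ →ₗ[ℂ] ℂ)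
    (ω₁ ω₂ : ℝ) : Prop :=
  ∃ ε R w₁ w₂ : ℕ → ℝ, (∀ j, 0 < ε j ∧ 0 < R j ∧ 0 < w₁ j ∧ 0 < w₂ j) ∧
    Tendsto ε atTop (𝓝 0) ∧ Tendsto R atTop atTop ∧
    Tendsto w₁ atTop (𝓝 ω₁) ∧ Tendsto w₂ atTop (𝓝 ω₂) ∧
    ∀ (j : ℕ) (φ : Dom B₀), SupportedOutside (R j) φ →
      potentialQuad (fun x => (‖x‖ * V₁ x) ^ 2) φ
          ≤ ε j * ‖momentum B₀ φ‖ ^ 2 + w₁ j ^ 2 * ‖(φ : L2)‖ ^ 2 ∧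
      (W₂ φ φ).re ≤ ε j * ‖momentum B₀ φ‖ ^ 2 + w₂ j * ‖(φ : L2)‖ ^ 2

theorem memLp_dilation (t : ℝ) (φ : L2) :
    MemLp (fun x : Plane => (Real.exp t : ℂ) * φ (Real.exp t • x)) 2 volume := by
  refine MemLp.const_mul ?_ _
  refine MemLp.comp_of_map (f := fun x : Plane => Real.exp t • x) (g := φ) ?_ (by fun_prop)
  rw [Measure.map_addHaar_smul volume (Real.exp_pos t).ne']
  exact (Lp.memLp φ).smul_measure ENNReal.ofReal_ne_top

/-- The unitary dilation `(U_t φ)(x) = e^t φ(e^t x)` of the plane. -/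
noncomputable def dilation (t : ℝ) (φ : L2) : L2 := (memLp_dilation t φ).toLp _

/-- `i D_t = (U_t - U_{-t}) / (2 t)`. -/
noncomputable def iD (t : ℝ) (φ : L2) : L2 :=
  ((2 * t : ℝ) : ℂ)⁻¹ • (dilation t φ - dilation (-t) φ)

/-- `ψ` is in the domain of the operator `H` associated with the form `q`, and `H ψ = f`. -/
def HamiltonianMaps (B₀ : ℝ) (V : Plane → ℝ) (ψ f : L2) : Prop :=
  ∃ h : ψ ∈ Dom B₀, ∀ φ : Dom B₀, form B₀ V φ ⟨ψ, h⟩ = inner ℂ (φ : L2) f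

/-- `E` is an eigenvalue of the operator `H` associated with the form `q`. -/
def IsEigenvalue (B₀ : ℝ) (V : Plane → ℝ) (E : ℝ) : Prop :=
  ∃ ψ : L2, ψ ≠ 0 ∧ HamiltonianMaps B₀ V ψ ((E : ℂ) • ψ)

end AharonovBohm

namespace AharonovBohm

variable {B₀ : ℝ}

/-! ### The graph norm and density of test functions -/

/-! The vector potential A is homogeneous of degree −1 and orthogonal to x. Homogeneity gives
(P−A)U_t = e^t U_t(P−A), so dilations preserve the form domain. Orthogonality gives i x·(P−A) = x·∇,
so radial derivatives do not see the field.

Virial theorem. The kinetic part of 2 Re q(φ, iD_t φ) is (e^t − e^{−t})/t times Re⟨(P−A)φ,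
U_t(P−A)φ⟩ and converges because U_t is strongly continuous. Polarisation turns the potential part
into difference quotients of ⟨χ, Vχ⟩ along dilations, at χ = φ ± U_t φ (`re_potForm_iDDom`). On test
functions such quotients tend to −⟨χ, x·∇V χ⟩. Form boundedness of x·∇V makes them quadratic forms
bounded uniformly in t, so the limit extends to the whole domain and to arguments moving with t
(`tendsto_sub_dilDom_div`). The argument is run for any locally Lipschitz functional w that extends
the distribution. This is the form needed for V₁ + V₂, where the derivative of V₁ is moved onto φ
and only |x|V₁ is estimated (`exists_virial_add`).

Absence of eigenvalues. For an eigenfunction ψ take φ = e^F ψ, with F compactly supported, ∇F = g x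
and g ≥ 0. The conjugated equation (`exists_weighted`) tested with φ gives the energy identity
‖(P−A)φ‖² + ⟨V⟩ = E‖φ‖² + ⟨|x|²g²⟩. Tested with iD_t φ as t → 0, after completing a square, it gives
the virial inequality 2‖(P−A)φ‖² − w(φ) + ⟨x·∇(|x|²g²)⟩ ≤ ⟨(x·∇)²g⟩ (`IsWeighted.virial_le`).

These two relations are used twice. First, with F growing like M|x| up to a very large radius, φ
concentrates outside any fixed ball that ψ leaves. With t = ‖(P−A)φ‖/‖φ‖ the two relations then
read, up to small errors, E ≤ t² and 2t² ≤ ω₂ + 2ω₁t, which is impossible for E above the threshold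
(`exists_margin`). Hence ψ vanishes outside a ball (`ae_eq_zero_outside`). Second, on a bounded
support F may grow like a high power of |x|. Then ⟨x·∇(|x|²g²)⟩ dominates all other terms as the
strength M tends to infinity, which forces ψ = 0 (`eq_zero_of_ae_eq_zero_outside`). No decay of ψ is
needed beforehand, since every weight is bounded, and no unique continuation theorem enters. -/

theorem momentum_graph (B₀ : ℝ) : (momentum B₀).graph = (coreGraph B₀).topologicalClosure :=
  Submodule.toLinearPMap_graph_eq _ (coreGraph_closable B₀)

theorem mem_closure_coreGraph (φ : Dom B₀) :
    ((φ : L2), momentum B₀ φ) ∈ (coreGraph B₀).topologicalClosure :=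
  momentum_graph B₀ ▸ (momentum B₀).mem_graph φ

theorem exists_dom_of_mem_closure {f : L2} {h : L2Vec}
    (hm : (f, h) ∈ (coreGraph B₀).topologicalClosure) :
    ∃ φ : Dom B₀, (φ : L2) = f ∧ momentum B₀ φ = h := by
  rw [← momentum_graph, LinearPMap.mem_graph_iff] at hm
  exact hm

theorem exists_dom_of_tendsto {u : ℕ → Dom B₀} {f : L2} {h : L2Vec}
    (hf : Tendsto (fun n => (u n : L2)) atTop (𝓝 f))
    (hh : Tendsto (fun n => momentum B₀ (u n)) atTop (𝓝 h)) :
    ∃ φ : Dom B₀, (φ : L2) = f ∧ momentum B₀ φ = h :=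
  exists_dom_of_mem_closure <|
    (coreGraph B₀).isClosed_topologicalClosure.mem_of_tendsto (hf.prodMk_nhds hh)
      (Eventually.of_forall fun n => mem_closure_coreGraph (u n))

/-- The graph norm `‖φ‖ + ‖(P - A) φ‖` of the form domain. -/
noncomputable def gnorm (B₀ : ℝ) : Seminorm ℂ (Dom B₀) :=
  (normSeminorm ℂ L2).comp (Dom B₀).subtype + (normSeminorm ℂ L2Vec).comp (momentum B₀).toFun

theorem gnorm_apply (φ : Dom B₀) : gnorm B₀ φ = ‖(φ : L2)‖ + ‖momentum B₀ φ‖ := rfl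

theorem norm_le_gnorm (φ : Dom B₀) : ‖(φ : L2)‖ ≤ gnorm B₀ φ := by
  rw [gnorm_apply]; linarith [norm_nonneg (momentum B₀ φ)]

theorem norm_momentum_le_gnorm (φ : Dom B₀) : ‖momentum B₀ φ‖ ≤ gnorm B₀ φ := by
  rw [gnorm_apply]; linarith [norm_nonneg (φ : L2)]

theorem momentum_sub (φ ψ : Dom B₀) :
    momentum B₀ (φ - ψ) = momentum B₀ φ - momentum B₀ ψ := (momentum B₀).map_sub φ ψ

theorem momentum_smul (c : ℂ) (φ : Dom B₀) :
    momentum B₀ (c • φ) = c • momentum B₀ φ := (momentum B₀).map_smul c φ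

theorem gnorm_rsmul (c : ℝ) (φ : Dom B₀) : gnorm B₀ (c • φ) = |c| * gnorm B₀ φ := by
  have : c • φ = (c : ℂ) • φ := (Complex.coe_smul c φ).symm
  rw [this, map_smul_eq_mul, Complex.norm_real, Real.norm_eq_abs]

theorem tendsto_gnorm_sub_iff {ι : Type*} {l : Filter ι} {u : ι → Dom B₀} {φ : Dom B₀} :
    Tendsto (fun n => gnorm B₀ (u n - φ)) l (𝓝 0) ↔
      Tendsto (fun n => (u n : L2)) l (𝓝 φ) ∧
        Tendsto (fun n => momentum B₀ (u n)) l (𝓝 (momentum B₀ φ)) := by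
  rw [tendsto_iff_norm_sub_tendsto_zero (b := (φ : L2)),
    tendsto_iff_norm_sub_tendsto_zero (b := momentum B₀ φ)]
  have e1 : ∀ n, ‖(u n : L2) - φ‖ ≤ gnorm B₀ (u n - φ) := fun n => norm_le_gnorm (u n - φ)
  have e2 : ∀ n, ‖momentum B₀ (u n) - momentum B₀ φ‖ ≤ gnorm B₀ (u n - φ) := fun n => by
    rw [← momentum_sub]; exact norm_momentum_le_gnorm _
  refine ⟨fun h => ⟨squeeze_zero (fun _ => norm_nonneg _) e1 h,
    squeeze_zero (fun _ => norm_nonneg _) e2 h⟩, fun h => ?_⟩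
  have := h.1.add h.2
  rw [add_zero] at this
  refine this.congr fun n => ?_
  rw [gnorm_apply, momentum_sub]
  rfl

/-! ### Test functions inside the form domain -/

/-- The element `φ` of the form domain is represented by the test function `η`. -/
structure Represents (φ : Dom B₀) (η : Plane → ℂ) : Prop where
  test : IsTest η
  ae_eq : (φ : L2) =ᵐ[volume] η

theorem IsTest.continuous_momentumTest {η : Plane → ℂ} (h : IsTest η) :
    Continuous (momentumTest B₀ η) := by
  refine (PiLp.continuous_toLp 2 _).comp (continuous_pi fun j => ?_)
  exact (continuous_const.mul (continuous_fderiv_test h _)).sub (continuous_abPotential_mul B₀ h j)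

theorem momentumTest_eq_zero {η : Plane → ℂ} {x : Plane} (hx : x ∉ tsupport η) :
    momentumTest B₀ η x = 0 := by
  have h1 : η x = 0 := image_eq_zero_of_notMem_tsupport hx
  have h2 : fderiv ℝ η x = 0 := by
    by_contra h
    exact hx (support_fderiv_subset ℝ (Function.mem_support.2 h))
  ext j
  simp [momentumTest, h1, h2]

theorem IsTest.hasCompactSupport_momentumTest {η : Plane → ℂ} (h : IsTest η) :
    HasCompactSupport (momentumTest B₀ η) :=
  HasCompactSupport.intro h.compact fun _ hx => momentumTest_eq_zero hx

theorem IsTest.memLp {η : Plane → ℂ} (h : IsTest η) : MemLp η 2 (volume : Measure Plane) :=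
  h.smooth.continuous.memLp_of_hasCompactSupport h.compact

theorem IsTest.memLp_momentumTest {η : Plane → ℂ} (h : IsTest η) :
    MemLp (momentumTest B₀ η) 2 (volume : Measure Plane) :=
  h.continuous_momentumTest.memLp_of_hasCompactSupport h.hasCompactSupport_momentumTest

/-- The classical pair lies on the closed graph, and closability makes that graph single valued. -/
theorem Represents.momentum_ae_eq {φ : Dom B₀} {η : Plane → ℂ} (h : Represents φ η) :
    momentum B₀ φ =ᵐ[volume] momentumTest B₀ η := by
  have hm := h.test.memLp_momentumTest (B₀ := B₀)
  have h1 : ((φ : L2), hm.toLp _) ∈ (momentum B₀).graph := by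
    rw [momentum_graph]
    exact subset_closure ⟨η, h.test, h.ae_eq, hm.coeFn_toLp⟩
  have h2 : momentum B₀ φ = hm.toLp _ :=
    (momentum B₀).mem_graph_snd_inj ((momentum B₀).mem_graph φ) h1 rfl
  rw [h2]
  exact hm.coeFn_toLp

theorem IsTest.exists_represents (B₀ : ℝ) {η : Plane → ℂ} (h : IsTest η) :
    ∃ φ : Dom B₀, Represents φ η := by
  obtain ⟨φ, h1, -⟩ := exists_dom_of_mem_closure (B₀ := B₀) (f := h.memLp.toLp η)
    (h := h.memLp_momentumTest.toLp _)
    (subset_closure ⟨η, h, h.memLp.coeFn_toLp, h.memLp_momentumTest.coeFn_toLp⟩)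
  exact ⟨φ, h, by rw [h1]; exact h.memLp.coeFn_toLp⟩

theorem exists_seq_represents (φ : Dom B₀) :
    ∃ u : ℕ → Dom B₀, (∀ n, ∃ η, Represents (u n) η) ∧
      Tendsto (fun n => gnorm B₀ (u n - φ)) atTop (𝓝 0) := by
  obtain ⟨p, hp, hlim⟩ := mem_closure_iff_seq_limit.1 (mem_closure_coreGraph φ)
  have : ∀ n, ∃ χ : Dom B₀, (χ : L2) = (p n).1 ∧ momentum B₀ χ = (p n).2 := fun n =>
    exists_dom_of_mem_closure (subset_closure (hp n))
  choose u hu1 hu2 using this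
  refine ⟨u, fun n => ?_, tendsto_gnorm_sub_iff.2 ⟨?_, ?_⟩⟩
  · obtain ⟨η, h1, h2, -⟩ := hp n
    exact ⟨η, h1, by rw [hu1]; exact h2⟩
  · simpa only [hu1, Function.comp_def] using (continuous_fst.tendsto _).comp hlim
  · simpa only [hu2, Function.comp_def] using (continuous_snd.tendsto _).comp hlim

/-- A property of elements of the form domain that is closed under limits in the graph norm holds
everywhere as soon as it holds for test functions. -/
theorem dom_induction {p : Dom B₀ → Prop}
    (hlim : ∀ (u : ℕ → Dom B₀) (φ : Dom B₀), Tendsto (fun n => gnorm B₀ (u n - φ)) atTop (𝓝 0) →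
      (∀ n, p (u n)) → p φ)
    (htest : ∀ φ η, Represents φ η → p φ) (φ : Dom B₀) : p φ := by
  obtain ⟨u, hu, hlim'⟩ := exists_seq_represents φ
  exact hlim u φ hlim' fun n => (hu n).elim fun η h => htest _ η h

/-! ### Bounded quadratic forms are locally Lipschitz -/

/-- `w` is locally Lipschitz on `𝒟(P - A)`, as bounded quadratic forms are. -/
def IsQuadLip (w : Dom B₀ → ℝ) : Prop :=
  ∃ C : ℝ, 0 ≤ C ∧ ∀ φ ψ, |w φ - w ψ| ≤ C * gnorm B₀ (φ - ψ) * (gnorm B₀ φ + gnorm B₀ ψ)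

theorem gnorm_tendsto {ι : Type*} {l : Filter ι} {u : ι → Dom B₀} {φ : Dom B₀}
    (h : Tendsto (fun n => gnorm B₀ (u n - φ)) l (𝓝 0)) :
    Tendsto (fun n => gnorm B₀ (u n)) l (𝓝 (gnorm B₀ φ)) := by
  rw [tendsto_iff_norm_sub_tendsto_zero]
  refine squeeze_zero (fun _ => norm_nonneg _) (fun n => ?_) h
  exact abs_sub_map_le_sub (gnorm B₀) (u n) φ

theorem IsQuadLip.tendsto {w : Dom B₀ → ℝ} (hw : IsQuadLip w) {ι : Type*} {l : Filter ι}
    {u : ι → Dom B₀} {φ : Dom B₀}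
    (h : Tendsto (fun n => gnorm B₀ (u n - φ)) l (𝓝 0)) :
    Tendsto (fun n => w (u n)) l (𝓝 (w φ)) := by
  obtain ⟨C, hC, H⟩ := hw
  rw [tendsto_iff_norm_sub_tendsto_zero]
  refine squeeze_zero (fun _ => norm_nonneg _) (fun n => H (u n) φ) ?_
  have := (h.const_mul C).mul ((gnorm_tendsto h).add_const (gnorm B₀ φ))
  simpa using this

theorem IsQuadLip.add {w w' : Dom B₀ → ℝ} (hw : IsQuadLip w) (hw' : IsQuadLip w') :
    IsQuadLip (fun φ => w φ + w' φ) := by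
  obtain ⟨C, hC, H⟩ := hw
  obtain ⟨C', hC', H'⟩ := hw'
  refine ⟨C + C', by positivity, fun φ ψ => ?_⟩
  have := abs_add_le (w φ - w ψ) (w' φ - w' ψ)
  calc |w φ + w' φ - (w ψ + w' ψ)| = |(w φ - w ψ) + (w' φ - w' ψ)| := by ring_nf
    _ ≤ _ := this.trans (by linarith [H φ ψ, H' φ ψ])

theorem IsQuadLip.const_mul {w : Dom B₀ → ℝ} (hw : IsQuadLip w) (c : ℝ) :
    IsQuadLip (fun φ => c * w φ) := by
  obtain ⟨C, hC, H⟩ := hw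
  refine ⟨|c| * C, by positivity, fun φ ψ => ?_⟩
  rw [← mul_sub, abs_mul]
  calc _ ≤ |c| * _ := mul_le_mul_of_nonneg_left (H φ ψ) (abs_nonneg c)
    _ = _ := by ring

/-- Bounded quadratic forms are locally Lipschitz, by polarisation. -/
theorem quadraticForm_sub_le (Q : QuadraticForm ℝ (Dom B₀)) {C : ℝ} (hC : 0 ≤ C)
    (h : ∀ φ, |Q φ| ≤ C * gnorm B₀ φ ^ 2) (φ ψ : Dom B₀) :
    |Q φ - Q ψ| ≤ 6 * C * gnorm B₀ (φ - ψ) * (gnorm B₀ φ + gnorm B₀ ψ) := by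
  -- The factor 3 is 2 from the value at a + b and 1 from the values at a and b.
  have hp : ∀ a b : Dom B₀, |QuadraticMap.polar Q a b| ≤ 3 * C * (gnorm B₀ a ^ 2 + gnorm B₀ b ^ 2) := by
    intro a b
    have h1 := abs_le.1 (h (a + b))
    have h2 := abs_le.1 (h a)
    have h3 := abs_le.1 (h b)
    have h4 : gnorm B₀ (a + b) ^ 2 ≤ 2 * (gnorm B₀ a ^ 2 + gnorm B₀ b ^ 2) := by
      have := map_add_le_add (gnorm B₀) a b
      have h0 := apply_nonneg (gnorm B₀) (a + b)
      nlinarith [sq_nonneg (gnorm B₀ a - gnorm B₀ b)]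
    have h5 := mul_le_mul_of_nonneg_left h4 hC
    rw [QuadraticMap.polar, abs_le]
    constructor <;> linarith
  -- Normalising both arguments turns the sum of squares into a product. Division is by s > `gnorm
  -- B₀ a` and t > `gnorm B₀ b`, which avoids the case of a vanishing seminorm; then s and t
  -- decrease to these values.
  have hp' : ∀ a b : Dom B₀, |QuadraticMap.polar Q a b| ≤ 6 * C * gnorm B₀ a * gnorm B₀ b := by
    intro a b
    have key : ∀ s t : ℝ, gnorm B₀ a < s → gnorm B₀ b < t →
        |QuadraticMap.polar Q a b| ≤ 6 * C * s * t := by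
      intro s t hs ht
      have ha0 := apply_nonneg (gnorm B₀) a
      have hb0 := apply_nonneg (gnorm B₀) b
      have hs0 : 0 < s := ha0.trans_lt hs
      have ht0 : 0 < t := hb0.trans_lt ht
      have e := hp (s⁻¹ • a) (t⁻¹ • b)
      rw [QuadraticMap.polar_smul_left, QuadraticMap.polar_smul_right, smul_smul, smul_eq_mul,
        abs_mul, gnorm_rsmul, gnorm_rsmul, abs_of_pos (by positivity : 0 < s⁻¹ * t⁻¹),
        abs_of_pos (by positivity : 0 < s⁻¹), abs_of_pos (by positivity : 0 < t⁻¹)] at e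
      have e1 : s⁻¹ * gnorm B₀ a ≤ 1 := by
        rw [inv_mul_le_iff₀ hs0]; linarith
      have e2 : t⁻¹ * gnorm B₀ b ≤ 1 := by
        rw [inv_mul_le_iff₀ ht0]; linarith
      have e3 : (s⁻¹ * gnorm B₀ a) ^ 2 ≤ 1 := pow_le_one₀ (by positivity) e1
      have e4 : (t⁻¹ * gnorm B₀ b) ^ 2 ≤ 1 := pow_le_one₀ (by positivity) e2
      have e5 : s⁻¹ * t⁻¹ * |QuadraticMap.polar Q a b| ≤ 6 * C := by
        refine e.trans ?_
        have := mul_le_mul_of_nonneg_left (add_le_add e3 e4) (by positivity : 0 ≤ 3 * C)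
        linarith
      calc |QuadraticMap.polar Q a b| = s * t * (s⁻¹ * t⁻¹ * |QuadraticMap.polar Q a b|) := by
            field_simp
        _ ≤ s * t * (6 * C) := mul_le_mul_of_nonneg_left e5 (by positivity)
        _ = _ := by ring
    have hlim : Tendsto (fun n : ℕ => 6 * C * (gnorm B₀ a + 1 / ((n : ℝ) + 1)) *
        (gnorm B₀ b + 1 / ((n : ℝ) + 1))) atTop (𝓝 (6 * C * (gnorm B₀ a + 0) * (gnorm B₀ b + 0))) :=
      ((tendsto_one_div_add_atTop_nhds_zero_nat.const_add _).const_mul _).mul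
        (tendsto_one_div_add_atTop_nhds_zero_nat.const_add _)
    rw [add_zero, add_zero] at hlim
    refine ge_of_tendsto hlim (Eventually.of_forall fun n => ?_)
    have : (0 : ℝ) < 1 / ((n : ℝ) + 1) := by positivity
    exact key _ _ (by linarith) (by linarith)
  have e : Q φ - Q ψ = QuadraticMap.polar Q ((1 / 2 : ℝ) • (φ - ψ)) (φ + ψ) := by
    have e1 : QuadraticMap.polar Q (φ - ψ) (φ + ψ) = 2 * (Q φ - Q ψ) := by
      rw [sub_eq_add_neg, QuadraticMap.polar_add_left, QuadraticMap.polar_add_right,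
        QuadraticMap.polar_neg_left, QuadraticMap.polar_add_right, QuadraticMap.polar_self,
        QuadraticMap.polar_self, QuadraticMap.polar_comm Q ψ φ]
      simp only [two_smul]
      ring
    rw [QuadraticMap.polar_smul_left, e1, smul_eq_mul]
    ring
  rw [e]
  refine (hp' _ _).trans ?_
  rw [gnorm_rsmul, abs_of_pos (by norm_num : (0 : ℝ) < 1 / 2)]
  have h1 := map_add_le_add (gnorm B₀) φ ψ
  have h2 : 0 ≤ C * gnorm B₀ (φ - ψ) := mul_nonneg hC (apply_nonneg _ _)
  have h3 := apply_nonneg (gnorm B₀) (φ + ψ)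
  nlinarith

theorem isQuadLip_of_quadraticForm (Q : QuadraticForm ℝ (Dom B₀)) {C : ℝ} (hC : 0 ≤ C)
    (h : ∀ φ, |Q φ| ≤ C * gnorm B₀ φ ^ 2) : IsQuadLip Q :=
  ⟨6 * C, by positivity, quadraticForm_sub_le Q hC h⟩

theorem rsmul_eq (c : ℝ) (φ : Dom B₀) : c • φ = (c : ℂ) • φ := (Complex.coe_smul c φ).symm

/-- The real quadratic form of a sesquilinear form. -/
noncomputable def sesqQuad (W : Dom B₀ →ₗ⋆[ℂ] Dom B₀ →ₗ[ℂ] ℂ) : QuadraticForm ℝ (Dom B₀) :=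
  LinearMap.BilinMap.toQuadraticMap <|
    LinearMap.mk₂ ℝ (fun φ ψ => (W φ ψ).re) (fun _ _ _ => by simp)
      (fun c φ ψ => by
        change (W (c • φ) ψ).re = _
        rw [rsmul_eq, map_smulₛₗ]
        simp)
      (fun _ _ _ => by simp)
      (fun c φ ψ => (congrArg (fun χ => (W φ χ).re) (rsmul_eq c ψ)).trans (by simp))

theorem sesqQuad_apply (W : Dom B₀ →ₗ⋆[ℂ] Dom B₀ →ₗ[ℂ] ℂ) (φ : Dom B₀) :
    sesqQuad W φ = (W φ φ).re := rfl

theorem quad_bound_le_gnorm (a b : ℝ) (φ : Dom B₀) :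
    a * ‖momentum B₀ φ‖ ^ 2 + b * ‖(φ : L2)‖ ^ 2 ≤ (|a| + |b|) * gnorm B₀ φ ^ 2 := by
  have h1 := norm_le_gnorm φ
  have h2 := norm_momentum_le_gnorm φ
  have h3 : ‖(φ : L2)‖ ^ 2 ≤ gnorm B₀ φ ^ 2 := by gcongr
  have h4 : ‖momentum B₀ φ‖ ^ 2 ≤ gnorm B₀ φ ^ 2 := by gcongr
  calc _ ≤ |a| * ‖momentum B₀ φ‖ ^ 2 + |b| * ‖(φ : L2)‖ ^ 2 := by
        gcongr <;> exact le_abs_self _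
    _ ≤ |a| * gnorm B₀ φ ^ 2 + |b| * gnorm B₀ φ ^ 2 := by gcongr
    _ = _ := by ring

theorem IsVirial.isQuadLip {V : Plane → ℝ} {W : Dom B₀ →ₗ⋆[ℂ] Dom B₀ →ₗ[ℂ] ℂ}
    (h : IsVirial B₀ V W) : IsQuadLip (fun φ => (W φ φ).re) := by
  obtain ⟨a, b, hab⟩ := h.bounded
  refine isQuadLip_of_quadraticForm (sesqQuad W) (C := |a| + |b|) (by positivity) fun φ => ?_
  exact (Complex.abs_re_le_norm _).trans ((hab φ).trans (quad_bound_le_gnorm a b φ))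

/-! ### Dilations -/

theorem quasiMeasurePreserving_exp_smul (t : ℝ) :
    Measure.QuasiMeasurePreserving (fun x : Plane => Real.exp t • x) volume volume := by
  refine ⟨by fun_prop, ?_⟩
  rw [Measure.map_addHaar_smul volume (Real.exp_pos t).ne']
  exact Measure.smul_absolutelyContinuous

theorem integral_comp_exp_smul {G : Type*} [NormedAddCommGroup G] [NormedSpace ℝ G] (t : ℝ)
    (f : Plane → G) :
    ∫ x : Plane, f (Real.exp t • x) = Real.exp (-(2 * t)) • ∫ x, f x := by
  rw [Measure.integral_comp_smul]
  congr 1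
  rw [finrank_euclideanSpace_fin, abs_of_pos (by positivity), ← Real.exp_nat_mul, ← Real.exp_neg]
  norm_num

section Dilation

variable {E : Type*} [NormedAddCommGroup E] [InnerProductSpace ℂ E]

theorem memLp_dil (t : ℝ) (f : Lp E 2 (volume : Measure Plane)) :
    MemLp (fun x : Plane => (Real.exp t : ℂ) • f (Real.exp t • x)) 2 volume := by
  refine MemLp.const_smul ?_ _
  refine MemLp.comp_of_map (f := fun x : Plane => Real.exp t • x) (g := f) ?_ (by fun_prop)
  rw [Measure.map_addHaar_smul volume (Real.exp_pos t).ne']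
  exact (Lp.memLp f).smul_measure ENNReal.ofReal_ne_top

/-- The unitary dilations of vector valued square integrable functions. -/
noncomputable def dil (t : ℝ) :
    Lp E 2 (volume : Measure Plane) →ₗ[ℂ] Lp E 2 (volume : Measure Plane) where
  toFun f := (memLp_dil t f).toLp _
  map_add' f g := by
    ext1
    filter_upwards [(memLp_dil t (f + g)).coeFn_toLp, (memLp_dil t f).coeFn_toLp,
      (memLp_dil t g).coeFn_toLp, Lp.coeFn_add ((memLp_dil t f).toLp _) ((memLp_dil t g).toLp _),
      (quasiMeasurePreserving_exp_smul t).ae (Lp.coeFn_add f g)] with x h1 h2 h3 h4 h5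
    rw [h1, h4, Pi.add_apply, h2, h3, h5, Pi.add_apply, smul_add]
  map_smul' c f := by
    ext1
    filter_upwards [(memLp_dil t (c • f)).coeFn_toLp, (memLp_dil t f).coeFn_toLp,
      Lp.coeFn_smul c ((memLp_dil t f).toLp _),
      (quasiMeasurePreserving_exp_smul t).ae (Lp.coeFn_smul c f)] with x h1 h2 h4 h5
    rw [h1, RingHom.id_apply, h4, Pi.smul_apply, h2, h5, Pi.smul_apply, smul_comm]

theorem dil_ae (t : ℝ) (f : Lp E 2 (volume : Measure Plane)) :
    dil t f =ᵐ[volume] fun x => (Real.exp t : ℂ) • f (Real.exp t • x) :=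
  (memLp_dil t f).coeFn_toLp

theorem dil_ae_of_ae {t : ℝ} {f : Lp E 2 (volume : Measure Plane)} {g : Plane → E}
    (h : f =ᵐ[volume] g) : dil t f =ᵐ[volume] fun x => (Real.exp t : ℂ) • g (Real.exp t • x) := by
  filter_upwards [dil_ae t f, (quasiMeasurePreserving_exp_smul t).ae h] with x h1 h2
  rw [h1, h2]

theorem dil_dil (s t : ℝ) (f : Lp E 2 (volume : Measure Plane)) :
    dil s (dil t f) = dil (s + t) f := by
  ext1
  filter_upwards [dil_ae_of_ae (t := s) (dil_ae t f), dil_ae (s + t) f] with x h1 h2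
  rw [h1, h2, smul_smul, smul_smul, ← Complex.ofReal_mul, ← Real.exp_add, ← Real.exp_add,
    add_comm t s]

theorem dil_zero (f : Lp E 2 (volume : Measure Plane)) : dil 0 f = f := by
  ext1
  filter_upwards [dil_ae 0 f] with x h1
  rw [h1]
  simp

/-- Change of variables: the planar Jacobian e^{−2t} turns the factor e^t into e^{−t}. -/
theorem inner_dil_left (t : ℝ) (f g : Lp E 2 (volume : Measure Plane)) :
    inner ℂ (dil t f) g = inner ℂ f (dil (-t) g) := by
  rw [L2.inner_def, L2.inner_def]
  have e1 : ∫ x : Plane, inner ℂ (dil t f x) (g x) =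
      ∫ x : Plane, (fun y => (Real.exp t : ℂ) * inner ℂ (f y) (g (Real.exp (-t) • y)))
        (Real.exp t • x) := by
    refine integral_congr_ae ?_
    filter_upwards [dil_ae t f] with x h1
    rw [h1, inner_smul_left, Complex.conj_ofReal, smul_smul, ← Real.exp_add]
    simp
  rw [e1, integral_comp_exp_smul t fun y =>
    (Real.exp t : ℂ) * inner ℂ (f y) (g (Real.exp (-t) • y)), ← integral_smul]
  refine integral_congr_ae ?_
  filter_upwards [dil_ae (-t) g] with x h1
  rw [h1, inner_smul_right, Complex.real_smul, ← mul_assoc, ← Complex.ofReal_mul, ← Real.exp_add]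
  ring_nf

theorem norm_dil (t : ℝ) (f : Lp E 2 (volume : Measure Plane)) : ‖dil t f‖ = ‖f‖ := by
  have h : ‖dil t f‖ ^ 2 = ‖f‖ ^ 2 := by
    rw [← inner_self_eq_norm_sq (𝕜 := ℂ), ← inner_self_eq_norm_sq (𝕜 := ℂ), inner_dil_left,
      dil_dil, neg_add_cancel, dil_zero]
  exact (pow_left_inj₀ (norm_nonneg _) (norm_nonneg _) two_ne_zero).1 h

/-- For isometries, ‖U_t G − G‖² = 2‖G‖² − 2 Re⟨G, U_t G⟩, so for continuous G of compact support it
is enough that a scalar integral converges. Density and the uniform bound ‖U_t‖ = 1 give the rest.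
-/
theorem tendsto_dil [FiniteDimensional ℂ E] (f : Lp E 2 (volume : Measure Plane)) :
    Tendsto (fun t => dil t f) (𝓝 0) (𝓝 f) := by
  have hcont : ∀ g : Plane → E, Continuous g → HasCompactSupport g →
      ∀ G : Lp E 2 (volume : Measure Plane), G =ᵐ[volume] g →
        Tendsto (fun t => dil t G) (𝓝 0) (𝓝 G) := by
    intro g hg hgc G hG
    obtain ⟨C, hC⟩ := hgc.exists_bound_of_continuous hg
    -- The fixed factor g localises the integrand, so the moving support of the dilated function is
    -- irrelevant; e bounds e^t for |t| < 1.
    have hint : Integrable (fun x => Real.exp 1 * C * ‖g x‖) (volume : Measure Plane) :=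
      ((hg.integrable_of_hasCompactSupport hgc).norm).const_mul _
    have hin : Tendsto (fun t => inner ℂ G (dil t G)) (𝓝 0) (𝓝 (inner ℂ G G)) := by
      have e : ∀ t, inner ℂ G (dil t G) =
          ∫ x, inner ℂ (g x) ((Real.exp t : ℂ) • g (Real.exp t • x)) := by
        intro t
        rw [L2.inner_def]
        refine integral_congr_ae ?_
        filter_upwards [hG, dil_ae_of_ae (t := t) hG] with x h1 h2
        rw [h1, h2]
      have e0 : inner ℂ G G = ∫ x, inner ℂ (g x) (g x) := by
        rw [L2.inner_def]
        refine integral_congr_ae ?_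
        filter_upwards [hG] with x h1
        rw [h1]
      simp only [e]
      rw [e0]
      refine tendsto_integral_filter_of_dominated_convergence _ ?_ ?_ hint ?_
      · exact Eventually.of_forall fun t => by
          refine Continuous.aestronglyMeasurable ?_
          fun_prop
      · filter_upwards [Metric.ball_mem_nhds (0 : ℝ) one_pos] with t ht
        refine Eventually.of_forall fun x => ?_
        have ht1 : Real.exp t ≤ Real.exp 1 := Real.exp_le_exp.2 (by
          have := abs_lt.1 (by simpa using ht : |t| < 1); linarith)
        calc _ ≤ ‖g x‖ * ‖(Real.exp t : ℂ) • g (Real.exp t • x)‖ := norm_inner_le_norm _ _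
          _ = ‖g x‖ * (Real.exp t * ‖g (Real.exp t • x)‖) := by
            rw [norm_smul, Complex.norm_real, Real.norm_of_nonneg (Real.exp_pos t).le]
          _ ≤ ‖g x‖ * (Real.exp 1 * C) := by gcongr; exact hC _
          _ = _ := by ring
      · refine Eventually.of_forall fun x => ?_
        have : Continuous fun t : ℝ => inner ℂ (g x) ((Real.exp t : ℂ) • g (Real.exp t • x)) := by
          fun_prop
        simpa using this.tendsto 0
    rw [tendsto_iff_norm_sub_tendsto_zero]
    have e : ∀ t, ‖dil t G - G‖ =
        Real.sqrt (2 * ‖G‖ ^ 2 - 2 * (inner ℂ G (dil t G)).re) := by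
      intro t
      rw [eq_comm, Real.sqrt_eq_iff_eq_sq _ (norm_nonneg _), norm_sub_rev, @norm_sub_sq ℂ,
        norm_dil]
      · simp; ring
      · have := (Complex.re_le_norm (inner ℂ G (dil t G))).trans (norm_inner_le_norm G (dil t G))
        rw [norm_dil] at this
        nlinarith
    simp only [e]
    have h0 : Tendsto (fun t => Real.sqrt (2 * ‖G‖ ^ 2 - 2 * (inner ℂ G (dil t G)).re)) (𝓝 0)
        (𝓝 (Real.sqrt (2 * ‖G‖ ^ 2 - 2 * (inner ℂ G G).re))) :=
      (Real.continuous_sqrt.tendsto _).comp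
        (((Complex.continuous_re.tendsto _).comp hin).const_mul 2 |>.const_sub _)
    have h1 : (inner ℂ G G).re = ‖G‖ ^ 2 := inner_self_eq_norm_sq (𝕜 := ℂ) G
    rwa [h1, sub_self, Real.sqrt_zero] at h0
  rw [Metric.tendsto_nhds]
  intro ε hε
  obtain ⟨g, hgc, hge, hg, hgm⟩ := (Lp.memLp f).exists_hasCompactSupport_eLpNorm_sub_le
    (by norm_num) (ε := ENNReal.ofReal (ε / 4)) (by simpa using hε)
  set G := hgm.toLp g
  have hGf : ‖f - G‖ ≤ ε / 4 := by
    rw [Lp.norm_def]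
    refine ENNReal.toReal_le_of_le_ofReal (by positivity) (le_trans (le_of_eq ?_) hge)
    refine eLpNorm_congr_ae ?_
    filter_upwards [Lp.coeFn_sub f G, hgm.coeFn_toLp] with x h1 h2
    rw [h1, Pi.sub_apply, Pi.sub_apply, h2]
  filter_upwards [Metric.tendsto_nhds.1 (hcont g hg hgc G hgm.coeFn_toLp) (ε / 4) (by positivity)]
    with t ht
  rw [dist_eq_norm] at ht ⊢
  have e : dil t f - f = dil t (f - G) + (dil t G - G) - (f - G) := by
    rw [map_sub]; abel
  rw [e]
  have h1 := norm_sub_le (dil t (f - G) + (dil t G - G)) (f - G)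
  have h2 := norm_add_le (dil t (f - G)) (dil t G - G)
  rw [norm_dil] at h2
  linarith

end Dilation

/-! ### Dilations of test functions and of the form domain -/

theorem IsTest.dilate {η : Plane → ℂ} (h : IsTest η) (t : ℝ) :
    IsTest (fun x => η (Real.exp t • x)) := by
  have hs : tsupport (fun x => η (Real.exp t • x)) = (fun x => Real.exp t • x) ⁻¹' tsupport η :=
    tsupport_comp_eq_preimage η (Homeomorph.smulOfNeZero _ (Real.exp_pos t).ne')
  refine ⟨h.smooth.comp (contDiff_const_smul _), ?_, ?_⟩
  · exact h.compact.comp_homeomorph (Homeomorph.smulOfNeZero _ (Real.exp_pos t).ne')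
  · rw [hs]
    simpa using h.away

theorem fderiv_comp_exp_smul {η : Plane → ℂ} (h : Differentiable ℝ η) (t : ℝ) (x v : Plane) :
    fderiv ℝ (fun x => η (Real.exp t • x)) x v = Real.exp t * fderiv ℝ η (Real.exp t • x) v := by
  have h1 : HasFDerivAt (fun x : Plane => Real.exp t • x)
      (Real.exp t • ContinuousLinearMap.id ℝ Plane) x :=
    (Real.exp t • ContinuousLinearMap.id ℝ Plane).hasFDerivAt
  have h2 := ((h (Real.exp t • x)).hasFDerivAt.comp x h1).fderiv
  simp only [Function.comp_def] at h2
  rw [h2]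
  simp

/-- Homogeneity of degree −1, the source of the covariance of P − A. At the origin both sides vanish
because division by zero gives zero. -/
theorem abPotential_exp_smul (t : ℝ) (x : Plane) (j : Fin 2) :
    abPotential B₀ x j = Real.exp t * abPotential B₀ (Real.exp t • x) j := by
  have h0 := (Real.exp_pos t).ne'
  have hn : ‖Real.exp t • x‖ = Real.exp t * ‖x‖ := by
    rw [norm_smul, Real.norm_of_nonneg (Real.exp_pos t).le]
  simp only [abPotential, hn, PiLp.smul_apply, smul_eq_mul]
  rcases eq_or_ne ‖x‖ 0 with hx | hx
  · simp [hx]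
  · fin_cases j <;> simp <;> field_simp

theorem momentumTest_dilate {η : Plane → ℂ} (h : IsTest η) (t : ℝ) (x : Plane) :
    momentumTest B₀ (fun x => (Real.exp t : ℂ) * η (Real.exp t • x)) x =
      (Real.exp t : ℂ) • (Real.exp t : ℂ) • momentumTest B₀ η (Real.exp t • x) := by
  rw [momentumTest_smul B₀ _ (h.dilate t)]
  congr 1
  ext j
  simp only [momentumTest, fderiv_comp_exp_smul h.differentiable, PiLp.smul_apply, smul_eq_mul]
  rw [abPotential_exp_smul t x j]
  push_cast
  ring

theorem tendsto_dil_of_tendsto {E : Type*} [NormedAddCommGroup E] [InnerProductSpace ℂ E]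
    {ι : Type*} {l : Filter ι} {u : ι → Lp E 2 (volume : Measure Plane)}
    {f : Lp E 2 (volume : Measure Plane)} (t : ℝ)
    (h : Tendsto u l (𝓝 f)) : Tendsto (fun n => dil t (u n)) l (𝓝 (dil t f)) := by
  rw [tendsto_iff_norm_sub_tendsto_zero] at h ⊢
  simpa only [← map_sub, norm_dil] using h

/-- The covariance (P−A)U_t = e^t U_t(P−A) holds on test functions and survives graph limits, since
U_t is isometric in both components. -/
theorem exists_dom_dil (t : ℝ) (φ : Dom B₀) : ∃ χ : Dom B₀, (χ : L2) = dil t (φ : L2) ∧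
    momentum B₀ χ = (Real.exp t : ℂ) • dil t (momentum B₀ φ) := by
  revert φ
  refine dom_induction (fun u φ hlim hu => ?_) fun φ η h => ?_
  · choose χ h1 h2 using hu
    obtain ⟨l1, l2⟩ := tendsto_gnorm_sub_iff.1 hlim
    refine exists_dom_of_tendsto (u := χ) ?_ ?_
    · simpa only [h1] using tendsto_dil_of_tendsto t l1
    · simpa only [h2] using (tendsto_dil_of_tendsto t l2).const_smul (Real.exp t : ℂ)
  · refine exists_dom_of_mem_closure (subset_closure ⟨_, (h.test.dilate t).smul (Real.exp t), ?_, ?_⟩)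
    · simpa only [smul_eq_mul] using dil_ae_of_ae (t := t) h.ae_eq
    · filter_upwards [Lp.coeFn_smul (Real.exp t : ℂ) (dil t (momentum B₀ φ)),
        dil_ae_of_ae (t := t) h.momentum_ae_eq] with x h1 h2
      rw [h1, Pi.smul_apply, h2, momentumTest_dilate h.test]

/-- Dilations on the form domain. -/
noncomputable def dilDom (t : ℝ) : Dom B₀ →ₗ[ℂ] Dom B₀ :=
  (dil t : L2 →ₗ[ℂ] L2).restrict fun φ hφ => by
    obtain ⟨χ, h, -⟩ := exists_dom_dil t ⟨φ, hφ⟩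
    exact h ▸ χ.2

theorem coe_dilDom (t : ℝ) (φ : Dom B₀) : (dilDom t φ : L2) = dil t (φ : L2) := rfl

theorem momentum_dilDom (t : ℝ) (φ : Dom B₀) :
    momentum B₀ (dilDom t φ) = (Real.exp t : ℂ) • dil t (momentum B₀ φ) := by
  obtain ⟨χ, h1, h2⟩ := exists_dom_dil t φ
  have : dilDom t φ = χ := Subtype.ext h1.symm
  rw [this, h2]

theorem dilDom_dilDom (s t : ℝ) (φ : Dom B₀) : dilDom s (dilDom t φ) = dilDom (s + t) φ :=
  Subtype.ext (dil_dil s t _)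

theorem dilDom_zero (φ : Dom B₀) : dilDom 0 φ = φ := Subtype.ext (dil_zero _)

theorem Represents.dilate {φ : Dom B₀} {η : Plane → ℂ} (h : Represents φ η) (t : ℝ) :
    Represents (dilDom t φ) (fun x => (Real.exp t : ℂ) * η (Real.exp t • x)) :=
  ⟨(h.test.dilate t).smul _, by
    rw [coe_dilDom]; simpa only [smul_eq_mul] using dil_ae_of_ae (t := t) h.ae_eq⟩

theorem gnorm_dilDom_le {t : ℝ} (ht : |t| ≤ 1) (φ : Dom B₀) :
    gnorm B₀ (dilDom t φ) ≤ 3 * gnorm B₀ φ := by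
  rw [gnorm_apply, gnorm_apply, momentum_dilDom, coe_dilDom, norm_smul, norm_dil, norm_dil,
    Complex.norm_real, Real.norm_of_nonneg (Real.exp_pos t).le]
  have h1 : Real.exp t ≤ 3 := by
    have := Real.exp_le_exp.2 (abs_le.1 ht).2
    linarith [Real.exp_one_lt_d9]
  nlinarith [norm_nonneg (φ : L2), norm_nonneg (momentum B₀ φ)]

theorem tendsto_gnorm_dilDom (φ : Dom B₀) :
    Tendsto (fun t => gnorm B₀ (dilDom t φ - φ)) (𝓝 0) (𝓝 0) := by
  refine tendsto_gnorm_sub_iff.2 ⟨tendsto_dil (φ : L2), ?_⟩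
  simp only [momentum_dilDom]
  have h : Tendsto (fun t : ℝ => (Real.exp t : ℂ)) (𝓝 0) (𝓝 1) := by
    have : Continuous fun t : ℝ => (Real.exp t : ℂ) := by fun_prop
    simpa using this.tendsto 0
  simpa using h.smul (tendsto_dil (momentum B₀ φ))

theorem iD_eq (t : ℝ) (φ : Dom B₀) :
    iD t (φ : L2) = ((((2 * t : ℝ) : ℂ)⁻¹ • (dilDom t φ - dilDom (-t) φ) : Dom B₀) : L2) := rfl

theorem iD_mem (t : ℝ) (φ : Dom B₀) : iD t (φ : L2) ∈ Dom B₀ := by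
  rw [iD_eq]; exact Subtype.mem _

/-- `i D_t` on the form domain. -/
noncomputable def iDDom (t : ℝ) (φ : Dom B₀) : Dom B₀ :=
  ((2 * t : ℝ) : ℂ)⁻¹ • (dilDom t φ - dilDom (-t) φ)

/-! ### Integrals against dilated test functions -/

/-- `w` is integrable on compact subsets of the punctured plane. -/
def LocInt (w : Plane → ℂ) : Prop :=
  ∀ K : Set Plane, IsCompact K → (0 : Plane) ∉ K → IntegrableOn w K

theorem LocInt.integrable_mul {w f : Plane → ℂ} (hw : LocInt w) (hf : Continuous f)
    (hc : HasCompactSupport f) (h0 : (0 : Plane) ∉ tsupport f) :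
    Integrable (fun x => w x * f x) := by
  obtain ⟨C, hC⟩ := hc.exists_bound_of_continuous hf
  have h1 : Integrable (fun x => (tsupport f).indicator w x * f x) :=
    ((integrable_indicator_iff (isClosed_tsupport f).measurableSet).2 (hw _ hc h0)).mul_bdd
      hf.aestronglyMeasurable (Eventually.of_forall hC)
  refine h1.congr (Eventually.of_forall fun x => ?_)
  by_cases hx : x ∈ tsupport f
  · simp [hx]
  · simp [image_eq_zero_of_notMem_tsupport hx]

theorem IsTest.continuous_fderiv_self {η : Plane → ℂ} (h : IsTest η) :
    Continuous (fun y : Plane => fderiv ℝ η y y) ∧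
      HasCompactSupport (fun y : Plane => fderiv ℝ η y y) := by
  refine ⟨(h.smooth.continuous_fderiv (by simp)).clm_apply continuous_id,
    HasCompactSupport.intro h.compact fun y hy => ?_⟩
  have : fderiv ℝ η y = 0 := by
    by_contra h
    exact hy (support_fderiv_subset ℝ (Function.mem_support.2 h))
  simp [this]

theorem hasDerivAt_integral_dilate_of_integrable {w ξ : Plane → ℂ} (hw : Integrable w)
    (hξ : IsTest ξ) :
    HasDerivAt (fun s : ℝ => ∫ x, w x * ξ (Real.exp s • x)) (∫ x, w x * fderiv ℝ ξ x x) 0 := by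
  obtain ⟨hd, hdc⟩ := hξ.continuous_fderiv_self
  obtain ⟨C, hC⟩ := hdc.exists_bound_of_continuous hd
  obtain ⟨C', hC'⟩ := hξ.compact.exists_bound_of_continuous hξ.smooth.continuous
  -- The s-derivative is y ↦ ∇ξ(y)·y at y = e^s x. This function is bounded, so the domination below
  -- holds for all s at once.
  have hder : ∀ (x : Plane) (s : ℝ), HasDerivAt (fun s : ℝ => ξ (Real.exp s • x))
      (fderiv ℝ ξ (Real.exp s • x) (Real.exp s • x)) s := fun x s =>
    (hξ.differentiable (Real.exp s • x)).hasFDerivAt.comp_hasDerivAt s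
      ((Real.hasDerivAt_exp s).smul_const x)
  have h := (hasDerivAt_integral_of_dominated_loc_of_deriv_le (μ := (volume : Measure Plane))
    (F := fun s x => w x * ξ (Real.exp s • x))
    (F' := fun s x => w x * fderiv ℝ ξ (Real.exp s • x) (Real.exp s • x))
    (x₀ := 0) (s := Set.univ) (bound := fun x => ‖w x‖ * C) Filter.univ_mem
    (Eventually.of_forall fun s => ?_) ?_ ?_ ?_ ?_ ?_).2
  · simpa using h
  · exact hw.aestronglyMeasurable.mul
      (hξ.smooth.continuous.comp (by fun_prop)).aestronglyMeasurable
  · exact hw.mul_bdd (hξ.smooth.continuous.comp (by fun_prop)).aestronglyMeasurable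
      (Eventually.of_forall fun x => hC' _)
  · refine hw.aestronglyMeasurable.mul ?_
    exact (hd.comp (by fun_prop : Continuous fun x : Plane => Real.exp 0 • x)).aestronglyMeasurable
  · refine Eventually.of_forall fun x s _ => ?_
    rw [norm_mul]
    exact mul_le_mul_of_nonneg_left (hC _) (norm_nonneg _)
  · exact hw.norm.mul_const C
  · exact Eventually.of_forall fun x s _ => (hder x s).const_mul (w x)

/-- For |s| ≤ 1 all dilates of ξ live in one compact set K that avoids the origin, so w may be
replaced by its restriction to K, which is integrable. -/
theorem hasDerivAt_integral_dilate {w ξ : Plane → ℂ} (hw : LocInt w) (hξ : IsTest ξ) :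
    HasDerivAt (fun s : ℝ => ∫ x, w x * ξ (Real.exp s • x)) (∫ x, w x * fderiv ℝ ξ x x) 0 := by
  set K : Set Plane := (fun p : ℝ × Plane => Real.exp p.1 • p.2) '' (Set.Icc (-1) 1 ×ˢ tsupport ξ)
  have hK : IsCompact K := (isCompact_Icc.prod hξ.compact).image (by fun_prop)
  have h0 : (0 : Plane) ∉ K := by
    rintro ⟨⟨s, x⟩, ⟨-, hx⟩, h⟩
    have : x = 0 := by simpa [(Real.exp_pos s).ne'] using h
    exact hξ.ne_zero hx this
  have hmem : ∀ (s : ℝ) (x : Plane), |s| ≤ 1 → x ∉ K → ξ (Real.exp s • x) = 0 := by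
    intro s x hs hx
    refine image_eq_zero_of_notMem_tsupport fun hx' => hx ⟨(-s, Real.exp s • x), ⟨?_, hx'⟩, ?_⟩
    · have := abs_le.1 hs
      constructor <;> simp <;> linarith
    · simp [smul_smul, ← Real.exp_add]
  have h1 := hasDerivAt_integral_dilate_of_integrable
    ((integrable_indicator_iff hK.measurableSet).2 (hw K hK h0)) hξ
  have e : ∫ x, K.indicator w x * fderiv ℝ ξ x x = ∫ x, w x * fderiv ℝ ξ x x := by
    congr 1
    funext x
    by_cases hx : x ∈ K
    · simp [hx]
    · have : x ∉ tsupport ξ := fun hx' => hx ⟨(0, x), ⟨by simp, hx'⟩, by simp⟩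
      have : fderiv ℝ ξ x = 0 := by
        by_contra h
        exact this (support_fderiv_subset ℝ (Function.mem_support.2 h))
      simp [this]
  rw [e] at h1
  refine h1.congr_of_eventuallyEq ?_
  filter_upwards [Metric.closedBall_mem_nhds (0 : ℝ) one_pos] with s hs
  congr 1
  funext x
  by_cases hx : x ∈ K
  · simp [hx]
  · simp [hmem s x (by simpa using hs) hx]

theorem exists_isTest_eq_one {K : Set Plane} (hK : IsCompact K) (h0 : (0 : Plane) ∉ K) :
    ∃ η : Plane → ℂ, IsTest η ∧ ∀ x ∈ K, η x = 1 := by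
  obtain ⟨r, hr, hrK⟩ : ∃ r > 0, ∀ x ∈ K, r ≤ ‖x‖ := by
    obtain ⟨r, hr, hsub⟩ := Metric.isOpen_iff.1 hK.isClosed.isOpen_compl 0 h0
    refine ⟨r, hr, fun x hx => ?_⟩
    by_contra h
    exact hsub (by simpa using h : x ∈ Metric.ball (0 : Plane) r) hx
  obtain ⟨R, hR⟩ := hK.isBounded.exists_norm_le
  let b₁ : ContDiffBump (0 : Plane) := ⟨r / 2, r, by positivity, by linarith⟩
  let b₂ : ContDiffBump (0 : Plane) := ⟨|R| + 1, |R| + 2, by positivity, by linarith⟩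
  refine ⟨fun x => (((1 - b₁ x) * b₂ x : ℝ) : ℂ), ⟨?_, ?_, ?_⟩, fun x hx => ?_⟩
  · exact Complex.ofRealCLM.contDiff.comp ((contDiff_const.sub b₁.contDiff).mul b₂.contDiff)
  · exact (b₂.hasCompactSupport.mul_left (f := fun x => 1 - b₁ x)).comp_left
      (g := Complex.ofReal) (by simp)
  · rw [notMem_tsupport_iff_eventuallyEq]
    filter_upwards [Metric.ball_mem_nhds (0 : Plane) b₁.rIn_pos] with x hx
    rw [b₁.one_of_mem_closedBall (Metric.ball_subset_closedBall hx)]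
    simp
  · have e1 : b₁ x = 0 := b₁.zero_of_le_dist (by simpa using hrK x hx)
    have e2 : b₂ x = 1 := b₂.one_of_mem_closedBall (by
      simp only [mem_closedBall_zero_iff]
      show ‖x‖ ≤ |R| + 1
      linarith [hR x hx, le_abs_self R])
    simp only [e1, e2]
    simp

/-! ### The form of a potential -/

/-- Test the integrability of V|φ|² with a φ that equals one on K. -/
theorem FormDomainContains.locInt {V : Plane → ℝ} (h : FormDomainContains B₀ V) :
    LocInt (fun x => (V x : ℂ)) := by
  intro K hK h0
  obtain ⟨η, hη, h1⟩ := exists_isTest_eq_one hK h0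
  obtain ⟨φ, hφ⟩ := hη.exists_represents B₀
  have h2 : IntegrableOn (fun x => ((V x * ‖(φ : L2) x‖ ^ 2 : ℝ) : ℂ)) K :=
    ((h φ).ofReal).integrableOn
  refine h2.congr ?_
  filter_upwards [ae_restrict_mem hK.measurableSet, ae_restrict_of_ae hφ.ae_eq] with x hx h3
  rw [h3, h1 x hx]
  simp

theorem FormDomainContains.integrable {V : Plane → ℝ} (hm : AEMeasurable V volume)
    (h : FormDomainContains B₀ V) (φ ψ : Dom B₀) :
    Integrable (fun x => conj ((φ : L2) x) * (V x : ℂ) * (ψ : L2) x) := by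
  refine Integrable.mono' (((h φ).norm.add (h ψ).norm)) ?_ ?_
  · exact ((Complex.continuous_conj.comp_aestronglyMeasurable (Lp.aestronglyMeasurable _)).mul
      (Complex.continuous_ofReal.comp_aestronglyMeasurable hm.aestronglyMeasurable)).mul
      (Lp.aestronglyMeasurable _)
  · refine Eventually.of_forall fun x => ?_
    simp only [norm_mul, RCLike.norm_conj, Complex.norm_real, Pi.add_apply, norm_pow, norm_norm]
    nlinarith [mul_nonneg (norm_nonneg (V x)) (sq_nonneg (‖(φ : L2) x‖ - ‖(ψ : L2) x‖)),
      mul_nonneg (norm_nonneg (V x)) (sq_nonneg (‖(φ : L2) x‖)),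
      mul_nonneg (norm_nonneg (V x)) (sq_nonneg (‖(ψ : L2) x‖))]

/-- The sesquilinear form `⟨φ, V ψ⟩`. -/
noncomputable def potForm (V : Plane → ℝ) (hm : AEMeasurable V volume)
    (h : FormDomainContains B₀ V) : Dom B₀ →ₗ⋆[ℂ] Dom B₀ →ₗ[ℂ] ℂ :=
  LinearMap.mk₂'ₛₗ (starRingEnd ℂ) (RingHom.id ℂ)
    (fun φ ψ => ∫ x, conj ((φ : L2) x) * (V x : ℂ) * (ψ : L2) x)
    (fun φ φ' ψ => by
      rw [← integral_add (h.integrable hm _ _) (h.integrable hm _ _)]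
      refine integral_congr_ae ?_
      filter_upwards [Lp.coeFn_add (φ : L2) φ'] with x hx
      rw [Submodule.coe_add, hx, Pi.add_apply, map_add]
      ring)
    (fun c φ ψ => by
      rw [← integral_smul]
      refine integral_congr_ae ?_
      filter_upwards [Lp.coeFn_smul c (φ : L2)] with x hx
      rw [Submodule.coe_smul, hx, Pi.smul_apply, smul_eq_mul, smul_eq_mul, map_mul]
      ring)
    (fun φ ψ ψ' => by
      rw [← integral_add (h.integrable hm _ _) (h.integrable hm _ _)]
      refine integral_congr_ae ?_
      filter_upwards [Lp.coeFn_add (ψ : L2) ψ'] with x hx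
      rw [Submodule.coe_add, hx, Pi.add_apply]
      ring)
    (fun c φ ψ => by
      rw [← integral_smul]
      refine integral_congr_ae ?_
      filter_upwards [Lp.coeFn_smul c (ψ : L2)] with x hx
      rw [Submodule.coe_smul, hx, Pi.smul_apply, smul_eq_mul, RingHom.id_apply, smul_eq_mul]
      ring)

theorem potForm_apply {V : Plane → ℝ} (hm : AEMeasurable V volume)
    (h : FormDomainContains B₀ V) (φ ψ : Dom B₀) :
    potForm V hm h φ ψ = ∫ x, conj ((φ : L2) x) * (V x : ℂ) * (ψ : L2) x := rfl

theorem potForm_conj {V : Plane → ℝ} (hm : AEMeasurable V volume)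
    (h : FormDomainContains B₀ V) (φ ψ : Dom B₀) :
    conj (potForm V hm h φ ψ) = potForm V hm h ψ φ := by
  rw [potForm_apply, potForm_apply, ← integral_conj]
  congr 1
  funext x
  simp only [map_mul, Complex.conj_conj, Complex.conj_ofReal]
  ring

theorem potForm_self {V : Plane → ℝ} (hm : AEMeasurable V volume)
    (h : FormDomainContains B₀ V) (φ : Dom B₀) :
    potForm V hm h φ φ = (potentialQuad V φ : ℂ) := by
  rw [potForm_apply, potentialQuad, ← integral_complex_ofReal]
  congr 1
  funext x
  push_cast
  rw [← Complex.mul_conj']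
  ring

/-- Polarisation. -/
theorem re_potForm {V : Plane → ℝ} (hm : AEMeasurable V volume)
    (h : FormDomainContains B₀ V) (φ ψ : Dom B₀) :
    (potForm V hm h φ ψ).re =
      (potentialQuad V ((φ + ψ : Dom B₀) : L2) - potentialQuad V ((φ - ψ : Dom B₀) : L2)) / 4 := by
  have e1 := congrArg Complex.re (potForm_self hm h (φ + ψ))
  have e2 := congrArg Complex.re (potForm_self hm h (φ - ψ))
  have e3 := congrArg Complex.re (potForm_conj hm h φ ψ)
  simp only [map_add, map_sub, LinearMap.add_apply, LinearMap.sub_apply, Complex.add_re,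
    Complex.sub_re, Complex.ofReal_re, Complex.conj_re] at e1 e2 e3
  rw [← e1, ← e2]
  linarith

theorem IsFormBounded.bound {V : Plane → ℝ} (h : IsFormBounded B₀ V) :
    ∃ C : ℝ, 0 ≤ C ∧ ∀ φ : Dom B₀, |potentialQuad V φ| ≤ C * gnorm B₀ φ ^ 2 := by
  obtain ⟨-, a, b, hab⟩ := h
  exact ⟨|a| + |b|, by positivity, fun φ => (hab φ).trans (quad_bound_le_gnorm a b φ)⟩

theorem IsFormSmall.isFormBounded {V : Plane → ℝ} (h : IsFormSmall B₀ V) : IsFormBounded B₀ V := by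
  obtain ⟨h0, a, b, -, h1⟩ := h
  exact ⟨h0, a, b, h1⟩

theorem IsFormBounded.isQuadLip {V : Plane → ℝ} (hm : AEMeasurable V volume)
    (h : IsFormBounded B₀ V) : IsQuadLip (fun φ : Dom B₀ => potentialQuad V φ) := by
  obtain ⟨C, hC, hb⟩ := h.bound
  have e : ∀ φ : Dom B₀, sesqQuad (potForm V hm h.1) φ = potentialQuad V φ := fun φ => by
    rw [sesqQuad_apply, potForm_self, Complex.ofReal_re]
  have h1 := isQuadLip_of_quadraticForm (sesqQuad (potForm V hm h.1)) hC fun φ => by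
    rw [e]; exact hb φ
  rwa [show ⇑(sesqQuad (potForm V hm h.1)) = fun φ : Dom B₀ => potentialQuad V φ from funext e]
    at h1

/-! ### The derivative of a potential under dilations -/

/-- The form at U_s φ is e^{2s} ∫ V(x)|η(e^s x)|² dx. At s = 0 the prefactor contributes 2∫V|η|² and
the dilation contributes 2 Re ∫V η̄ x·∇η, together the negative of the virial distribution. No
derivative falls on V. -/
theorem hasDerivAt_potentialQuad_dilDom_zero {V : Plane → ℝ} (h : FormDomainContains B₀ V)
    {φ : Dom B₀} {η : Plane → ℂ} (hφ : Represents φ η) :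
    HasDerivAt (fun s => potentialQuad V (dilDom s φ : Dom B₀)) (-virialTest V η) 0 := by
  have hη := hφ.test
  have hw := h.locInt
  have hconj : ContDiff ℝ ∞ (fun x => conj (η x)) :=
    Complex.conjCLE.toContinuousLinearMap.contDiff.comp hη.smooth
  have hξ : IsTest (fun x => conj (η x) * η x) := by
    refine ⟨hconj.mul hη.smooth, hη.compact.mul_left, ?_⟩
    have := hη.away
    rw [notMem_tsupport_iff_eventuallyEq] at this ⊢
    filter_upwards [this] with x hx
    simp [hx]
  have hfd : ∀ x v : Plane, fderiv ℝ (fun x => conj (η x) * η x) x v =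
      conj (η x) * fderiv ℝ η x v + conj (conj (η x) * fderiv ℝ η x v) := by
    intro x v
    have h1 : HasFDerivAt (fun x => conj (η x))
        (Complex.conjCLE.toContinuousLinearMap.comp (fderiv ℝ η x)) x :=
      (Complex.conjCLE.toContinuousLinearMap.hasFDerivAt).comp x (hη.differentiable x).hasFDerivAt
    rw [(h1.fun_mul (hη.differentiable x).hasFDerivAt).fderiv]
    simp
  have hd := hasDerivAt_integral_dilate hw hξ
  have e1 : ∀ s, potentialQuad V (dilDom s φ : Dom B₀) =
      Real.exp (2 * s) * (∫ x, (V x : ℂ) * (conj (η (Real.exp s • x)) * η (Real.exp s • x))).re := by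
    intro s
    have : ∀ x, (V x : ℂ) * (conj (η (Real.exp s • x)) * η (Real.exp s • x)) =
        ((V x * ‖η (Real.exp s • x)‖ ^ 2 : ℝ) : ℂ) := fun x => by
      rw [Complex.conj_mul']; push_cast; rfl
    simp only [this]
    rw [integral_complex_ofReal, Complex.ofReal_re, potentialQuad, ← integral_const_mul]
    refine integral_congr_ae ?_
    filter_upwards [(hφ.dilate s).ae_eq] with x hx
    rw [hx, norm_mul, Complex.norm_real, Real.norm_of_nonneg (Real.exp_pos s).le, two_mul,
      Real.exp_add]
    ring
  have hi : Integrable (fun x => (V x : ℂ) * (conj (η x) * fderiv ℝ η x x)) := by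
    refine hw.integrable_mul ?_ hη.continuous_fderiv_self.2.mul_left ?_
    · exact hconj.continuous.mul hη.continuous_fderiv_self.1
    · have := hη.away
      rw [notMem_tsupport_iff_eventuallyEq] at this ⊢
      filter_upwards [this] with x hx
      simp [hx]
  have e2 : (∫ x, (V x : ℂ) * fderiv ℝ (fun x => conj (η x) * η x) x x).re =
      2 * (∫ x, (V x : ℂ) * conj (η x) * fderiv ℝ η x x).re := by
    have h1 : ∀ x, (V x : ℂ) * fderiv ℝ (fun x => conj (η x) * η x) x x =
        (V x : ℂ) * (conj (η x) * fderiv ℝ η x x) +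
          conj ((V x : ℂ) * (conj (η x) * fderiv ℝ η x x)) := fun x => by
      rw [hfd, map_mul (starRingEnd ℂ) (V x : ℂ), Complex.conj_ofReal]; ring
    simp only [h1]
    have hic : Integrable (fun x => conj ((V x : ℂ) * (conj (η x) * fderiv ℝ η x x))) :=
      Complex.conjCLE.toContinuousLinearMap.integrable_comp hi
    rw [integral_add hi hic, integral_conj]
    simp only [Complex.add_re, Complex.conj_re, mul_assoc]
    ring
  have e3 : (∫ x, (V x : ℂ) * (conj (η x) * η x)).re = ∫ x, V x * ‖η x‖ ^ 2 := by
    have : ∀ x, (V x : ℂ) * (conj (η x) * η x) = ((V x * ‖η x‖ ^ 2 : ℝ) : ℂ) := fun x => by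
      rw [Complex.conj_mul']; push_cast; rfl
    simp only [this]
    rw [integral_complex_ofReal, Complex.ofReal_re]
  have h2 : HasDerivAt (fun s : ℝ => Real.exp (2 * s)) 2 0 := by
    simpa using ((hasDerivAt_id (0 : ℝ)).const_mul 2).exp
  have h3 := h2.mul (Complex.reCLM.hasFDerivAt.comp_hasDerivAt (0 : ℝ) hd)
  simp only [e1]
  refine h3.congr_deriv ?_
  simp only [Function.comp_def, Complex.reCLM_apply, e2, virialTest]
  simp [e3]
  ring

/-- The group law carries the derivative at 0 to any t. -/
theorem hasDerivAt_potentialQuad_dilDom {V : Plane → ℝ} (h : FormDomainContains B₀ V)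
    {w : Dom B₀ → ℝ} (hw : ∀ φ η, Represents φ η → w φ = virialTest V η)
    {φ : Dom B₀} {η : Plane → ℂ} (hφ : Represents φ η) (t : ℝ) :
    HasDerivAt (fun s => potentialQuad V (dilDom s φ : Dom B₀)) (-w (dilDom t φ)) t := by
  have h1 := hasDerivAt_potentialQuad_dilDom_zero h (hφ.dilate t)
  rw [← hw _ _ (hφ.dilate t)] at h1
  simp only [dilDom_dilDom] at h1
  rw [← sub_self t] at h1
  simpa using h1.comp_sub_const t t

/-- Convergence of a uniformly equicontinuous family follows from convergence on test functions. -/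
theorem tendsto_of_represents {ι G : Type*} [NormedAddCommGroup G] {l : Filter ι}
    {f : ι → Dom B₀ → G} {g : Dom B₀ → G} {β : Dom B₀ → Dom B₀ → ℝ}
    (hf : ∀ φ ψ, ∀ᶠ t in l, ‖f t φ - f t ψ‖ ≤ β φ ψ)
    (hg : ∀ φ ψ, ‖g φ - g ψ‖ ≤ β φ ψ)
    (hβ : ∀ (u : ℕ → Dom B₀) (φ : Dom B₀), Tendsto (fun n => gnorm B₀ (u n - φ)) atTop (𝓝 0) →
      Tendsto (fun n => β (u n) φ) atTop (𝓝 0))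
    (htest : ∀ φ η, Represents φ η → Tendsto (fun t => f t φ) l (𝓝 (g φ))) (φ : Dom B₀) :
    Tendsto (fun t => f t φ) l (𝓝 (g φ)) := by
  rw [Metric.tendsto_nhds]
  intro ε hε
  obtain ⟨u, hu, hlim⟩ := exists_seq_represents φ
  obtain ⟨n, hn⟩ := ((hβ u φ hlim).eventually (gt_mem_nhds (by positivity : 0 < ε / 3))).exists
  obtain ⟨η, hη⟩ := hu n
  filter_upwards [hf (u n) φ, Metric.tendsto_nhds.1 (htest _ η hη) (ε / 3) (by positivity)]
    with t h1 h2
  have h3 := hg (u n) φ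
  rw [dist_eq_norm] at h2 ⊢
  have e : f t φ - g φ = -(f t (u n) - f t φ) + (f t (u n) - g (u n)) + (g (u n) - g φ) := by abel
  rw [e]
  refine (norm_add₃_le).trans_lt ?_
  rw [norm_neg]
  linarith

theorem IsQuadLip.exists_abs_le {w : Dom B₀ → ℝ} (hw : IsQuadLip w) (h0 : w 0 = 0) :
    ∃ C : ℝ, 0 ≤ C ∧ ∀ φ, |w φ| ≤ C * gnorm B₀ φ ^ 2 := by
  obtain ⟨C, hC, H⟩ := hw
  refine ⟨C, hC, fun φ => ?_⟩
  have := H φ 0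
  rw [h0, sub_zero, sub_zero, map_zero, add_zero] at this
  linarith

/-- The sesquilinear form `⟨φ, V φ⟩ - ⟨U φ, V U φ⟩`, `U` being the dilation by `-t`. -/
noncomputable def deltaForm (V : Plane → ℝ) (hm : AEMeasurable V volume)
    (h : FormDomainContains B₀ V) (t : ℝ) : Dom B₀ →ₗ⋆[ℂ] Dom B₀ →ₗ[ℂ] ℂ :=
  potForm V hm h - LinearMap.mk₂'ₛₗ (starRingEnd ℂ) (RingHom.id ℂ)
    (fun φ ψ => potForm V hm h (dilDom (-t) φ) (dilDom (-t) ψ))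
    (fun _ _ _ => by simp) (fun _ _ _ => by simp) (fun _ _ _ => by simp) (fun _ _ _ => by simp)

theorem sesqQuad_deltaForm {V : Plane → ℝ} (hm : AEMeasurable V volume)
    (h : FormDomainContains B₀ V) (t : ℝ) (φ : Dom B₀) :
    sesqQuad (deltaForm V hm h t) φ =
      potentialQuad V φ - potentialQuad V (dilDom (-t) φ : Dom B₀) := by
  rw [sesqQuad_apply]
  show (potForm V hm h φ φ - potForm V hm h (dilDom (-t) φ) (dilDom (-t) φ)).re = _
  rw [potForm_self, potForm_self, Complex.sub_re, Complex.ofReal_re, Complex.ofReal_re]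

theorem tendsto_gnorm_dilDom_sub {u : ℕ → Dom B₀} {φ : Dom B₀} {t : ℝ} (ht : |t| ≤ 1)
    (h : Tendsto (fun n => gnorm B₀ (u n - φ)) atTop (𝓝 0)) :
    Tendsto (fun n => gnorm B₀ (dilDom t (u n) - dilDom t φ)) atTop (𝓝 0) := by
  refine squeeze_zero (fun n => apply_nonneg _ _) (fun n => ?_) (by simpa using h.const_mul 3)
  rw [← map_sub]
  exact gnorm_dilDom_le ht _

/-- `⟨φ, V φ⟩` is Lipschitz along dilations. -/
theorem exists_abs_sub_dilDom_le {V : Plane → ℝ} (hm : AEMeasurable V volume)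
    (h : IsFormBounded B₀ V) {w : Dom B₀ → ℝ} (hwl : IsQuadLip w)
    (hw : ∀ φ η, Represents φ η → w φ = virialTest V η) :
    ∃ C : ℝ, 0 ≤ C ∧ ∀ t : ℝ, |t| ≤ 1 → ∀ φ : Dom B₀,
      |potentialQuad V φ - potentialQuad V (dilDom (-t) φ : Dom B₀)| ≤
        C * |t| * gnorm B₀ φ ^ 2 := by
  have hw0 : w 0 = 0 := by
    rw [hw 0 (fun _ => 0) ⟨IsTest.zero, Lp.coeFn_zero _ _ _⟩]
    simp [virialTest]
  obtain ⟨C, hC, hCw⟩ := hwl.exists_abs_le hw0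
  -- 9 is the square of the bound 3 for dilations with |s| ≤ 1 in the graph norm.
  refine ⟨C * 9, by positivity, fun t ht => ?_⟩
  refine dom_induction (fun u φ hlim hu => ?_) fun φ η hφ => ?_
  · have hq := h.isQuadLip hm
    refine le_of_tendsto_of_tendsto
      ((hq.tendsto hlim).sub (hq.tendsto (tendsto_gnorm_dilDom_sub (t := -t) (by simpa) hlim))).abs
      (((gnorm_tendsto hlim).pow 2).const_mul _) (Eventually.of_forall hu)
  · have hbound : ∀ s ∈ Set.Icc (-1 : ℝ) 1, ‖-w (dilDom s φ)‖ ≤ C * 9 * gnorm B₀ φ ^ 2 := by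
      intro s hs
      rw [norm_neg, Real.norm_eq_abs]
      refine (hCw _).trans ?_
      have h1 := gnorm_dilDom_le (abs_le.2 hs) φ
      have h2 : gnorm B₀ (dilDom s φ) ^ 2 ≤ (3 * gnorm B₀ φ) ^ 2 :=
        pow_le_pow_left₀ (apply_nonneg _ _) h1 2
      nlinarith
    -- Mean value inequality along the dilation orbit between −t and 0.
    have := (convex_Icc (-1 : ℝ) 1).norm_image_sub_le_of_norm_hasDerivWithin_le
      (fun s _ => (hasDerivAt_potentialQuad_dilDom h.1 hw hφ s).hasDerivWithinAt) hbound
      (x := -t) (y := 0) ⟨by linarith [(abs_le.1 ht).2], by linarith [(abs_le.1 ht).1]⟩ (by simp)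
    rw [dilDom_zero, Real.norm_eq_abs, Real.norm_eq_abs] at this
    refine this.trans (le_of_eq ?_)
    rw [zero_sub, neg_neg]
    ring

/-- The quotients are quadratic forms bounded by a multiple of the squared graph norm, uniformly in
small t, hence equi-Lipschitz on bounded sets. Convergence on test functions therefore spreads to
the whole domain and allows the argument `χ t` to move with t. -/
theorem tendsto_sub_dilDom_div {V : Plane → ℝ} (hm : AEMeasurable V volume)
    (h : IsFormBounded B₀ V) {w : Dom B₀ → ℝ} (hwl : IsQuadLip w)
    (hw : ∀ φ η, Represents φ η → w φ = virialTest V η) {χ : ℝ → Dom B₀} {φ : Dom B₀}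
    (hχ : Tendsto (fun t => gnorm B₀ (χ t - φ)) (𝓝[≠] 0) (𝓝 0)) :
    Tendsto (fun t => (potentialQuad V (χ t) - potentialQuad V (dilDom (-t) (χ t) : Dom B₀)) / t)
      (𝓝[≠] 0) (𝓝 (-w φ)) := by
  obtain ⟨C, hC, hb⟩ := exists_abs_sub_dilDom_le hm h hwl hw
  obtain ⟨C', hC', hlip⟩ := id hwl
  have hsmall : ∀ᶠ t : ℝ in 𝓝[≠] 0, |t| ≤ 1 ∧ t ≠ 0 := by
    refine (Filter.Eventually.and ?_ self_mem_nhdsWithin)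
    filter_upwards [mem_nhdsWithin_of_mem_nhds (Metric.closedBall_mem_nhds (0 : ℝ) one_pos)]
      with t ht
    simpa using ht
  set f : ℝ → Dom B₀ → ℝ := fun t φ =>
    (potentialQuad V φ - potentialQuad V (dilDom (-t) φ : Dom B₀)) / t with hf
  have hfl : ∀ t : ℝ, |t| ≤ 1 ∧ t ≠ 0 → ∀ φ ψ, ‖f t φ - f t ψ‖ ≤
      6 * C * gnorm B₀ (φ - ψ) * (gnorm B₀ φ + gnorm B₀ ψ) := by
    rintro t ⟨ht, ht0⟩ φ ψ
    have h1 := quadraticForm_sub_le (sesqQuad (deltaForm V hm h.1 t)) (C := C * |t|)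
      (by positivity) (fun φ => by rw [sesqQuad_deltaForm]; exact hb t ht φ) φ ψ
    rw [sesqQuad_deltaForm, sesqQuad_deltaForm] at h1
    simp only [hf]
    rw [← sub_div, norm_div, Real.norm_eq_abs, Real.norm_eq_abs, div_le_iff₀ (abs_pos.2 ht0)]
    refine h1.trans (le_of_eq (by ring))
  have hlim0 : Tendsto (fun t => f t φ) (𝓝[≠] 0) (𝓝 (-w φ)) := by
    refine tendsto_of_represents (f := f) (g := fun φ => -w φ)
      (β := fun φ ψ => (6 * C + C') * gnorm B₀ (φ - ψ) * (gnorm B₀ φ + gnorm B₀ ψ))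
      (fun φ ψ => ?_) (fun φ ψ => ?_) (fun u φ hu => ?_) (fun φ η hφ => ?_) φ
    · filter_upwards [hsmall] with t ht
      refine (hfl t ht φ ψ).trans ?_
      have : 0 ≤ C' * gnorm B₀ (φ - ψ) * (gnorm B₀ φ + gnorm B₀ ψ) := by positivity
      linarith
    · rw [Real.norm_eq_abs, ← neg_sub', abs_neg]
      refine (hlip φ ψ).trans ?_
      have : 0 ≤ C * gnorm B₀ (φ - ψ) * (gnorm B₀ φ + gnorm B₀ ψ) := by positivity
      linarith
    · simpa using (hu.const_mul (6 * C + C')).mul ((gnorm_tendsto hu).add_const (gnorm B₀ φ))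
    · have h1 := (hasDerivAt_potentialQuad_dilDom h.1 hw hφ 0)
      have h2 : HasDerivAt (fun s => potentialQuad V (dilDom (-s) φ : Dom B₀))
          (w (dilDom 0 φ)) 0 := by
        rw [← neg_zero] at h1
        have h2 := h1.comp (0 : ℝ) (hasDerivAt_neg (0 : ℝ))
        simpa [Function.comp_def] using h2
      have h3 := (h2.const_sub (potentialQuad V φ)).tendsto_slope_zero
      simp only [dilDom_zero] at h3
      refine h3.congr fun t => ?_
      simp only [hf, zero_add, neg_zero, dilDom_zero, sub_self, sub_zero, smul_eq_mul]
      rw [div_eq_inv_mul]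
  have hdiff : Tendsto (fun t => f t (χ t) - f t φ) (𝓝[≠] 0) (𝓝 0) := by
    refine squeeze_zero_norm' (hsmall.mono fun t ht => hfl t ht (χ t) φ) ?_
    simpa using (hχ.const_mul (6 * C)).mul ((gnorm_tendsto hχ).add_const (gnorm B₀ φ))
  simpa using hdiff.add hlim0

/-! ### The virial theorem -/

/-- By covariance the vector is (e^t U_t − e^{−t} U_{−t})(P−A)φ/(2t). The two overlaps with (P−A)φ
have the same real part because U_{−t} is the adjoint of U_t. -/
theorem re_inner_momentum_iDDom (t : ℝ) (φ : Dom B₀) :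
    2 * (inner ℂ (momentum B₀ φ) (momentum B₀ (iDDom t φ))).re =
      (Real.exp t - Real.exp (-t)) / t * (inner ℂ (momentum B₀ φ) (dil t (momentum B₀ φ))).re := by
  have h : (inner ℂ (momentum B₀ φ) (dil (-t) (momentum B₀ φ))).re =
      (inner ℂ (momentum B₀ φ) (dil t (momentum B₀ φ))).re := by
    rw [← inner_dil_left, ← inner_conj_symm, Complex.conj_re]
  rw [iDDom, momentum_smul, momentum_sub, momentum_dilDom, momentum_dilDom, inner_smul_right,
    inner_sub_right, inner_smul_right, inner_smul_right, ← Complex.ofReal_inv, Complex.re_ofReal_mul,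
    Complex.sub_re, Complex.re_ofReal_mul, Complex.re_ofReal_mul, h, mul_inv]
  ring

theorem tendsto_re_inner_momentum_iDDom (φ : Dom B₀) :
    Tendsto (fun t => 2 * (inner ℂ (momentum B₀ φ) (momentum B₀ (iDDom t φ))).re) (𝓝[≠] 0)
      (𝓝 (2 * ‖momentum B₀ φ‖ ^ 2)) := by
  simp only [re_inner_momentum_iDDom]
  have h1 : Tendsto (fun t : ℝ => (Real.exp t - Real.exp (-t)) / t) (𝓝[≠] 0) (𝓝 2) := by
    have h : HasDerivAt (fun t : ℝ => Real.exp t - Real.exp (-t)) 2 0 := by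
      have := (Real.hasDerivAt_exp 0).fun_sub ((hasDerivAt_neg (0 : ℝ)).exp)
      exact this.congr_deriv (by norm_num)
    refine h.tendsto_slope_zero.congr fun t => ?_
    simp [div_eq_inv_mul]
  have h2 : Tendsto (fun t => (inner ℂ (momentum B₀ φ) (dil t (momentum B₀ φ))).re) (𝓝[≠] 0)
      (𝓝 (‖momentum B₀ φ‖ ^ 2)) := by
    have e : ‖momentum B₀ φ‖ ^ 2 = (inner ℂ (momentum B₀ φ) (momentum B₀ φ)).re :=
      (inner_self_eq_norm_sq (𝕜 := ℂ) _).symm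
    rw [e]
    refine (Complex.continuous_re.tendsto _).comp ?_
    exact tendsto_const_nhds.inner
      ((tendsto_dil (momentum B₀ φ)).mono_left nhdsWithin_le_nhds)
  exact h1.mul h2

/-- Polarise ⟨φ, V U_{±t} φ⟩. The dilation by −t carries φ + U_t φ to φ + U_{−t} φ, and φ − U_t φ to
the negative of φ − U_{−t} φ. The four resulting values thus pair off into quotients along
dilations, at points tending to 2φ and to 0. -/
theorem re_potForm_iDDom {V : Plane → ℝ} (hm : AEMeasurable V volume)
    (h : FormDomainContains B₀ V) (t : ℝ) (φ : Dom B₀) :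
    2 * (potForm V hm h φ (iDDom t φ)).re =
      ((potentialQuad V (φ + dilDom t φ : Dom B₀) -
          potentialQuad V (dilDom (-t) (φ + dilDom t φ) : Dom B₀)) / t -
        (potentialQuad V (φ - dilDom t φ : Dom B₀) -
          potentialQuad V (dilDom (-t) (φ - dilDom t φ) : Dom B₀)) / t) / 4 := by
  have e1 : dilDom (-t) (φ + dilDom t φ) = φ + dilDom (-t) φ := by
    rw [map_add, dilDom_dilDom, neg_add_cancel, dilDom_zero, add_comm]
  have e2 : potentialQuad V (dilDom (-t) (φ - dilDom t φ) : Dom B₀) =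
      potentialQuad V (φ - dilDom (-t) φ : Dom B₀) := by
    rw [map_sub, dilDom_dilDom, neg_add_cancel, dilDom_zero]
    refine integral_congr_ae ?_
    filter_upwards [Lp.coeFn_sub (φ : L2) (dilDom (-t) φ : Dom B₀),
      Lp.coeFn_sub ((dilDom (-t) φ : Dom B₀) : L2) (φ : L2)] with x h1 h2
    rw [Submodule.coe_sub, Submodule.coe_sub, h1, h2, Pi.sub_apply, Pi.sub_apply, norm_sub_rev]
  rw [e1, e2, iDDom, map_smul, map_sub, smul_eq_mul, ← Complex.ofReal_inv, Complex.re_ofReal_mul,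
    Complex.sub_re, re_potForm, re_potForm, mul_inv]
  ring

theorem form_eq {V : Plane → ℝ} (hm : AEMeasurable V volume)
    (h : FormDomainContains B₀ V) (φ ψ : Dom B₀) :
    form B₀ V φ ψ = inner ℂ (momentum B₀ φ) (momentum B₀ ψ) + potForm V hm h φ ψ := rfl

/-- The virial theorem, for any locally Lipschitz extension of the distribution `x · ∇V`. -/
theorem tendsto_re_form_iDDom {V : Plane → ℝ} (hm : AEMeasurable V volume)
    (h : IsFormBounded B₀ V) {w : Dom B₀ → ℝ} (hwl : IsQuadLip w)
    (hw : ∀ φ η, Represents φ η → w φ = virialTest V η) (φ : Dom B₀) :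
    Tendsto (fun t => 2 * (form B₀ V φ (iDDom t φ)).re) (𝓝[≠] 0)
      (𝓝 (2 * ‖momentum B₀ φ‖ ^ 2 - w φ)) := by
  have hd := (tendsto_gnorm_dilDom φ).mono_left (nhdsWithin_le_nhds (s := {0}ᶜ))
  have h1 : Tendsto (fun t => gnorm B₀ (φ + dilDom t φ - (φ + φ))) (𝓝[≠] 0) (𝓝 0) := by
    refine hd.congr fun t => ?_
    congr 1
    abel
  have h2 : Tendsto (fun t => gnorm B₀ (φ - dilDom t φ - 0)) (𝓝[≠] 0) (𝓝 0) := by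
    refine hd.congr fun t => ?_
    rw [sub_zero, map_sub_rev]
  have k1 := tendsto_sub_dilDom_div hm h hwl hw h1
  have k2 := tendsto_sub_dilDom_div hm h hwl hw h2
  -- w is not assumed to be quadratic; the scaling follows from uniqueness of the limits of the
  -- quotients.
  have hw2 : w (φ + φ) = 4 * w φ := by
    have hc1 : Tendsto (fun _ : ℝ => gnorm B₀ (φ - φ)) (𝓝[≠] 0) (𝓝 0) := by simp
    have hc2 : Tendsto (fun _ : ℝ => gnorm B₀ ((φ + φ) - (φ + φ))) (𝓝[≠] 0) (𝓝 0) := by simp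
    have m1 := tendsto_sub_dilDom_div hm h hwl hw hc1
    have m2 := tendsto_sub_dilDom_div hm h hwl hw hc2
    have e : ∀ χ : Dom B₀, potentialQuad V (χ + χ : Dom B₀) = 4 * potentialQuad V χ := by
      intro χ
      rw [potentialQuad, potentialQuad, ← integral_const_mul]
      refine integral_congr_ae ?_
      filter_upwards [Lp.coeFn_add (χ : L2) χ] with x hx
      rw [Submodule.coe_add, hx, Pi.add_apply, ← two_mul, norm_mul, Complex.norm_ofNat]
      ring
    simp only [map_add, e] at m2
    have := tendsto_nhds_unique m2 ((m1.const_mul 4).congr fun t => by ring)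
    linarith
  have hw0 : w 0 = 0 := by
    rw [hw 0 (fun _ => 0) ⟨IsTest.zero, Lp.coeFn_zero _ _ _⟩]
    simp [virialTest]
  have k3 := (tendsto_re_inner_momentum_iDDom φ).add ((k1.sub k2).div_const 4)
  rw [hw2, hw0] at k3
  have e : 2 * ‖momentum B₀ φ‖ ^ 2 + (-(4 * w φ) - -0) / 4 = 2 * ‖momentum B₀ φ‖ ^ 2 - w φ := by
    ring
  rw [e] at k3
  refine k3.congr fun t => ?_
  rw [← re_potForm_iDDom hm h.1, form_eq hm h.1, Complex.add_re]
  ring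

/-! ### Bounded pointwise operators -/

section PointwiseOperators

variable {E G : Type*} [NormedAddCommGroup E] [NormedSpace ℂ E]
  [NormedAddCommGroup G] [NormedSpace ℂ G]

/-- A bounded measurable field of operators. -/
structure IsBddField (a : Plane → E →L[ℂ] G) : Prop where
  meas : AEStronglyMeasurable a (volume : Measure Plane)
  bdd : ∃ C : ℝ, ∀ x, ‖a x‖ ≤ C

theorem IsBddField.memLp {a : Plane → E →L[ℂ] G} (ha : IsBddField a)
    (f : Lp E 2 (volume : Measure Plane)) : MemLp (fun x => a x (f x)) 2 volume := by
  obtain ⟨C, hC⟩ := ha.bdd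
  refine (Lp.memLp f).of_le_mul (c := C) ?_ (Eventually.of_forall fun x => ?_)
  · exact (isBoundedBilinearMap_apply (𝕜 := ℂ) (E := E) (F := G)).continuous.comp_aestronglyMeasurable
      (ha.meas.prodMk (Lp.aestronglyMeasurable f))
  · exact (a x).le_of_opNorm_le (hC x) _

/-- The operator of pointwise application of a bounded field of operators. -/
noncomputable def fieldMap {a : Plane → E →L[ℂ] G} (ha : IsBddField a) :
    Lp E 2 (volume : Measure Plane) →ₗ[ℂ] Lp G 2 (volume : Measure Plane) where
  toFun f := (ha.memLp f).toLp _
  map_add' f g := by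
    ext1
    filter_upwards [(ha.memLp (f + g)).coeFn_toLp, (ha.memLp f).coeFn_toLp,
      (ha.memLp g).coeFn_toLp, Lp.coeFn_add ((ha.memLp f).toLp _) ((ha.memLp g).toLp _),
      Lp.coeFn_add f g] with x h1 h2 h3 h4 h5
    rw [h1, h4, Pi.add_apply, h2, h3, h5, Pi.add_apply, map_add]
  map_smul' c f := by
    ext1
    filter_upwards [(ha.memLp (c • f)).coeFn_toLp, (ha.memLp f).coeFn_toLp,
      Lp.coeFn_smul c ((ha.memLp f).toLp _), Lp.coeFn_smul c f] with x h1 h2 h4 h5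
    rw [h1, RingHom.id_apply, h4, Pi.smul_apply, h2, h5, Pi.smul_apply, map_smul]

theorem fieldMap_ae {a : Plane → E →L[ℂ] G} (ha : IsBddField a)
    (f : Lp E 2 (volume : Measure Plane)) : fieldMap ha f =ᵐ[volume] fun x => a x (f x) :=
  (ha.memLp f).coeFn_toLp

theorem norm_fieldMap_le {a : Plane → E →L[ℂ] G} (ha : IsBddField a) :
    ∃ C : ℝ, 0 ≤ C ∧ ∀ f : Lp E 2 (volume : Measure Plane), ‖fieldMap ha f‖ ≤ C * ‖f‖ := by
  obtain ⟨C, hC⟩ := ha.bdd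
  refine ⟨C, (norm_nonneg _).trans (hC 0), fun f => Lp.norm_le_mul_norm_of_ae_le_mul ?_⟩
  filter_upwards [fieldMap_ae ha f] with x hx
  rw [hx]
  exact (a x).le_of_opNorm_le (hC x) _

theorem tendsto_fieldMap {a : Plane → E →L[ℂ] G} (ha : IsBddField a) {ι : Type*} {l : Filter ι}
    {u : ι → Lp E 2 (volume : Measure Plane)} {f : Lp E 2 (volume : Measure Plane)}
    (h : Tendsto u l (𝓝 f)) : Tendsto (fun n => fieldMap ha (u n)) l (𝓝 (fieldMap ha f)) := by
  obtain ⟨C, -, hC⟩ := norm_fieldMap_le ha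
  rw [tendsto_iff_norm_sub_tendsto_zero] at h ⊢
  refine squeeze_zero (fun _ => norm_nonneg _) (fun n => ?_) (by simpa using h.const_mul C)
  rw [← map_sub]
  exact hC _

end PointwiseOperators

/-! ### Multiplication by functions -/

/-- The gradient of a real function, as a complex vector field. -/
noncomputable def gradC (m : Plane → ℝ) (x : Plane) : EuclideanSpace ℂ (Fin 2) :=
  WithLp.toLp 2 fun j => (fderiv ℝ m x (EuclideanSpace.single j 1) : ℂ)

theorem norm_gradC_le (m : Plane → ℝ) (x : Plane) : ‖gradC m x‖ ≤ 2 * ‖fderiv ℝ m x‖ := by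
  have h : ∀ j, ‖gradC m x j‖ ≤ ‖fderiv ℝ m x‖ := fun j => by
    have h1 := (fderiv ℝ m x).le_opNorm (EuclideanSpace.single j 1)
    have h2 : ‖(EuclideanSpace.single j 1 : Plane)‖ = 1 := by simp
    rw [h2, mul_one] at h1
    simpa only [gradC, Complex.norm_real] using h1
  rw [EuclideanSpace.norm_eq, Fin.sum_univ_two]
  refine Real.sqrt_le_iff.2 ⟨by positivity, ?_⟩
  have h0 := pow_le_pow_left₀ (norm_nonneg _) (h 0) 2
  have h1 := pow_le_pow_left₀ (norm_nonneg _) (h 1) 2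
  nlinarith [sq_nonneg ‖fderiv ℝ m x‖]

/-- Smooth bounded functions with bounded gradient. -/
structure IsMult (m : Plane → ℝ) : Prop where
  smooth : ContDiff ℝ ∞ m
  bdd : ∃ C : ℝ, ∀ x, |m x| ≤ C
  bdd_fderiv : ∃ C : ℝ, ∀ x, ‖fderiv ℝ m x‖ ≤ C

theorem continuous_gradC {m : Plane → ℝ} (hm : ContDiff ℝ ∞ m) : Continuous (gradC m) := by
  refine (PiLp.continuous_toLp 2 _).comp (continuous_pi fun j => ?_)
  exact Complex.continuous_ofReal.comp
    ((hm.continuous_fderiv (by simp)).clm_apply continuous_const)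

theorem isBddField_smul {E : Type*} [NormedAddCommGroup E] [NormedSpace ℂ E] {m : Plane → ℝ}
    (hm : Continuous m) (hb : ∃ C : ℝ, ∀ x, |m x| ≤ C) :
    IsBddField (fun x => (m x : ℂ) • ContinuousLinearMap.id ℂ E) := by
  obtain ⟨C, hC⟩ := hb
  refine ⟨Continuous.aestronglyMeasurable (by fun_prop), C, fun x => ?_⟩
  refine ContinuousLinearMap.opNorm_le_bound _ ((abs_nonneg _).trans (hC x)) fun v => ?_
  simp only [smul_apply, ContinuousLinearMap.id_apply, norm_smul,
    Complex.norm_real, Real.norm_eq_abs]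
  exact mul_le_mul_of_nonneg_right (hC x) (norm_nonneg _)

theorem IsMult.isBddField_grad {m : Plane → ℝ} (hm : IsMult m) :
    IsBddField (fun x => (ContinuousLinearMap.id ℂ ℂ).smulRight (-Complex.I • gradC m x)) := by
  obtain ⟨C, hC⟩ := hm.bdd_fderiv
  refine ⟨Continuous.aestronglyMeasurable ?_, 2 * C, fun x => ?_⟩
  · have := continuous_gradC hm.smooth
    fun_prop
  · rw [ContinuousLinearMap.norm_smulRight_apply, norm_smul, norm_neg, Complex.norm_I, one_mul]
    have h1 := norm_gradC_le m x
    have h2 := hC x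
    have h3 : ‖ContinuousLinearMap.id ℂ ℂ‖ ≤ 1 := ContinuousLinearMap.norm_id_le
    nlinarith [norm_nonneg (gradC m x)]

theorem IsTest.mul_real {m : Plane → ℝ} (hm : ContDiff ℝ ∞ m) {η : Plane → ℂ} (h : IsTest η) :
    IsTest (fun x => (m x : ℂ) * η x) := by
  refine ⟨(Complex.ofRealCLM.contDiff.comp hm).mul h.smooth, h.compact.mul_left, ?_⟩
  have := h.away
  rw [notMem_tsupport_iff_eventuallyEq] at this ⊢
  filter_upwards [this] with x hx
  simp [hx]

theorem fderiv_mul_real {m : Plane → ℝ} (hm : ContDiff ℝ ∞ m) {η : Plane → ℂ}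
    (h : Differentiable ℝ η) (x v : Plane) :
    fderiv ℝ (fun x => (m x : ℂ) * η x) x v =
      (m x : ℂ) * fderiv ℝ η x v + (fderiv ℝ m x v : ℂ) * η x := by
  have h1 : HasFDerivAt (fun x => (m x : ℂ)) (Complex.ofRealCLM.comp (fderiv ℝ m x)) x :=
    Complex.ofRealCLM.hasFDerivAt.comp x ((hm.differentiable (by simp)) x).hasFDerivAt
  rw [(h1.fun_mul (h x).hasFDerivAt).fderiv]
  simp [mul_comm]

theorem momentumTest_mul_real {m : Plane → ℝ} (hm : ContDiff ℝ ∞ m) {η : Plane → ℂ}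
    (h : IsTest η) (x : Plane) :
    momentumTest B₀ (fun x => (m x : ℂ) * η x) x =
      (m x : ℂ) • momentumTest B₀ η x + η x • (-Complex.I • gradC m x) := by
  ext j
  simp only [momentumTest, fderiv_mul_real hm h.differentiable, PiLp.add_apply, PiLp.smul_apply,
    smul_eq_mul, gradC]
  ring

/-- Leibniz rule. It involves only bounded pointwise operators applied to φ and (P−A)φ, so it passes
to graph limits. -/
theorem IsMult.exists_mul {m : Plane → ℝ} (hm : IsMult m) (φ : Dom B₀) :
    ∃ χ : Dom B₀, (χ : L2) =ᵐ[volume] (fun x => (m x : ℂ) * (φ : L2) x) ∧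
      momentum B₀ χ =ᵐ[volume] fun x =>
        (m x : ℂ) • momentum B₀ φ x + (φ : L2) x • (-Complex.I • gradC m x) := by
  have b1 := isBddField_smul (E := ℂ) hm.smooth.continuous hm.bdd
  have b2 := isBddField_smul (E := EuclideanSpace ℂ (Fin 2)) hm.smooth.continuous hm.bdd
  have b3 := hm.isBddField_grad
  suffices h : ∀ φ : Dom B₀, ∃ χ : Dom B₀, (χ : L2) = fieldMap b1 (φ : L2) ∧
      momentum B₀ χ = fieldMap b2 (momentum B₀ φ) + fieldMap b3 (φ : L2) by
    obtain ⟨χ, h1, h2⟩ := h φ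
    refine ⟨χ, ?_, ?_⟩
    · rw [h1]
      exact fieldMap_ae b1 _
    · rw [h2]
      filter_upwards [Lp.coeFn_add (fieldMap b2 (momentum B₀ φ)) (fieldMap b3 (φ : L2)),
        fieldMap_ae b2 (momentum B₀ φ), fieldMap_ae b3 (φ : L2)] with x e1 e2 e3
      rw [e1, Pi.add_apply, e2, e3]
      rfl
  refine dom_induction (fun u φ hlim hu => ?_) fun φ η h => ?_
  · choose χ h1 h2 using hu
    obtain ⟨l1, l2⟩ := tendsto_gnorm_sub_iff.1 hlim
    refine exists_dom_of_tendsto (u := χ) ?_ ?_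
    · simpa only [h1] using tendsto_fieldMap b1 l1
    · simpa only [h2] using (tendsto_fieldMap b2 l2).add (tendsto_fieldMap b3 l1)
  · refine exists_dom_of_mem_closure (subset_closure ⟨_, h.test.mul_real hm.smooth, ?_, ?_⟩)
    · filter_upwards [fieldMap_ae b1 (φ : L2), h.ae_eq] with x h1 h2
      rw [h1, h2]
      rfl
    · filter_upwards [Lp.coeFn_add (fieldMap b2 (momentum B₀ φ)) (fieldMap b3 (φ : L2)),
        fieldMap_ae b2 (momentum B₀ φ), fieldMap_ae b3 (φ : L2), h.ae_eq, h.momentum_ae_eq]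
        with x e1 e2 e3 e4 e5
      rw [e1, Pi.add_apply, e2, e3, e4, e5, momentumTest_mul_real hm.smooth h.test]
      rfl

/-! ### Compactly supported multipliers and their radial derivatives -/

/-- Real smooth functions with compact support. -/
structure IsCc (n : Plane → ℝ) : Prop where
  smooth : ContDiff ℝ ∞ n
  compact : HasCompactSupport n

/-- The radial derivative `x · ∇ n`. -/
noncomputable def rd (n : Plane → ℝ) (x : Plane) : ℝ := fderiv ℝ n x x

theorem IsCc.bdd {n : Plane → ℝ} (h : IsCc n) : ∃ C : ℝ, ∀ x, |n x| ≤ C :=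
  h.compact.exists_bound_of_continuous h.smooth.continuous

theorem IsCc.isMult {n : Plane → ℝ} (h : IsCc n) : IsMult n :=
  ⟨h.smooth, h.bdd, (h.compact.fderiv ℝ).exists_bound_of_continuous
    (h.smooth.continuous_fderiv (by simp))⟩

theorem fderiv_exp_comp {n : Plane → ℝ} (h : ContDiff ℝ ∞ n) (x : Plane) :
    fderiv ℝ (fun x => Real.exp (n x)) x = Real.exp (n x) • fderiv ℝ n x :=
  (((h.differentiable (by simp)) x).hasFDerivAt.exp).fderiv

theorem IsCc.exp {n : Plane → ℝ} (h : IsCc n) : IsMult (fun x => Real.exp (n x)) := by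
  obtain ⟨C, hC⟩ := h.bdd
  obtain ⟨C', hC'⟩ := h.isMult.bdd_fderiv
  have hb : ∀ x, Real.exp (n x) ≤ Real.exp C := fun x => Real.exp_le_exp.2 (abs_le.1 (hC x)).2
  refine ⟨h.smooth.exp, ⟨Real.exp C, fun x => ?_⟩, ⟨Real.exp C * C', fun x => ?_⟩⟩
  · rw [abs_of_pos (Real.exp_pos _)]; exact hb x
  · rw [fderiv_exp_comp h.smooth, norm_smul, Real.norm_of_nonneg (Real.exp_pos _).le]
    exact mul_le_mul (hb x) (hC' x) (norm_nonneg _) (Real.exp_pos _).le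

theorem IsCc.mul_smooth {m n : Plane → ℝ} (h : IsCc n) (hm : ContDiff ℝ ∞ m) :
    IsCc (fun x => m x * n x) := ⟨hm.mul h.smooth, h.compact.mul_left⟩

theorem IsCc.add {m n : Plane → ℝ} (h : IsCc n) (hm : IsCc m) :
    IsCc (fun x => n x + m x) := ⟨h.smooth.add hm.smooth, h.compact.add hm.compact⟩

theorem IsCc.sub {m n : Plane → ℝ} (h : IsCc n) (hm : IsCc m) :
    IsCc (fun x => n x - m x) := ⟨h.smooth.sub hm.smooth, h.compact.sub hm.compact⟩

theorem IsCc.rd {n : Plane → ℝ} (h : IsCc n) : IsCc (rd n) := by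
  refine ⟨?_, HasCompactSupport.intro h.compact fun y hy => ?_⟩
  · exact (h.smooth.fderiv_right (m := ∞) (by simp)).clm_apply contDiff_id
  · have : fderiv ℝ n y = 0 := by
      by_contra h
      exact hy (support_fderiv_subset ℝ (Function.mem_support.2 h))
    simp [AharonovBohm.rd, this]

theorem rd_add {m n : Plane → ℝ} (hm : IsCc m) (hn : IsCc n) (x : Plane) :
    rd (fun x => m x + n x) x = rd m x + rd n x := by
  simp only [rd]
  rw [fderiv_fun_add ((hm.smooth.differentiable (by simp)) x)
    ((hn.smooth.differentiable (by simp)) x)]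
  rfl

theorem rd_sub {m n : Plane → ℝ} (hm : IsCc m) (hn : IsCc n) (x : Plane) :
    rd (fun x => m x - n x) x = rd m x - rd n x := by
  simp only [rd]
  rw [fderiv_fun_sub ((hm.smooth.differentiable (by simp)) x)
    ((hn.smooth.differentiable (by simp)) x)]
  rfl

theorem rd_const_mul {n : Plane → ℝ} (c : ℝ) (hn : IsCc n) (x : Plane) :
    rd (fun x => c * n x) x = c * rd n x := by
  simp only [rd]
  rw [fderiv_const_mul ((hn.smooth.differentiable (by simp)) x)]
  rfl

/-- Multiplication by a smooth function with compact support. -/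
noncomputable def mulMap {n : Plane → ℝ} (hn : IsCc n) : L2 →ₗ[ℂ] L2 :=
  fieldMap (isBddField_smul (E := ℂ) hn.smooth.continuous hn.bdd)

theorem mulMap_ae {n : Plane → ℝ} (hn : IsCc n) (f : L2) :
    mulMap hn f =ᵐ[volume] fun x => (n x : ℂ) * f x := fieldMap_ae _ f

/-! ### The radial derivative -/

/-- The position vector, as a complex vector. -/
noncomputable def posC (x : Plane) : EuclideanSpace ℂ (Fin 2) := WithLp.toLp 2 fun j => (x j : ℂ)

theorem norm_posC (x : Plane) : ‖posC x‖ = ‖x‖ := by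
  simp [EuclideanSpace.norm_eq, posC]

theorem continuous_posC : Continuous posC :=
  (PiLp.continuous_toLp 2 _).comp (continuous_pi fun j => by fun_prop)

theorem IsCc.isBddField_radial {n : Plane → ℝ} (hn : IsCc n) :
    IsBddField (fun x => ((n x : ℂ) * Complex.I) • innerSL ℂ (posC x)) := by
  have h1 : Continuous (fun x => ‖x‖ * n x) := continuous_norm.mul hn.smooth.continuous
  obtain ⟨C, hC⟩ := (hn.compact.mul_left (f := fun x => ‖x‖)).exists_bound_of_continuous h1
  refine ⟨Continuous.aestronglyMeasurable ?_, C, fun x => ?_⟩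
  · have h2 := hn.smooth.continuous
    have h3 := (innerSL ℂ (E := EuclideanSpace ℂ (Fin 2))).continuous.comp continuous_posC
    exact (by fun_prop : Continuous fun x => (n x : ℂ) * Complex.I).smul h3
  · rw [norm_smul, innerSL_apply_norm, norm_posC, norm_mul, Complex.norm_I, mul_one,
      Complex.norm_real]
    have : ‖‖x‖ * n x‖ ≤ C := hC x
    rw [norm_mul, norm_norm] at this
    linarith

/-- The operator `φ ↦ n · i x · (P - A) φ`, which is `n x · ∇φ` since `x · A = 0`. -/
noncomputable def radialMap {n : Plane → ℝ} (hn : IsCc n) : Dom B₀ →ₗ[ℂ] L2 :=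
  fieldMap hn.isBddField_radial ∘ₗ (momentum B₀).toFun

theorem radialMap_ae {n : Plane → ℝ} (hn : IsCc n) (φ : Dom B₀) :
    radialMap hn φ =ᵐ[volume] fun x =>
      (n x : ℂ) * (Complex.I * inner ℂ (posC x) (momentum B₀ φ x)) := by
  filter_upwards [fieldMap_ae hn.isBddField_radial (momentum B₀ φ)] with x hx
  rw [← mul_assoc]
  exact hx

theorem tendsto_radialMap {n : Plane → ℝ} (hn : IsCc n) {ι : Type*} {l : Filter ι}
    {u : ι → Dom B₀} {φ : Dom B₀} (h : Tendsto (fun n => gnorm B₀ (u n - φ)) l (𝓝 0)) :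
    Tendsto (fun k => radialMap hn (u k)) l (𝓝 (radialMap hn φ)) :=
  tendsto_fieldMap hn.isBddField_radial (tendsto_gnorm_sub_iff.1 h).2

theorem norm_radialMap_le {n : Plane → ℝ} (hn : IsCc n) :
    ∃ C : ℝ, 0 ≤ C ∧ ∀ φ : Dom B₀, ‖radialMap hn φ‖ ≤ C * gnorm B₀ φ := by
  obtain ⟨C, hC, h⟩ := norm_fieldMap_le hn.isBddField_radial
  exact ⟨C, hC, fun φ => (h _).trans
    (mul_le_mul_of_nonneg_left (norm_momentum_le_gnorm φ) hC)⟩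

/-- The vector (−y, x) is orthogonal to (x, y), so the magnetic term drops out. -/
theorem inner_posC_momentumTest {η : Plane → ℂ} (x : Plane) :
    Complex.I * inner ℂ (posC x) (momentumTest B₀ η x) = fderiv ℝ η x x := by
  have hx : x = x 0 • EuclideanSpace.single 0 1 + x 1 • EuclideanSpace.single 1 1 := by
    ext j; fin_cases j <;> simp
  have h1 : fderiv ℝ η x x = x 0 * fderiv ℝ η x (EuclideanSpace.single 0 1) +
      x 1 * fderiv ℝ η x (EuclideanSpace.single 1 1) := by
    rw [← Complex.real_smul, ← Complex.real_smul, ← map_smul, ← map_smul, ← map_add, ← hx]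
  rw [h1, PiLp.inner_apply, Fin.sum_univ_two]
  simp only [posC, momentumTest, abPotential, RCLike.inner_apply, Complex.conj_ofReal,
    PiLp.smul_apply, smul_eq_mul]
  simp
  linear_combination (-(x 0 : ℂ) * fderiv ℝ η x (EuclideanSpace.single 0 1) -
    (x 1 : ℂ) * fderiv ℝ η x (EuclideanSpace.single 1 1)) * Complex.I_mul_I

theorem Represents.radialMap_ae {n : Plane → ℝ} (hn : IsCc n) {φ : Dom B₀} {η : Plane → ℂ}
    (h : Represents φ η) : radialMap hn φ =ᵐ[volume] fun x => (n x : ℂ) * fderiv ℝ η x x := by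
  filter_upwards [AharonovBohm.radialMap_ae hn φ, h.momentum_ae_eq] with x h1 h2
  rw [h1, h2, inner_posC_momentumTest]

/-- This function is the divergence of the planar field n x. -/
theorem IsCc.two_mul_add_rd {n : Plane → ℝ} (hn : IsCc n) : IsCc (fun x => 2 * n x + AharonovBohm.rd n x) :=
  (hn.mul_smooth contDiff_const).add hn.rd

theorem locInt_of_memLp {f : Plane → ℂ} (hf : MemLp f 2 (volume : Measure Plane)) : LocInt f :=
  fun _ hK _ => (hf.locallyIntegrable (by norm_num)).integrableOn_isCompact hK

/-- Differentiate ∫ G(e^s x) dx = e^{−2s} ∫ G at s = 0. -/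
theorem integral_fderiv_self {G : Plane → ℂ} (hG : IsTest G) :
    ∫ x, fderiv ℝ G x x = -2 * ∫ x, G x := by
  have hw : LocInt (fun _ : Plane => (1 : ℂ)) := fun K hK _ => by
    exact integrableOn_const hK.measure_lt_top.ne
  have h1 := hasDerivAt_integral_dilate hw hG
  simp only [one_mul, integral_comp_exp_smul] at h1
  have h2 : HasDerivAt (fun s : ℝ => Real.exp (-(2 * s)) • ∫ x, G x) ((-2 : ℝ) • ∫ x, G x) 0 := by
    have : HasDerivAt (fun s : ℝ => Real.exp (-(2 * s))) (-2) 0 := by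
      simpa using (((hasDerivAt_id (0 : ℝ)).const_mul 2).neg).exp
    exact this.smul_const _
  rw [h1.unique h2, Complex.real_smul]
  push_cast
  ring

theorem tendsto_coe_of_gnorm {ι : Type*} {l : Filter ι} {u : ι → Dom B₀} {φ : Dom B₀}
    (h : Tendsto (fun n => gnorm B₀ (u n - φ)) l (𝓝 0)) :
    Tendsto (fun n => (u n : L2)) l (𝓝 φ) := (tendsto_gnorm_sub_iff.1 h).1

/-- The divergence theorem for the vector field `n x`. -/
theorem inner_radialMap_add {n : Plane → ℝ} (hn : IsCc n) (χ φ : Dom B₀) :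
    inner ℂ (radialMap hn χ) (φ : L2) + inner ℂ (χ : L2) (radialMap hn φ) =
      -inner ℂ (χ : L2) (mulMap hn.two_mul_add_rd φ) := by
  revert χ
  refine dom_induction (fun u χ hlim hu => ?_) fun χ ξ hχ => ?_
  · refine tendsto_nhds_unique ?_
      (((tendsto_coe_of_gnorm hlim).inner tendsto_const_nhds).neg.congr fun k => (hu k).symm)
    exact ((tendsto_radialMap hn hlim).inner tendsto_const_nhds).add
      ((tendsto_coe_of_gnorm hlim).inner tendsto_const_nhds)
  revert φ
  refine dom_induction (fun u φ hlim hu => ?_) fun φ η hφ => ?_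
  · refine tendsto_nhds_unique ?_
      ((tendsto_const_nhds.inner
        (tendsto_fieldMap _ (tendsto_coe_of_gnorm hlim))).neg.congr fun k => (hu k).symm)
    exact (tendsto_const_nhds.inner (tendsto_coe_of_gnorm hlim)).add
      (tendsto_const_nhds.inner (tendsto_radialMap hn hlim))
  have hξ := hχ.test
  have hη := hφ.test
  have hcs : ContDiff ℝ ∞ (fun x => conj (ξ x)) :=
    Complex.conjCLE.toContinuousLinearMap.contDiff.comp hξ.smooth
  have hG0 : IsTest (fun x => conj (ξ x) * η x) := by
    refine ⟨hcs.mul hη.smooth, hη.compact.mul_left, ?_⟩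
    have := hη.away
    rw [notMem_tsupport_iff_eventuallyEq] at this ⊢
    filter_upwards [this] with x hx
    simp [hx]
  have hG := hG0.mul_real hn.smooth
  have hfd : ∀ x : Plane, fderiv ℝ (fun x => (n x : ℂ) * (conj (ξ x) * η x)) x x =
      (n x : ℂ) * conj (fderiv ℝ ξ x x) * η x + conj (ξ x) * ((n x : ℂ) * fderiv ℝ η x x) +
        (rd n x : ℂ) * (conj (ξ x) * η x) := by
    intro x
    rw [fderiv_mul_real hn.smooth hG0.differentiable]
    have h1 : HasFDerivAt (fun x => conj (ξ x))
        (Complex.conjCLE.toContinuousLinearMap.comp (fderiv ℝ ξ x)) x :=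
      (Complex.conjCLE.toContinuousLinearMap.hasFDerivAt).comp x (hξ.differentiable x).hasFDerivAt
    rw [(h1.fun_mul (hη.differentiable x).hasFDerivAt).fderiv]
    simp [rd]
    ring
  have i1 := L2.integrable_inner (𝕜 := ℂ) (radialMap hn χ) (φ : L2)
  have i2 := L2.integrable_inner (𝕜 := ℂ) (χ : L2) (radialMap hn φ)
  have hi := (hG.smooth.continuous).integrable_of_hasCompactSupport hG.compact (μ := volume)
  have hid := hG.continuous_fderiv_self.1.integrable_of_hasCompactSupport
    hG.continuous_fderiv_self.2 (μ := volume)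
  rw [L2.inner_def, L2.inner_def, L2.inner_def, ← integral_add i1 i2]
  have h0 : ∫ x, (fderiv ℝ (fun x => (n x : ℂ) * (conj (ξ x) * η x)) x x +
      2 * ((n x : ℂ) * (conj (ξ x) * η x))) = 0 := by
    rw [integral_add hid (hi.const_mul 2), integral_const_mul, integral_fderiv_self hG]
    ring
  have i12 : Integrable (fun x => inner ℂ (radialMap hn χ x) ((φ : L2) x) +
      inner ℂ ((χ : L2) x) (radialMap hn φ x)) := i1.add i2
  have i3 := L2.integrable_inner (𝕜 := ℂ) (χ : L2) (mulMap hn.two_mul_add_rd φ)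
  rw [← add_eq_zero_iff_eq_neg, ← integral_add i12 i3, ← h0]
  refine integral_congr_ae ?_
  filter_upwards [hχ.radialMap_ae hn, hφ.radialMap_ae hn, hχ.ae_eq, hφ.ae_eq,
    mulMap_ae hn.two_mul_add_rd (φ : L2)] with x e1 e2 e3 e4 e5
  rw [hfd]
  simp only [RCLike.inner_apply, e1, e2, e3, e4, e5, map_mul, Complex.conj_ofReal]
  push_cast
  ring

/-! ### The generator of dilations, tested against compactly supported functions -/

theorem hasDerivAt_inner_mulMap_dilDom_zero {ζ : Plane → ℝ} (hζ : IsCc ζ) (k : L2)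
    {φ : Dom B₀} {η : Plane → ℂ} (hφ : Represents φ η) :
    HasDerivAt (fun s => inner ℂ k (mulMap hζ (dilDom s φ : Dom B₀)))
      (inner ℂ k (mulMap hζ φ) + inner ℂ k (radialMap hζ φ)) 0 := by
  have hw : LocInt (fun x => conj (k x) * (ζ x : ℂ)) := by
    refine locInt_of_memLp ((Lp.memLp (mulMap hζ k)).star.congr_norm ?_ ?_)
    · exact (Complex.continuous_conj.comp_aestronglyMeasurable (Lp.aestronglyMeasurable k)).mul
        (Complex.continuous_ofReal.comp hζ.smooth.continuous).aestronglyMeasurable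
    · filter_upwards [mulMap_ae hζ k] with x hx
      simp [hx, mul_comm]
  have hd := hasDerivAt_integral_dilate hw hφ.test
  have e1 : ∀ s, inner ℂ k (mulMap hζ (dilDom s φ : Dom B₀)) =
      (Real.exp s : ℂ) * ∫ x, conj (k x) * (ζ x : ℂ) * η (Real.exp s • x) := by
    intro s
    rw [L2.inner_def, ← integral_const_mul]
    refine integral_congr_ae ?_
    filter_upwards [mulMap_ae hζ (dilDom s φ : Dom B₀), (hφ.dilate s).ae_eq] with x h1 h2
    rw [h1, h2, RCLike.inner_apply]
    ring
  have e2 : inner ℂ k (radialMap hζ φ) =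
      ∫ x, conj (k x) * (ζ x : ℂ) * fderiv ℝ η x x := by
    rw [L2.inner_def]
    refine integral_congr_ae ?_
    filter_upwards [hφ.radialMap_ae hζ] with x h1
    rw [h1, RCLike.inner_apply]
    ring
  have e3 := e1 0
  simp only [dilDom_zero, Real.exp_zero, Complex.ofReal_one, one_mul] at e3
  have he : HasDerivAt (fun s : ℝ => (Real.exp s : ℂ)) 1 0 := by
    simpa using (Real.hasDerivAt_exp 0).ofReal_comp
  have h3 := he.mul hd
  simp only [e1]
  refine h3.congr_deriv ?_
  rw [e3, e2]
  simp

theorem hasDerivAt_inner_mulMap_dilDom {ζ : Plane → ℝ} (hζ : IsCc ζ) (k : L2)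
    {φ : Dom B₀} {η : Plane → ℂ} (hφ : Represents φ η) (t : ℝ) :
    HasDerivAt (fun s => inner ℂ k (mulMap hζ (dilDom s φ : Dom B₀)))
      (inner ℂ k (mulMap hζ (dilDom t φ : Dom B₀)) + inner ℂ k (radialMap hζ (dilDom t φ))) t := by
  have h1 := hasDerivAt_inner_mulMap_dilDom_zero hζ k (hφ.dilate t)
  simp only [dilDom_dilDom] at h1
  rw [← sub_self t] at h1
  simpa using h1.comp_sub_const t t

/-- The generator 1 + x·∇ need not map the form domain into L², since x is unbounded; after the
cutoff ζ it does. A mean value bound on test functions makes the symmetric quotients uniformly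
bounded in the graph norm, so density applies. -/
theorem tendsto_inner_mulMap_iDDom {ζ : Plane → ℝ} (hζ : IsCc ζ) (k : L2) (φ : Dom B₀) :
    Tendsto (fun t => inner ℂ k (mulMap hζ (iDDom t φ : Dom B₀))) (𝓝[≠] 0)
      (𝓝 (inner ℂ k (mulMap hζ φ) + inner ℂ k (radialMap hζ φ))) := by
  obtain ⟨C₁, hC₁, h₁⟩ := norm_fieldMap_le (isBddField_smul (E := ℂ) hζ.smooth.continuous hζ.bdd)
  obtain ⟨C₂, hC₂, h₂⟩ := norm_radialMap_le (B₀ := B₀) hζ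
  set g : Dom B₀ → ℂ := fun φ => inner ℂ k (mulMap hζ φ) + inner ℂ k (radialMap hζ φ) with hg
  have hgb : ∀ φ, ‖g φ‖ ≤ ‖k‖ * (C₁ + C₂) * gnorm B₀ φ := by
    intro φ
    have a1 := norm_inner_le_norm (𝕜 := ℂ) k (mulMap hζ φ)
    have a2 := norm_inner_le_norm (𝕜 := ℂ) k (radialMap hζ φ)
    have a3 := mul_le_mul_of_nonneg_left ((h₁ (φ : L2)).trans
      (mul_le_mul_of_nonneg_left (norm_le_gnorm φ) hC₁)) (norm_nonneg k)
    have a4 := mul_le_mul_of_nonneg_left (h₂ φ) (norm_nonneg k)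
    refine (norm_add_le _ _).trans ?_
    calc _ ≤ ‖k‖ * (C₁ * gnorm B₀ φ) + ‖k‖ * (C₂ * gnorm B₀ φ) :=
          add_le_add (a1.trans a3) (a2.trans a4)
      _ = _ := by ring
  have hgsub : ∀ φ ψ, g φ - g ψ = g (φ - ψ) := by
    intro φ ψ
    simp only [hg, map_sub, inner_sub_right, Submodule.coe_sub]
    ring
  set D : ℝ := ‖k‖ * (C₁ + C₂) with hD
  have hD0 : 0 ≤ D := by positivity
  have hbound : ∀ t : ℝ, |t| ≤ 1 → ∀ φ : Dom B₀,
      ‖inner ℂ k (mulMap hζ (dilDom t φ : Dom B₀)) -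
        inner ℂ k (mulMap hζ (dilDom (-t) φ : Dom B₀))‖ ≤ D * 3 * gnorm B₀ φ * (2 * |t|) := by
    intro t ht
    refine dom_induction (fun u φ hlim hu => ?_) fun φ η hφ => ?_
    · have hl : ∀ s : ℝ, |s| ≤ 1 → Tendsto (fun n => inner ℂ k (mulMap hζ (dilDom s (u n) : Dom B₀)))
          atTop (𝓝 (inner ℂ k (mulMap hζ (dilDom s φ : Dom B₀)))) := fun s hs =>
        tendsto_const_nhds.inner (tendsto_fieldMap _
          (tendsto_coe_of_gnorm (tendsto_gnorm_dilDom_sub hs hlim)))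
      exact le_of_tendsto_of_tendsto ((hl t ht).sub (hl (-t) (by simpa))).norm
        (((gnorm_tendsto hlim).const_mul _).mul_const _) (Eventually.of_forall hu)
    · have := (convex_Icc (-1 : ℝ) 1).norm_image_sub_le_of_norm_hasDerivWithin_le
        (fun s _ => (hasDerivAt_inner_mulMap_dilDom hζ k hφ s).hasDerivWithinAt)
        (C := D * 3 * gnorm B₀ φ) (fun s hs => ?_)
        (x := -t) (y := t) ⟨by linarith [(abs_le.1 ht).2], by linarith [(abs_le.1 ht).1]⟩
        (abs_le.1 ht)
      · refine this.trans (le_of_eq ?_)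
        rw [Real.norm_eq_abs, sub_neg_eq_add, ← two_mul, abs_mul, abs_two]
      · refine (hgb _).trans ?_
        have := mul_le_mul_of_nonneg_left (gnorm_dilDom_le (abs_le.2 hs) φ) hD0
        linarith
  have hiD : ∀ t φ, inner ℂ k (mulMap hζ (iDDom t φ : Dom B₀)) =
      ((2 * t : ℝ) : ℂ)⁻¹ * (inner ℂ k (mulMap hζ (dilDom t φ : Dom B₀)) -
        inner ℂ k (mulMap hζ (dilDom (-t) φ : Dom B₀))) := by
    intro t φ
    rw [iDDom, Submodule.coe_smul, map_smul, inner_smul_right, Submodule.coe_sub, map_sub,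
      inner_sub_right]
  have hsmall : ∀ᶠ t : ℝ in 𝓝[≠] 0, |t| ≤ 1 ∧ t ≠ 0 := by
    refine (Filter.Eventually.and ?_ self_mem_nhdsWithin)
    filter_upwards [mem_nhdsWithin_of_mem_nhds (Metric.closedBall_mem_nhds (0 : ℝ) one_pos)]
      with t ht
    simpa using ht
  refine tendsto_of_represents
    (f := fun t φ => inner ℂ k (mulMap hζ (iDDom t φ : Dom B₀))) (g := g)
    (β := fun φ ψ => D * 3 * gnorm B₀ (φ - ψ)) (fun φ ψ => ?_) (fun φ ψ => ?_) (fun u φ hu => ?_)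
    (fun φ η hφ => ?_) φ
  · filter_upwards [hsmall] with t ⟨ht, ht0⟩
    have e : inner ℂ k (mulMap hζ (iDDom t φ : Dom B₀)) -
        inner ℂ k (mulMap hζ (iDDom t ψ : Dom B₀)) =
        inner ℂ k (mulMap hζ (iDDom t (φ - ψ) : Dom B₀)) := by
      simp only [hiD, map_sub, Submodule.coe_sub, inner_sub_right]
      ring
    rw [e, hiD, norm_mul, norm_inv, Complex.norm_real, Real.norm_eq_abs, abs_mul, abs_two,
      inv_mul_le_iff₀ (by positivity)]
    linarith [hbound t ht (φ - ψ)]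
  · rw [hgsub]
    have := hgb (φ - ψ)
    have h0 : 0 ≤ D * gnorm B₀ (φ - ψ) := by positivity
    linarith
  · simpa using hu.const_mul (D * 3)
  · have h1 := hasDerivAt_inner_mulMap_dilDom_zero hζ k hφ
    have h1' := h1
    rw [← neg_zero] at h1'
    -- The symmetric quotient is half the slope at 0 of s ↦ f(s) − f(−s).
    have h2 := h1.sub (h1'.scomp (0 : ℝ) (hasDerivAt_neg (0 : ℝ)))
    have h3 := h2.tendsto_slope_zero.const_mul (2 : ℂ)⁻¹
    have e0 : (2 : ℂ)⁻¹ * (g φ - (-1 : ℝ) • g φ) = g φ := by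
      rw [Complex.real_smul]; push_cast; ring
    refine (h3.congr fun t => ?_).trans_eq ?_
    · simp only [Function.comp_def, Pi.sub_apply, zero_add, neg_zero, sub_self, sub_zero, hiD,
        Complex.real_smul]
      push_cast
      rw [mul_inv]
      ring
    · rw [← e0]

/-! ### Exponentially weighted eigenfunctions -/

/-- A compactly supported weight `F` with `∇ F = g x`. -/
structure IsWeight (F g : Plane → ℝ) : Prop where
  weight : IsCc F
  slope : IsCc g
  grad : ∀ x v, fderiv ℝ F x v = g x * inner ℝ x v

theorem IsCc.sq_norm {g : Plane → ℝ} (h : IsCc g) : IsCc (fun x => (‖x‖ * g x) ^ 2) := by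
  have := h.mul_smooth ((contDiff_norm_sq ℝ (E := Plane) (n := ∞)).mul h.smooth)
  convert this using 2 with x
  ring

theorem IsWeight.gradC_exp {F g : Plane → ℝ} (h : IsWeight F g) (x : Plane) :
    gradC (fun x => Real.exp (F x)) x = ((Real.exp (F x) * g x : ℝ) : ℂ) • posC x := by
  ext j
  simp only [gradC, fderiv_exp_comp h.weight.smooth, smul_apply, h.grad, posC, PiLp.smul_apply,
    smul_eq_mul, EuclideanSpace.inner_single_right]
  rw [one_mul, conj_trivial]
  push_cast
  ring

/-- Pointwise algebra of the conjugation: p is the position, e = e^F, (a, c) are (P−A)χ and χ, (b,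
d) are (P−A)φ and φ, and q is (P−A)ψ. The hypothesis is the Leibniz rule for φ = e^F ψ solved for
e^F q; the factor e^F on the left is moved onto q. -/
theorem inner_weighted {E : Type*} [NormedAddCommGroup E] [InnerProductSpace ℂ E] {a b p q : E}
    {c d : ℂ} {e g : ℝ} (hq : (e : ℂ) • q = b + (Complex.I * (g * d)) • p) :
    inner ℂ ((e : ℂ) • a + c • (-Complex.I • ((e * g : ℝ) : ℂ) • p)) q =
      inner ℂ a b - conj ((g : ℂ) * (Complex.I * inner ℂ p a)) * d +
        conj c * (g * (Complex.I * inner ℂ p b)) - conj c * (((‖p‖ * g) ^ 2 : ℝ) * d) := by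
  have h1 : inner ℂ ((e : ℂ) • a + c • (-Complex.I • ((e * g : ℝ) : ℂ) • p)) q =
      inner ℂ (a + (c * (-Complex.I) * g) • p) ((e : ℂ) • q) := by
    have h : (e : ℂ) • a + c • (-Complex.I • ((e * g : ℝ) : ℂ) • p) =
        (e : ℂ) • (a + (c * (-Complex.I) * g) • p) := by
      rw [smul_add, smul_smul, smul_smul, smul_smul]
      push_cast
      ring_nf
    rw [h, inner_smul_right, inner_smul_left, Complex.conj_ofReal]
  have h2 : conj (inner ℂ p a) = inner ℂ a p := inner_conj_symm a p
  have h3 : inner ℂ p p = ((‖p‖ : ℝ) : ℂ) ^ 2 := inner_self_eq_norm_sq_to_K p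
  rw [h1, hq, inner_add_left, inner_add_right, inner_add_right, inner_smul_left, inner_smul_left,
    inner_smul_right, inner_smul_right, h3]
  simp only [map_mul, map_neg, Complex.conj_I, Complex.conj_ofReal, h2]
  push_cast
  linear_combination (conj c * g * (g * d) * (‖p‖ : ℂ) ^ 2) * Complex.I_mul_I

/-- The zeroth order coefficient of the conjugated operator. -/
noncomputable def weightCoeff (g : Plane → ℝ) (x : Plane) : ℝ :=
  (‖x‖ * g x) ^ 2 - (2 * g x + rd g x)

theorem IsCc.weightCoeff {g : Plane → ℝ} (h : IsCc g) : IsCc (weightCoeff g) :=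
  h.sq_norm.sub h.two_mul_add_rd

/-- Test the eigenvalue equation with e^F χ: the potential and eigenvalue terms only see the product
e^F ψ = φ, and the kinetic term produces the commutator with e^F. -/
theorem exists_weighted {V : Plane → ℝ} {E : ℝ} {ψ : Dom B₀}
    (heig : ∀ χ : Dom B₀, form B₀ V χ ψ = inner ℂ (χ : L2) ((E : ℂ) • (ψ : L2)))
    {F g : Plane → ℝ} (hF : IsWeight F g) :
    ∃ φ : Dom B₀, (φ : L2) =ᵐ[volume] (fun x => (Real.exp (F x) : ℂ) * (ψ : L2) x) ∧
      ∀ χ : Dom B₀, form B₀ V χ φ = E * inner ℂ (χ : L2) (φ : L2) +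
        inner ℂ (χ : L2) (mulMap hF.slope.weightCoeff φ - (2 : ℂ) • radialMap hF.slope φ) := by
  obtain ⟨φ, hφ, hφ'⟩ := hF.weight.exp.exists_mul ψ
  refine ⟨φ, hφ, fun χ => ?_⟩
  obtain ⟨χ', hχ, hχ'⟩ := hF.weight.exp.exists_mul χ
  have h0 := heig χ'
  have hV : ∫ x, conj ((χ' : L2) x) * (V x : ℂ) * (ψ : L2) x =
      ∫ x, conj ((χ : L2) x) * (V x : ℂ) * (φ : L2) x := by
    refine integral_congr_ae ?_
    filter_upwards [hφ, hχ] with x h1 h2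
    rw [h1, h2, map_mul, Complex.conj_ofReal]
    ring
  have hE : inner ℂ (χ' : L2) ((E : ℂ) • (ψ : L2)) = E * inner ℂ (χ : L2) (φ : L2) := by
    rw [inner_smul_right]
    congr 1
    rw [L2.inner_def, L2.inner_def]
    refine integral_congr_ae ?_
    filter_upwards [hφ, hχ] with x h1 h2
    rw [h1, h2, RCLike.inner_apply, RCLike.inner_apply, map_mul, Complex.conj_ofReal]
    ring
  have hP : inner ℂ (momentum B₀ χ') (momentum B₀ ψ) =
      inner ℂ (momentum B₀ χ) (momentum B₀ φ) - inner ℂ (radialMap hF.slope χ) (φ : L2) +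
        inner ℂ (χ : L2) (radialMap hF.slope φ) -
        inner ℂ (χ : L2) (mulMap hF.slope.sq_norm φ) := by
    simp only [L2.inner_def]
    have i1 := L2.integrable_inner (𝕜 := ℂ) (momentum B₀ χ) (momentum B₀ φ)
    have i2 := L2.integrable_inner (𝕜 := ℂ) (radialMap hF.slope χ) (φ : L2)
    have i3 := L2.integrable_inner (𝕜 := ℂ) (χ : L2) (radialMap hF.slope φ)
    have i4 := L2.integrable_inner (𝕜 := ℂ) (χ : L2) (mulMap hF.slope.sq_norm φ)
    have i12 : Integrable (fun x => inner ℂ (momentum B₀ χ x) (momentum B₀ φ x) -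
      inner ℂ (radialMap hF.slope χ x) ((φ : L2) x)) := i1.sub i2
    have i123 : Integrable (fun x => inner ℂ (momentum B₀ χ x) (momentum B₀ φ x) -
      inner ℂ (radialMap hF.slope χ x) ((φ : L2) x) +
      inner ℂ ((χ : L2) x) (radialMap hF.slope φ x)) := i12.add i3
    rw [← integral_sub i1 i2, ← integral_add i12 i3, ← integral_sub i123 i4]
    refine integral_congr_ae ?_
    filter_upwards [hφ, hφ', hχ', radialMap_ae hF.slope χ, radialMap_ae hF.slope φ,
      mulMap_ae hF.slope.sq_norm (φ : L2)] with x h1 h2 h3 h4 h5 h6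
    have hq : ((Real.exp (F x) : ℝ) : ℂ) • momentum B₀ ψ x =
        momentum B₀ φ x + (Complex.I * (g x * (φ : L2) x)) • posC x := by
      rw [h2, h1, hF.gradC_exp, add_assoc, left_eq_add, smul_smul, smul_smul, ← add_smul]
      convert zero_smul ℂ _
      push_cast
      ring
    rw [h3, hF.gradC_exp, inner_weighted hq, h4, h5, h6, norm_posC]
    simp only [RCLike.inner_apply]
    ring
  -- Moving the radial derivative from χ to φ doubles the first order term and subtracts div(g x)
  -- from the zeroth order one.
  have hdiv := inner_radialMap_add hF.slope χ φ
  have hm : mulMap hF.slope.weightCoeff (φ : L2) =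
      mulMap hF.slope.sq_norm (φ : L2) - mulMap hF.slope.two_mul_add_rd (φ : L2) := by
    ext1
    filter_upwards [mulMap_ae hF.slope.weightCoeff (φ : L2), mulMap_ae hF.slope.sq_norm (φ : L2),
      mulMap_ae hF.slope.two_mul_add_rd (φ : L2),
      Lp.coeFn_sub (mulMap hF.slope.sq_norm (φ : L2)) (mulMap hF.slope.two_mul_add_rd (φ : L2))]
      with x h1 h2 h3 h4
    rw [h1, h4, Pi.sub_apply, h2, h3, weightCoeff]
    push_cast
    ring
  rw [form, hV, hE, hP] at h0
  rw [form, hm, inner_sub_right, inner_sub_right, inner_smul_right]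
  linear_combination h0 + hdiv

/-! ### Energy identity and virial inequality -/

theorem inner_mulMap_self {n : Plane → ℝ} (hn : IsCc n) (φ : L2) :
    inner ℂ φ (mulMap hn φ) = (potentialQuad n φ : ℂ) := by
  rw [L2.inner_def, potentialQuad, ← integral_complex_ofReal]
  refine integral_congr_ae ?_
  filter_upwards [mulMap_ae hn φ] with x hx
  rw [hx, RCLike.inner_apply]
  push_cast
  rw [← Complex.mul_conj']
  ring

theorem re_inner_radialMap_self {n : Plane → ℝ} (hn : IsCc n) (φ : Dom B₀) :
    2 * (inner ℂ (φ : L2) (radialMap hn φ)).re =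
      -potentialQuad (fun x => 2 * n x + rd n x) φ := by
  have h := congrArg Complex.re (inner_radialMap_add hn φ φ)
  rw [inner_mulMap_self, Complex.add_re, Complex.neg_re, Complex.ofReal_re,
    ← inner_conj_symm, Complex.conj_re] at h
  linarith

theorem integrable_potentialQuad_of_isCc {n : Plane → ℝ} (hn : IsCc n) (φ : L2) :
    Integrable (fun x => n x * ‖φ x‖ ^ 2) := by
  obtain ⟨C, hC⟩ := hn.bdd
  exact (Lp.memLp φ).norm.integrable_sq.bdd_mul hn.smooth.continuous.aestronglyMeasurable
    (Eventually.of_forall hC)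

theorem potentialQuad_add {m n : Plane → ℝ} {φ : L2} (hm : Integrable (fun x => m x * ‖φ x‖ ^ 2))
    (hn : Integrable (fun x => n x * ‖φ x‖ ^ 2)) :
    potentialQuad (fun x => m x + n x) φ = potentialQuad m φ + potentialQuad n φ := by
  simp only [potentialQuad, add_mul]
  exact integral_add hm hn

theorem potentialQuad_sub {m n : Plane → ℝ} {φ : L2} (hm : Integrable (fun x => m x * ‖φ x‖ ^ 2))
    (hn : Integrable (fun x => n x * ‖φ x‖ ^ 2)) :
    potentialQuad (fun x => m x - n x) φ = potentialQuad m φ - potentialQuad n φ := by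
  simp only [potentialQuad, sub_mul]
  exact integral_sub hm hn

theorem potentialQuad_const_mul {n : Plane → ℝ} (c : ℝ) (φ : L2) :
    potentialQuad (fun x => c * n x) φ = c * potentialQuad n φ := by
  simp only [potentialQuad, mul_assoc]
  exact integral_const_mul _ _

theorem re_form_self {V : Plane → ℝ} (hm : AEMeasurable V volume) (h : FormDomainContains B₀ V)
    (φ : Dom B₀) : (form B₀ V φ φ).re = ‖momentum B₀ φ‖ ^ 2 + potentialQuad V φ := by
  rw [form_eq hm h, potForm_self, Complex.add_re, Complex.ofReal_re]
  congr 1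
  exact inner_self_eq_norm_sq (𝕜 := ℂ) _

theorem re_form_comm {V : Plane → ℝ} (hm : AEMeasurable V volume) (h : FormDomainContains B₀ V)
    (φ ψ : Dom B₀) : (form B₀ V φ ψ).re = (form B₀ V ψ φ).re := by
  rw [form_eq hm h, form_eq hm h, Complex.add_re, Complex.add_re, ← inner_conj_symm,
    ← potForm_conj, Complex.conj_re, Complex.conj_re]

/-- The weighted eigenvalue equation for `φ = e^F ψ`. -/
def IsWeighted (V : Plane → ℝ) (E : ℝ) {g : Plane → ℝ} (hg : IsCc g) (φ : Dom B₀) : Prop :=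
  ∀ χ : Dom B₀, form B₀ V χ φ = E * inner ℂ (χ : L2) (φ : L2) +
    inner ℂ (χ : L2) (mulMap hg.weightCoeff φ - (2 : ℂ) • radialMap hg φ)

/-- Testing with φ itself, the real part of the first order term reduces to ⟨div(g x)⟩ and cancels
the divergence in `weightCoeff`. -/
theorem IsWeighted.energy {V : Plane → ℝ} (hm : AEMeasurable V volume)
    (h : FormDomainContains B₀ V) {E : ℝ} {g : Plane → ℝ} {hg : IsCc g} {φ : Dom B₀}
    (hφ : IsWeighted V E hg φ) :
    ‖momentum B₀ φ‖ ^ 2 + potentialQuad V φ =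
      E * ‖(φ : L2)‖ ^ 2 + potentialQuad (fun x => (‖x‖ * g x) ^ 2) φ := by
  have h1 := congrArg Complex.re (hφ φ)
  have h2 := re_inner_radialMap_self hg φ
  have h3 : potentialQuad (weightCoeff g) φ = potentialQuad (fun x => (‖x‖ * g x) ^ 2) φ -
      potentialQuad (fun x => 2 * g x + rd g x) φ :=
    potentialQuad_sub (integrable_potentialQuad_of_isCc hg.sq_norm _)
      (integrable_potentialQuad_of_isCc hg.two_mul_add_rd _)
  have h4 : (inner ℂ (φ : L2) (φ : L2)).re = ‖(φ : L2)‖ ^ 2 := inner_self_eq_norm_sq (𝕜 := ℂ) _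
  rw [re_form_self hm h, Complex.add_re, Complex.re_ofReal_mul, h4, inner_sub_right,
    inner_mulMap_self, inner_smul_right, Complex.sub_re, Complex.ofReal_re, h3] at h1
  have h5 : ((2 : ℂ) * inner ℂ (φ : L2) (radialMap hg φ)).re =
      2 * (inner ℂ (φ : L2) (radialMap hg φ)).re := by simp
  rw [h5, h2] at h1
  linarith

/-- The operator iD_t is antisymmetric, so the eigenvalue drops out of the virial identity. -/
theorem re_inner_iDDom_self (t : ℝ) (φ : Dom B₀) :
    (inner ℂ ((iDDom t φ : Dom B₀) : L2) (φ : L2)).re = 0 := by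
  have h : (inner ℂ (dil (-t) (φ : L2)) (φ : L2)).re = (inner ℂ (dil t (φ : L2)) (φ : L2)).re := by
    rw [inner_dil_left, neg_neg, ← inner_conj_symm, Complex.conj_re]
  rw [iDDom, Submodule.coe_smul, inner_smul_left, Submodule.coe_sub, inner_sub_left, coe_dilDom,
    coe_dilDom, ← Complex.ofReal_inv, Complex.conj_ofReal, Complex.re_ofReal_mul, Complex.sub_re, h,
    sub_self, mul_zero]

theorem exists_isCc_eq_one {g : Plane → ℝ} (hg : IsCc g) :
    ∃ ζ : Plane → ℝ, IsCc ζ ∧ (∀ x, 0 ≤ ζ x) ∧ ∀ x ∈ tsupport g, ζ x = 1 := by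
  obtain ⟨R, hR⟩ := hg.compact.isBounded.exists_norm_le
  let b : ContDiffBump (0 : Plane) := ⟨|R| + 1, |R| + 2, by positivity, by linarith⟩
  refine ⟨b, ⟨b.contDiff, b.hasCompactSupport⟩, fun x => b.nonneg, fun x hx => ?_⟩
  refine b.one_of_mem_closedBall ?_
  simp only [mem_closedBall_zero_iff]
  show ‖x‖ ≤ |R| + 1
  linarith [hR x hx, le_abs_self R]

/-- Test with iD_t φ and let t → 0. The left side is the virial theorem. On the right the vector k
lives on the support of g, so ζ can be inserted for free, and the cut-off generator has a weak
limit. -/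
theorem IsWeighted.virial_eq {V : Plane → ℝ} (hm : AEMeasurable V volume)
    (h : IsFormBounded B₀ V) {w : Dom B₀ → ℝ} (hwl : IsQuadLip w)
    (hw : ∀ φ η, Represents φ η → w φ = virialTest V η) {E : ℝ} {g ζ : Plane → ℝ} {hg : IsCc g}
    (hζ : IsCc ζ) (h1 : ∀ x ∈ tsupport g, ζ x = 1) {φ : Dom B₀} (hφ : IsWeighted V E hg φ) :
    2 * ‖momentum B₀ φ‖ ^ 2 - w φ =
      2 * (inner ℂ (mulMap hg.weightCoeff φ - (2 : ℂ) • radialMap hg φ)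
        (mulMap hζ φ + radialMap hζ φ)).re := by
  set k : L2 := mulMap hg.weightCoeff φ - (2 : ℂ) • radialMap hg φ with hk
  have hkζ : ∀ᵐ x : Plane, (ζ x : ℂ) * k x = k x := by
    filter_upwards [Lp.coeFn_sub (mulMap hg.weightCoeff φ) ((2 : ℂ) • radialMap hg φ),
      Lp.coeFn_smul (2 : ℂ) (radialMap hg φ), mulMap_ae hg.weightCoeff (φ : L2),
      radialMap_ae hg φ] with x e1 e2 e3 e4
    rw [hk, e1, Pi.sub_apply, e2, Pi.smul_apply, e3, e4]
    by_cases hx : x ∈ tsupport g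
    · rw [h1 x hx]; simp
    · have hg0 : g x = 0 := image_eq_zero_of_notMem_tsupport hx
      have hf0 : fderiv ℝ g x = 0 := by
        by_contra h
        exact hx (support_fderiv_subset ℝ (Function.mem_support.2 h))
      simp [weightCoeff, rd, hg0, hf0]
  have hkf : ∀ f : L2, inner ℂ k f = inner ℂ k (mulMap hζ f) := by
    intro f
    rw [L2.inner_def, L2.inner_def]
    refine integral_congr_ae ?_
    filter_upwards [hkζ, mulMap_ae hζ f] with x e1 e2
    rw [e2, RCLike.inner_apply, RCLike.inner_apply]
    conv_lhs => rw [← e1, map_mul, Complex.conj_ofReal]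
    ring
  have hlim := tendsto_re_form_iDDom hm h hwl hw φ
  have hlim' := ((Complex.continuous_re.tendsto _).comp
    (tendsto_inner_mulMap_iDDom hζ k φ)).const_mul 2
  rw [inner_add_right]
  refine tendsto_nhds_unique hlim (hlim'.congr fun t => ?_)
  rw [Function.comp_apply, ← hkf, re_form_comm hm h.1, hφ, Complex.add_re, Complex.re_ofReal_mul,
    re_inner_iDDom_self, mul_zero, zero_add, ← inner_conj_symm, Complex.conj_re]

/-- The virial inequality for exponentially weighted eigenfunctions. -/
theorem IsWeighted.virial_le {V : Plane → ℝ} (hm : AEMeasurable V volume)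
    (h : IsFormBounded B₀ V) {w : Dom B₀ → ℝ} (hwl : IsQuadLip w)
    (hw : ∀ φ η, Represents φ η → w φ = virialTest V η) {E : ℝ} {g : Plane → ℝ} {hg : IsCc g}
    (hpos : ∀ x, 0 ≤ g x) {φ : Dom B₀} (hφ : IsWeighted V E hg φ) :
    2 * ‖momentum B₀ φ‖ ^ 2 - w φ + potentialQuad (rd fun x => (‖x‖ * g x) ^ 2) φ ≤
      potentialQuad (rd (rd g)) φ := by
  obtain ⟨ζ, hζ, hζ0, h1⟩ := exists_isCc_eq_one hg
  have hv := hφ.virial_eq hm h hwl hw hζ h1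
  -- ζ equals one wherever n is nonzero, so it disappears from these inner products.
  have hmul : ∀ {n : Plane → ℝ} (hn : IsCc n), (∀ x, n x ≠ 0 → x ∈ tsupport g) →
      inner ℂ (mulMap hn φ) (mulMap hζ φ) = (potentialQuad n φ : ℂ) ∧
      inner ℂ (mulMap hn φ) (radialMap hζ φ) = inner ℂ (φ : L2) (radialMap hn φ) := by
    intro n hn hs
    have hnζ : ∀ x, n x * ζ x = n x := fun x => by
      by_cases hx : n x = 0
      · simp [hx]
      · rw [h1 x (hs x hx), mul_one]
    constructor
    · rw [← inner_mulMap_self hn, L2.inner_def, L2.inner_def]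
      refine integral_congr_ae ?_
      filter_upwards [mulMap_ae hn (φ : L2), mulMap_ae hζ (φ : L2)] with x e1 e2
      rw [e1, e2, RCLike.inner_apply, RCLike.inner_apply, map_mul, Complex.conj_ofReal]
      conv_rhs => rw [← hnζ x]
      push_cast
      ring
    · rw [L2.inner_def, L2.inner_def]
      refine integral_congr_ae ?_
      filter_upwards [mulMap_ae hn (φ : L2), radialMap_ae hζ φ, radialMap_ae hn φ] with x e1 e2 e3
      rw [e1, e2, e3, RCLike.inner_apply, RCLike.inner_apply, map_mul, Complex.conj_ofReal]
      conv_rhs => rw [← hnζ x]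
      push_cast
      ring
  have hgs : ∀ x, g x ≠ 0 → x ∈ tsupport g := fun x hx => subset_tsupport _ hx
  have hms : ∀ x, weightCoeff g x ≠ 0 → x ∈ tsupport g := by
    intro x hx
    by_contra hx'
    have hg0 : g x = 0 := image_eq_zero_of_notMem_tsupport hx'
    have hf0 : fderiv ℝ g x = 0 := by
      by_contra h
      exact hx' (support_fderiv_subset ℝ (Function.mem_support.2 h))
    exact hx (by simp [weightCoeff, rd, hg0, hf0])
  obtain ⟨a1, a2⟩ := hmul hg.weightCoeff hms
  have a3 : inner ℂ (radialMap hg φ) (mulMap hζ φ) = conj (inner ℂ (φ : L2) (radialMap hg φ)) := by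
    rw [inner_conj_symm, L2.inner_def, L2.inner_def]
    refine integral_congr_ae ?_
    filter_upwards [radialMap_ae hg φ, mulMap_ae hζ (φ : L2)] with x e1 e2
    rw [e1, e2, RCLike.inner_apply, RCLike.inner_apply, map_mul, Complex.conj_ofReal]
    by_cases hx : g x = 0
    · simp [hx]
    · rw [h1 x (hgs x hx)]; simp
  -- completing the square
  have hsq : 0 ≤ (inner ℂ (mulMap hg φ + radialMap hg φ) (mulMap hζ φ + radialMap hζ φ)).re := by
    rw [L2.inner_def]
    have e : ∀ᵐ x : Plane, inner ℂ ((mulMap hg φ + radialMap hg φ : L2) x)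
        ((mulMap hζ φ + radialMap hζ φ : L2) x) = ((g x * ζ x *
          ‖(φ : L2) x + Complex.I * inner ℂ (posC x) (momentum B₀ φ x)‖ ^ 2 : ℝ) : ℂ) := by
      filter_upwards [Lp.coeFn_add (mulMap hg (φ : L2)) (radialMap hg φ),
        Lp.coeFn_add (mulMap hζ (φ : L2)) (radialMap hζ φ), mulMap_ae hg (φ : L2),
        radialMap_ae hg φ, mulMap_ae hζ (φ : L2), radialMap_ae hζ φ] with x e1 e2 e3 e4 e5 e6
      rw [e1, e2, Pi.add_apply, Pi.add_apply, e3, e4, e5, e6, ← mul_add, ← mul_add,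
        RCLike.inner_apply, map_mul, Complex.conj_ofReal]
      push_cast
      rw [← Complex.mul_conj']
      ring
    rw [integral_congr_ae e, integral_complex_ofReal, Complex.ofReal_re]
    exact integral_nonneg fun x => mul_nonneg (mul_nonneg (hpos x) (hζ0 x)) (sq_nonneg _)
  obtain ⟨b1, b2⟩ := hmul hg hgs
  have c1 := re_inner_radialMap_self hg φ
  have c2 := re_inner_radialMap_self hg.weightCoeff φ
  have i0 := integrable_potentialQuad_of_isCc hg (φ : L2)
  have i1 := integrable_potentialQuad_of_isCc hg.rd (φ : L2)
  have i2 := integrable_potentialQuad_of_isCc hg.rd.rd (φ : L2)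
  have i3 := integrable_potentialQuad_of_isCc hg.sq_norm (φ : L2)
  have i4 := integrable_potentialQuad_of_isCc hg.sq_norm.rd (φ : L2)
  have i5 := integrable_potentialQuad_of_isCc hg.two_mul_add_rd (φ : L2)
  have i6 := integrable_potentialQuad_of_isCc hg.weightCoeff (φ : L2)
  have i7 := integrable_potentialQuad_of_isCc hg.weightCoeff.rd (φ : L2)
  have i8 := integrable_potentialQuad_of_isCc (hg.mul_smooth (m := fun _ => 2) contDiff_const) (φ : L2)
  have i9 := integrable_potentialQuad_of_isCc
    (hg.rd.mul_smooth (m := fun _ => 2) contDiff_const) (φ : L2)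
  have i10 := integrable_potentialQuad_of_isCc
    (hg.weightCoeff.mul_smooth (m := fun _ => 2) contDiff_const) (φ : L2)
  have d1 : potentialQuad (fun x => 2 * g x + rd g x) φ =
      2 * potentialQuad g φ + potentialQuad (rd g) φ := by
    rw [potentialQuad_add i8 i1, potentialQuad_const_mul]
  have d2 : potentialQuad (fun x => 2 * weightCoeff g x + rd (weightCoeff g) x) φ =
      2 * potentialQuad (weightCoeff g) φ + potentialQuad (rd (weightCoeff g)) φ := by
    rw [potentialQuad_add i10 i7, potentialQuad_const_mul]
  have d4 : potentialQuad (rd (weightCoeff g)) φ =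
      potentialQuad (rd fun x => (‖x‖ * g x) ^ 2) φ -
        (2 * potentialQuad (rd g) φ + potentialQuad (rd (rd g)) φ) := by
    have e : rd (weightCoeff g) = fun x => rd (fun x => (‖x‖ * g x) ^ 2) x -
        (2 * rd g x + rd (rd g) x) := by
      funext x
      have e1 : rd (weightCoeff g) x = rd (fun x => (‖x‖ * g x) ^ 2) x -
          rd (fun x => 2 * g x + rd g x) x := rd_sub hg.sq_norm hg.two_mul_add_rd x
      rw [e1, rd_add (hg.mul_smooth (m := fun _ => 2) contDiff_const) hg.rd, rd_const_mul 2 hg]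
    rw [e, potentialQuad_sub i4 (integrable_potentialQuad_of_isCc hg.rd.two_mul_add_rd _),
      potentialQuad_add i9 i2, potentialQuad_const_mul]
  -- Exactly, the right side of the virial identity is ⟨(x·∇)²g⟩ − ⟨x·∇(|x|²g²)⟩ minus four times
  -- the square, the latter being ⟨g |(1 + x·∇)φ|²⟩.
  rw [inner_add_left, inner_add_right, inner_add_right, b1, b2, a3, Complex.add_re, Complex.add_re,
    Complex.add_re, Complex.conj_re, Complex.ofReal_re] at hsq
  rw [inner_sub_left, inner_add_right, a1, a2, inner_smul_left, inner_add_right, a3,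
    Complex.sub_re, Complex.add_re, Complex.ofReal_re, Complex.conj_ofNat,
    ← Complex.ofReal_ofNat 2, Complex.re_ofReal_mul, Complex.add_re, Complex.conj_re] at hv
  linarith

/-! ### The virial form of a potential with `|x|² V²` form bounded -/

theorem isBddField_unitRadial :
    IsBddField (fun x => ((‖x‖⁻¹ : ℝ) * Complex.I : ℂ) • innerSL ℂ (posC x)) := by
  refine ⟨?_, 1, fun x => ?_⟩
  · have h3 := (innerSL ℂ (E := EuclideanSpace ℂ (Fin 2))).continuous.comp continuous_posC
    have h2 : Measurable fun x : Plane => ((‖x‖⁻¹ : ℝ) * Complex.I : ℂ) :=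
      (Complex.measurable_ofReal.comp measurable_norm.inv).mul_const _
    exact h2.aestronglyMeasurable.smul h3.aestronglyMeasurable
  · rw [norm_smul, innerSL_apply_norm, norm_posC, norm_mul, Complex.norm_I, mul_one,
      Complex.norm_real, norm_inv, norm_norm]
    exact inv_mul_le_one

/-- The operator `φ ↦ i (x / |x|) · (P - A) φ`. -/
noncomputable def unitRadialMap : Dom B₀ →ₗ[ℂ] L2 :=
  fieldMap isBddField_unitRadial ∘ₗ (momentum B₀).toFun

theorem unitRadialMap_ae (φ : Dom B₀) : unitRadialMap φ =ᵐ[volume] fun x =>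
    ((‖x‖⁻¹ : ℝ) : ℂ) * (Complex.I * inner ℂ (posC x) (momentum B₀ φ x)) := by
  filter_upwards [fieldMap_ae isBddField_unitRadial (momentum B₀ φ)] with x hx
  rw [← mul_assoc]
  exact hx

theorem norm_unitRadialMap_le (φ : Dom B₀) : ‖unitRadialMap φ‖ ≤ ‖momentum B₀ φ‖ := by
  have h := Lp.norm_le_mul_norm_of_ae_le_mul (c := 1) (f := unitRadialMap φ) (g := momentum B₀ φ) ?_
  · simpa using h
  filter_upwards [unitRadialMap_ae φ] with x hx
  rw [hx, norm_mul, norm_mul, Complex.norm_I, one_mul, Complex.norm_real, norm_inv, norm_norm]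
  have h1 := norm_inner_le_norm (𝕜 := ℂ) (posC x) (momentum B₀ φ x)
  rw [norm_posC] at h1
  calc ‖x‖⁻¹ * ‖(inner ℂ (posC x) (momentum B₀ φ x) : ℂ)‖
      ≤ ‖x‖⁻¹ * (‖x‖ * ‖momentum B₀ φ x‖) := by gcongr
    _ = (‖x‖⁻¹ * ‖x‖) * ‖momentum B₀ φ x‖ := by ring
    _ ≤ _ := mul_le_mul_of_nonneg_right inv_mul_le_one (norm_nonneg _)

theorem memLp_mul_of_formDomain {U : Plane → ℝ} (hU : AEMeasurable U volume)
    (h : FormDomainContains B₀ (fun x => U x ^ 2)) (φ : Dom B₀) :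
    MemLp (fun x => (U x : ℂ) * (φ : L2) x) 2 (volume : Measure Plane) := by
  have hm : AEStronglyMeasurable (fun x => (U x : ℂ) * (φ : L2) x) (volume : Measure Plane) :=
    (Complex.continuous_ofReal.comp_aestronglyMeasurable hU.aestronglyMeasurable).mul
      (Lp.aestronglyMeasurable _)
  refine (memLp_two_iff_integrable_sq_norm hm).2 ((h φ).congr (Eventually.of_forall fun x => ?_))
  simp only [norm_mul, Complex.norm_real, mul_pow, Real.norm_eq_abs, sq_abs]

/-- Multiplication by a real function with form bounded square. -/
noncomputable def formMul {U : Plane → ℝ} (hU : AEMeasurable U volume)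
    (h : FormDomainContains B₀ (fun x => U x ^ 2)) : Dom B₀ →ₗ[ℂ] L2 where
  toFun φ := (memLp_mul_of_formDomain hU h φ).toLp _
  map_add' φ ψ := by
    ext1
    filter_upwards [(memLp_mul_of_formDomain hU h (φ + ψ)).coeFn_toLp,
      (memLp_mul_of_formDomain hU h φ).coeFn_toLp, (memLp_mul_of_formDomain hU h ψ).coeFn_toLp,
      Lp.coeFn_add ((memLp_mul_of_formDomain hU h φ).toLp _)
        ((memLp_mul_of_formDomain hU h ψ).toLp _),
      Lp.coeFn_add (φ : L2) ψ] with x h1 h2 h3 h4 h5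
    rw [h1, h4, Pi.add_apply, h2, h3, Submodule.coe_add, h5, Pi.add_apply, mul_add]
  map_smul' c φ := by
    ext1
    filter_upwards [(memLp_mul_of_formDomain hU h (c • φ)).coeFn_toLp,
      (memLp_mul_of_formDomain hU h φ).coeFn_toLp,
      Lp.coeFn_smul c ((memLp_mul_of_formDomain hU h φ).toLp _),
      Lp.coeFn_smul c (φ : L2)] with x h1 h2 h4 h5
    rw [h1, RingHom.id_apply, h4, Pi.smul_apply, h2, Submodule.coe_smul, h5, Pi.smul_apply,
      smul_eq_mul, smul_eq_mul]
    ring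

theorem formMul_ae {U : Plane → ℝ} (hU : AEMeasurable U volume)
    (h : FormDomainContains B₀ (fun x => U x ^ 2)) (φ : Dom B₀) :
    formMul hU h φ =ᵐ[volume] fun x => (U x : ℂ) * (φ : L2) x :=
  (memLp_mul_of_formDomain hU h φ).coeFn_toLp

theorem norm_sq_eq_integral {E : Type*} [NormedAddCommGroup E] [InnerProductSpace ℂ E]
    (f : Lp E 2 (volume : Measure Plane)) : ‖f‖ ^ 2 = ∫ x, ‖f x‖ ^ 2 := by
  have h1 : ‖f‖ ^ 2 = (inner ℂ f f).re := (inner_self_eq_norm_sq (𝕜 := ℂ) f).symm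
  rw [h1, L2.inner_def]
  have : ∀ x, inner ℂ (f x) (f x) = ((‖f x‖ ^ 2 : ℝ) : ℂ) := fun x => by
    rw [inner_self_eq_norm_sq_to_K]; push_cast; rfl
  simp only [this]
  rw [integral_complex_ofReal, Complex.ofReal_re]

theorem norm_formMul_sq {U : Plane → ℝ} (hU : AEMeasurable U volume)
    (h : FormDomainContains B₀ (fun x => U x ^ 2)) (φ : Dom B₀) :
    ‖formMul hU h φ‖ ^ 2 = potentialQuad (fun x => U x ^ 2) φ := by
  rw [norm_sq_eq_integral, potentialQuad]
  refine integral_congr_ae ?_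
  filter_upwards [formMul_ae hU h φ] with x hx
  rw [hx, norm_mul, Complex.norm_real, mul_pow, Real.norm_eq_abs, sq_abs]

theorem virialTest_add {V₁ V₂ : Plane → ℝ} (h₁ : LocInt (fun x => (V₁ x : ℂ)))
    (h₂ : LocInt (fun x => (V₂ x : ℂ))) {η : Plane → ℂ} (hη : IsTest η) :
    virialTest (fun x => V₁ x + V₂ x) η = virialTest V₁ η + virialTest V₂ η := by
  have hcs : Continuous (fun x => conj (η x)) :=
    Complex.continuous_conj.comp hη.smooth.continuous
  have i : ∀ {V : Plane → ℝ}, LocInt (fun x => (V x : ℂ)) →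
      Integrable (fun x => V x * ‖η x‖ ^ 2) ∧
        Integrable (fun x => (V x : ℂ) * conj (η x) * fderiv ℝ η x x) := by
    intro V h
    have ha := hη.away
    rw [notMem_tsupport_iff_eventuallyEq] at ha
    constructor
    · have h1 := h.integrable_mul (f := fun x => conj (η x) * η x) (hcs.mul hη.smooth.continuous)
        hη.compact.mul_left (by
          rw [notMem_tsupport_iff_eventuallyEq]
          filter_upwards [ha] with x hx
          simp [hx])
      refine h1.re.congr (Eventually.of_forall fun x => ?_)
      simp only [Complex.conj_mul']
      simp [← Complex.ofReal_pow]
    · have h1 := h.integrable_mul (f := fun x => conj (η x) * fderiv ℝ η x x)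
        (hcs.mul hη.continuous_fderiv_self.1) hη.continuous_fderiv_self.2.mul_left (by
          rw [notMem_tsupport_iff_eventuallyEq]
          filter_upwards [ha] with x hx
          simp [hx])
      simpa only [mul_assoc] using h1
  obtain ⟨a1, b1⟩ := i h₁
  obtain ⟨a2, b2⟩ := i h₂
  have e1 : ∫ x, (V₁ x + V₂ x) * ‖η x‖ ^ 2 = (∫ x, V₁ x * ‖η x‖ ^ 2) + ∫ x, V₂ x * ‖η x‖ ^ 2 := by
    rw [← integral_add a1 a2]
    simp only [add_mul]
  have e2 : ∫ x, ((V₁ x + V₂ x : ℝ) : ℂ) * conj (η x) * fderiv ℝ η x x =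
      (∫ x, (V₁ x : ℂ) * conj (η x) * fderiv ℝ η x x) +
        ∫ x, (V₂ x : ℂ) * conj (η x) * fderiv ℝ η x x := by
    rw [← integral_add b1 b2]
    simp only [Complex.ofReal_add, add_mul]
  rw [virialTest, virialTest, virialTest, e1, e2, Complex.add_re]
  ring

theorem isQuadLip_re_inner {X Y : Dom B₀ →ₗ[ℂ] L2} {C D : ℝ} (hC : 0 ≤ C) (hD : 0 ≤ D)
    (hX : ∀ φ, ‖X φ‖ ≤ C * gnorm B₀ φ) (hY : ∀ φ, ‖Y φ‖ ≤ D * gnorm B₀ φ) :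
    IsQuadLip (fun φ => (inner ℂ (X φ) (Y φ)).re) := by
  refine ⟨C * D, by positivity, fun φ ψ => ?_⟩
  have e : inner ℂ (X φ) (Y φ) - inner ℂ (X ψ) (Y ψ) =
      inner ℂ (X (φ - ψ)) (Y φ) + inner ℂ (X ψ) (Y (φ - ψ)) := by
    rw [map_sub, map_sub, inner_sub_left, inner_sub_right]
    ring
  rw [← Complex.sub_re, e]
  refine (Complex.abs_re_le_norm _).trans ((norm_add_le _ _).trans ?_)
  have h1 := (norm_inner_le_norm (𝕜 := ℂ) (X (φ - ψ)) (Y φ)).trans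
    (mul_le_mul (hX (φ - ψ)) (hY φ) (norm_nonneg _) (by positivity))
  have h2 := (norm_inner_le_norm (𝕜 := ℂ) (X ψ) (Y (φ - ψ))).trans
    (mul_le_mul (hX ψ) (hY (φ - ψ)) (norm_nonneg _) (by positivity))
  linarith

/-- The virial form of `V₁ + V₂`, for `V₁` and `|x|² V₁²` form bounded. -/
theorem exists_virial_add {V₁ V₂ : Plane → ℝ} (hm : AEMeasurable V₁ volume)
    (h₁ : IsFormBounded B₀ V₁) (hx : IsFormBounded B₀ (fun x => (‖x‖ * V₁ x) ^ 2))
    (h₂ : LocInt (fun x => (V₂ x : ℂ))) {W₂ : Dom B₀ →ₗ⋆[ℂ] Dom B₀ →ₗ[ℂ] ℂ}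
    (hW : IsVirial B₀ V₂ W₂) :
    ∃ w : Dom B₀ → ℝ, IsQuadLip w ∧
      (∀ φ η, Represents φ η → w φ = virialTest (fun x => V₁ x + V₂ x) η) ∧
      ∀ φ, w φ ≤ (W₂ φ φ).re + 2 * |potentialQuad V₁ φ| +
        2 * Real.sqrt (potentialQuad (fun x => (‖x‖ * V₁ x) ^ 2) φ) * ‖momentum B₀ φ‖ := by
  have hU : AEMeasurable (fun x : Plane => ‖x‖ * V₁ x) volume :=
    measurable_norm.aemeasurable.mul hm
  obtain ⟨C, hC, hCb⟩ := hx.bound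
  have hd : FormDomainContains B₀ (fun x => (‖x‖ * V₁ x) ^ 2) := hx.1
  have hX : ∀ φ, ‖formMul hU hd φ‖ ≤ Real.sqrt C * gnorm B₀ φ := by
    intro φ
    refine abs_le_of_sq_le_sq' ?_ (by positivity) |>.2
    rw [norm_formMul_sq, mul_pow, Real.sq_sqrt hC]
    exact (le_abs_self _).trans (hCb φ)
  have hY : ∀ φ : Dom B₀, ‖unitRadialMap φ‖ ≤ 1 * gnorm B₀ φ := fun φ => by
    rw [one_mul]
    exact (norm_unitRadialMap_le φ).trans (norm_momentum_le_gnorm φ)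
  have hz := isQuadLip_re_inner (Real.sqrt_nonneg C) zero_le_one hX hY
  -- The distribution x·∇V₁ is −2⟨V₁⟩ − 2 Re⟨|x|V₁φ, |x|⁻¹x·∇φ⟩. Both factors of the inner product
  -- are bounded in the graph norm, so this extends from test functions without differentiating V₁.
  refine ⟨fun φ => (W₂ φ φ).re + (-2 * potentialQuad V₁ φ +
    -2 * (inner ℂ (formMul hU hd φ) (unitRadialMap φ)).re),
    hW.isQuadLip.add (((h₁.isQuadLip hm).const_mul (-2)).add (hz.const_mul (-2))),
    fun φ η hφ => ?_, fun φ => ?_⟩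
  · have e1 : (inner ℂ (formMul hU hd φ) (unitRadialMap φ)) =
        ∫ x, (V₁ x : ℂ) * conj (η x) * fderiv ℝ η x x := by
      rw [L2.inner_def]
      refine integral_congr_ae ?_
      filter_upwards [formMul_ae hU hd φ, unitRadialMap_ae φ, hφ.ae_eq, hφ.momentum_ae_eq,
        Measure.ae_ne volume (0 : Plane)] with x a1 a2 a3 a4 a5
      rw [a1, a2, a3, a4, inner_posC_momentumTest, RCLike.inner_apply, map_mul,
        Complex.conj_ofReal]
      have : (‖x‖ : ℂ) ≠ 0 := by exact_mod_cast norm_ne_zero_iff.2 a5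
      push_cast
      field_simp
    have e2 : potentialQuad V₁ φ = ∫ x, V₁ x * ‖η x‖ ^ 2 := by
      refine integral_congr_ae ?_
      filter_upwards [hφ.ae_eq] with x a
      rw [a]
    beta_reduce
    rw [virialTest_add h₁.1.locInt h₂ hφ.test, hW.extend η hφ.test φ hφ.ae_eq, Complex.ofReal_re,
      e1, e2, virialTest, virialTest]
    ring
  · have h1 := (abs_le.1 (Complex.abs_re_le_norm
      (inner ℂ (formMul hU hd φ) (unitRadialMap φ)))).1
    have h2 := norm_inner_le_norm (𝕜 := ℂ) (formMul hU hd φ) (unitRadialMap φ)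
    have h3 := mul_le_mul_of_nonneg_left (norm_unitRadialMap_le φ) (norm_nonneg (formMul hU hd φ))
    have h4 : ‖formMul hU hd φ‖ = Real.sqrt (potentialQuad (fun x => (‖x‖ * V₁ x) ^ 2) φ) := by
      rw [← norm_formMul_sq hU hd, Real.sqrt_sq (norm_nonneg _)]
    rw [h4] at h2 h3
    have h5 := neg_abs_le (potentialQuad V₁ φ)
    simp only
    linarith

/-! ### Radial weights -/

/-- The logarithmic radial variable. -/
noncomputable def lv (x : Plane) : ℝ := Real.log (1 + ‖x‖ ^ 2)

theorem exp_lv (x : Plane) : Real.exp (lv x) = 1 + ‖x‖ ^ 2 := Real.exp_log (by positivity)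

theorem lv_nonneg (x : Plane) : 0 ≤ lv x := Real.log_nonneg (by nlinarith [sq_nonneg ‖x‖])

theorem contDiff_lv : ContDiff ℝ ∞ lv :=
  (contDiff_const.add (contDiff_norm_sq ℝ)).log fun x => by positivity

/-- With v = log(1+|x|²) one has ∇v = 2x/(1+|x|²) = 2e^{−v}x. Hence radial functions of v stay
smooth at the origin and x·∇ becomes 2(1−e^{−v})∂_v. -/
theorem hasFDerivAt_comp_lv {H : ℝ → ℝ} {x : Plane} {d : ℝ} (hH : HasDerivAt H d (lv x)) :
    HasFDerivAt (fun x => H (lv x)) ((2 * d * Real.exp (-lv x)) • innerSL ℝ x) x := by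
  have h1 : HasFDerivAt (fun x : Plane => 1 + ‖x‖ ^ 2) (2 • innerSL ℝ x) x :=
    (hasStrictFDerivAt_norm_sq x).hasFDerivAt.const_add 1
  have h2 := hH.comp_hasFDerivAt x (h1.log (by positivity))
  refine h2.congr_fderiv ?_
  rw [Real.exp_neg, exp_lv]
  ext v
  simp
  ring

/-- The radial derivative in the logarithmic variable. -/
noncomputable def lrd (H : ℝ → ℝ) (v : ℝ) : ℝ := 2 * (1 - Real.exp (-v)) * deriv H v

theorem rd_comp_lv {H : ℝ → ℝ} (hH : ContDiff ℝ ∞ H) (x : Plane) :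
    rd (fun x => H (lv x)) x = lrd H (lv x) := by
  rw [rd, (hasFDerivAt_comp_lv ((hH.differentiable (by simp)) (lv x)).hasDerivAt).fderiv, lrd]
  have : ‖x‖ ^ 2 = Real.exp (lv x) - 1 := by rw [exp_lv]; ring
  simp only [smul_apply, innerSL_apply_apply, real_inner_self_eq_norm_sq, this, smul_eq_mul]
  have : Real.exp (-lv x) * Real.exp (lv x) = 1 := by rw [← Real.exp_add]; simp
  linear_combination 2 * deriv H (lv x) * this

theorem contDiff_lrd {H : ℝ → ℝ} (hH : ContDiff ℝ ∞ H) : ContDiff ℝ ∞ (lrd H) := by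
  have h1 : ContDiff ℝ ∞ (deriv H) := (contDiff_infty_iff_deriv.1 hH).2
  have h2 : ContDiff ℝ ∞ (fun v : ℝ => 2 * (1 - Real.exp (-v))) := by fun_prop
  exact h2.mul h1

theorem isCc_comp_lv {H : ℝ → ℝ} (hH : ContDiff ℝ ∞ H) {T : ℝ} (h0 : ∀ v, T ≤ v → H v = 0) :
    IsCc (fun x => H (lv x)) := by
  refine ⟨hH.comp contDiff_lv, HasCompactSupport.intro
    (isCompact_closedBall (0 : Plane) (Real.exp T)) fun x hx => h0 _ ?_⟩
  have h1 : Real.exp T < ‖x‖ := by simpa using hx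
  have h2 := Real.exp_pos T
  rw [← Real.exp_le_exp, exp_lv]
  nlinarith [sq_nonneg (‖x‖ - 1)]

/-- The weight whose slope is given by the profile `G` in the logarithmic variable. -/
noncomputable def profileWeight (G : ℝ → ℝ) (T v : ℝ) : ℝ := ∫ s in T..v, Real.exp s * G s / 2

theorem hasDerivAt_profileWeight {G : ℝ → ℝ} (hG : Continuous G) (T v : ℝ) :
    HasDerivAt (profileWeight G T) (Real.exp v * G v / 2) v := by
  have hc : Continuous fun s => Real.exp s * G s / 2 := by fun_prop
  exact intervalIntegral.integral_hasDerivAt_right (hc.intervalIntegrable _ _)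
    hc.stronglyMeasurable.stronglyMeasurableAtFilter hc.continuousAt

theorem contDiff_profileWeight {G : ℝ → ℝ} (hG : ContDiff ℝ ∞ G) (T : ℝ) :
    ContDiff ℝ ∞ (profileWeight G T) := by
  rw [contDiff_infty_iff_deriv]
  refine ⟨fun v => (hasDerivAt_profileWeight hG.continuous T v).differentiableAt, ?_⟩
  have : deriv (profileWeight G T) = fun v => Real.exp v * G v / 2 :=
    funext fun v => (hasDerivAt_profileWeight hG.continuous T v).deriv
  rw [this]
  fun_prop

/-- The density e^s/2 in `profileWeight` cancels the factor 2e^{−v} of ∇v, leaving slope G. Starting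
the integral at T, beyond which G vanishes, gives the weight compact support. -/
theorem isWeight_profile {G : ℝ → ℝ} (hG : ContDiff ℝ ∞ G) {T : ℝ} (h0 : ∀ v, T ≤ v → G v = 0) :
    IsWeight (fun x => profileWeight G T (lv x)) (fun x => G (lv x)) where
  weight := by
    refine isCc_comp_lv (contDiff_profileWeight hG T) (T := T) fun v hv => ?_
    refine intervalIntegral.integral_zero_ae (Eventually.of_forall fun s hs => ?_)
    rw [Set.uIoc_of_le hv] at hs
    rw [h0 s hs.1.le]
    simp
  slope := isCc_comp_lv hG h0
  grad x v := by
    rw [(hasFDerivAt_comp_lv (hasDerivAt_profileWeight hG.continuous T (lv x))).fderiv]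
    have : Real.exp (-lv x) * Real.exp (lv x) = 1 := by rw [← Real.exp_add]; simp
    simp only [smul_apply, innerSL_apply_apply, smul_eq_mul]
    linear_combination G (lv x) * inner ℝ x v * this

theorem mul_sub_le_profileWeight {G : ℝ → ℝ} (hG : Continuous G) (T : ℝ) {a b c : ℝ} (hab : a ≤ b)
    (hc : ∀ s ∈ Set.Icc a b, c ≤ Real.exp s * G s / 2) :
    c * (b - a) ≤ profileWeight G T b - profileWeight G T a := by
  refine (convex_Icc a b).mul_sub_le_image_sub_of_le_deriv
    (fun v _ => (hasDerivAt_profileWeight hG T v).continuousAt.continuousWithinAt)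
    (fun v _ => (hasDerivAt_profileWeight hG T v).differentiableAt.differentiableWithinAt)
    (fun v hv => ?_) a (Set.left_mem_Icc.2 hab) b (Set.right_mem_Icc.2 hab) hab
  rw [(hasDerivAt_profileWeight hG T v).deriv]
  exact hc v (interior_subset hv)

theorem monotone_profileWeight {G : ℝ → ℝ} (hG : Continuous G) (h0 : ∀ v, 0 ≤ G v) (T : ℝ) :
    Monotone (profileWeight G T) := by
  intro a b hab
  have := mul_sub_le_profileWeight hG T (c := 0) hab fun s _ => by
    have := h0 s
    positivity
  linarith

theorem sq_norm_mul_comp_lv (G : ℝ → ℝ) (x : Plane) :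
    (‖x‖ * G (lv x)) ^ 2 = (Real.exp (lv x) - 1) * G (lv x) ^ 2 := by
  rw [exp_lv]; ring

/-! ### Mass estimates for weighted functions -/

theorem integrable_bdd_mul_sq {n : Plane → ℝ} (hn : AEStronglyMeasurable n volume) {C : ℝ}
    (hC : ∀ x, |n x| ≤ C) (φ : L2) : Integrable (fun x => n x * ‖φ x‖ ^ 2) :=
  (Lp.memLp φ).norm.integrable_sq.bdd_mul hn (Eventually.of_forall hC)

theorem potentialQuad_one (φ : L2) : potentialQuad (fun _ => 1) φ = ‖φ‖ ^ 2 := by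
  simp only [potentialQuad, one_mul, norm_sq_eq_integral]

theorem potentialQuad_mono {m n : Plane → ℝ} {φ : L2} (hm : Integrable (fun x => m x * ‖φ x‖ ^ 2))
    (hn : Integrable (fun x => n x * ‖φ x‖ ^ 2)) (h : ∀ᵐ x : Plane, φ x ≠ 0 → m x ≤ n x) :
    potentialQuad m φ ≤ potentialQuad n φ := by
  refine integral_mono_ae hm hn ?_
  filter_upwards [h] with x hx
  by_cases h0 : φ x = 0
  · simp [h0]
  · exact mul_le_mul_of_nonneg_right (hx h0) (sq_nonneg _)

theorem measurable_lv : Measurable lv := contDiff_lv.continuous.measurable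

theorem exp_mul_setIntegral_le {F : ℝ → ℝ} (hF : Monotone F) {φ ψ : L2}
    (h : φ =ᵐ[volume] fun x => (Real.exp (F (lv x)) : ℂ) * ψ x) (b : ℝ) :
    Real.exp (2 * F b) * ∫ x in {x | b ≤ lv x}, ‖ψ x‖ ^ 2 ≤ ‖φ‖ ^ 2 := by
  have hS : MeasurableSet {x : Plane | b ≤ lv x} := measurableSet_le measurable_const measurable_lv
  have i1 : Integrable (fun x => ‖φ x‖ ^ 2) := (Lp.memLp φ).norm.integrable_sq
  have i2 : Integrable (fun x => ‖ψ x‖ ^ 2) := (Lp.memLp ψ).norm.integrable_sq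
  rw [norm_sq_eq_integral, ← integral_const_mul]
  refine (setIntegral_mono_on_ae (i2.const_mul _).integrableOn i1.integrableOn hS ?_).trans
    (setIntegral_le_integral i1 (Eventually.of_forall fun x => sq_nonneg _))
  filter_upwards [h] with x hx hb
  rw [hx, norm_mul, Complex.norm_real, Real.norm_of_nonneg (Real.exp_pos _).le, mul_pow,
    ← Real.exp_nat_mul]
  refine mul_le_mul_of_nonneg_right (Real.exp_le_exp.2 ?_) (sq_nonneg _)
  have : F b ≤ F (lv x) := hF hb
  push_cast
  linarith

theorem potentialQuad_indicator_le {F : ℝ → ℝ} (hF : Monotone F) {φ ψ : L2}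
    (h : φ =ᵐ[volume] fun x => (Real.exp (F (lv x)) : ℂ) * ψ x) (a : ℝ) :
    potentialQuad ({x | lv x < a}.indicator fun _ => 1) φ ≤ Real.exp (2 * F a) * ‖ψ‖ ^ 2 := by
  have hS : MeasurableSet {x : Plane | lv x < a} := measurableSet_lt measurable_lv measurable_const
  have i2 : Integrable (fun x => ‖ψ x‖ ^ 2) := (Lp.memLp ψ).norm.integrable_sq
  rw [norm_sq_eq_integral, ← integral_const_mul]
  refine integral_mono_ae (integrable_bdd_mul_sq (C := 1)
    (measurable_const.indicator hS).aestronglyMeasurable (fun x => ?_) φ) (i2.const_mul _) ?_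
  · by_cases hx : lv x < a <;> simp [Set.indicator, hx]
  · filter_upwards [h] with x hx
    by_cases hb : lv x < a
    · rw [Set.indicator_of_mem (by exact hb), one_mul, hx, norm_mul, Complex.norm_real,
        Real.norm_of_nonneg (Real.exp_pos _).le, mul_pow, ← Real.exp_nat_mul]
      refine mul_le_mul_of_nonneg_right (Real.exp_le_exp.2 ?_) (sq_nonneg _)
      have : F (lv x) ≤ F a := hF hb.le
      push_cast
      linarith
    · rw [Set.indicator_of_notMem (by exact hb), zero_mul]
      positivity

theorem setIntegral_sq_pos_or {ψ : L2} (b : ℝ) :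
    0 < ∫ x in {x | b ≤ lv x}, ‖ψ x‖ ^ 2 ∨ ∀ᵐ x : Plane, b ≤ lv x → ψ x = 0 := by
  have hS : MeasurableSet {x : Plane | b ≤ lv x} := measurableSet_le measurable_const measurable_lv
  have i2 : Integrable (fun x => ‖ψ x‖ ^ 2) := (Lp.memLp ψ).norm.integrable_sq
  rcases (integral_nonneg (μ := volume.restrict {x : Plane | b ≤ lv x})
    (f := fun x => ‖ψ x‖ ^ 2) fun x => sq_nonneg _).lt_or_eq with h | h
  · exact Or.inl h
  · right
    have h1 := (setIntegral_eq_zero_iff_of_nonneg_ae (Eventually.of_forall fun x => sq_nonneg _)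
      i2.integrableOn).1 h.symm
    rw [EventuallyEq, ae_restrict_iff' hS] at h1
    filter_upwards [h1] with x hx hb
    simpa using hx hb

theorem exists_setIntegral_sq_pos {ψ : L2} (h : ψ ≠ 0) :
    ∃ b : ℝ, 0 < b ∧ 0 < ∫ x in {x | b ≤ lv x}, ‖ψ x‖ ^ 2 := by
  by_contra! hc
  refine h (Lp.eq_zero_iff_ae_eq_zero.2 ?_)
  have h1 : ∀ n : ℕ, ∀ᵐ x : Plane, 1 / ((n : ℝ) + 1) ≤ lv x → ψ x = 0 := fun n =>
    (setIntegral_sq_pos_or _).resolve_left (not_lt.2 (hc _ (by positivity)))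
  filter_upwards [ae_all_iff.2 h1, Measure.ae_ne volume (0 : Plane)] with x hx h0
  have hl : 0 < lv x := Real.log_pos (by
    have := norm_pos_iff.2 h0
    nlinarith)
  obtain ⟨n, hn⟩ := exists_nat_one_div_lt hl
  exact hx n hn.le

/-! ### Weight profiles -/

/-- A smooth cutoff on the real line. -/
noncomputable def cutoff : ContDiffBump (0 : ℝ) := ⟨1, 2, one_pos, one_lt_two⟩

theorem cutoff_eq_one {L v : ℝ} (hL : 0 < L) (h0 : 0 ≤ v) (h : v ≤ L) : cutoff (v / L) = 1 := by
  refine cutoff.one_of_mem_closedBall ?_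
  rw [mem_closedBall_zero_iff, Real.norm_of_nonneg (by positivity)]
  exact (div_le_one hL).2 h

theorem cutoff_eq_zero {L v : ℝ} (hL : 0 < L) (h : 2 * L ≤ v) : cutoff (v / L) = 0 := by
  refine cutoff.zero_of_le_dist ?_
  rw [Real.dist_eq, sub_zero]
  refine le_trans ?_ (le_abs_self _)
  exact (le_div_iff₀ hL).2 h

/-- The profile of the weight in the logarithmic variable. -/
noncomputable def profile (κ L M v : ℝ) : ℝ := M * (cutoff (v / L) * Real.exp ((κ - 1) * v))

theorem contDiff_profile (κ L M : ℝ) : ContDiff ℝ ∞ (profile κ L M) := by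
  have h1 : ContDiff ℝ ∞ (fun v : ℝ => cutoff (v / L)) :=
    cutoff.contDiff.comp (contDiff_id.div_const L)
  unfold profile
  fun_prop

theorem profile_nonneg {κ L M : ℝ} (hM : 0 ≤ M) (v : ℝ) : 0 ≤ profile κ L M v :=
  mul_nonneg hM (mul_nonneg cutoff.nonneg (Real.exp_pos _).le)

theorem profile_eq_zero {κ L M v : ℝ} (hL : 0 < L) (h : 2 * L ≤ v) : profile κ L M v = 0 := by
  rw [profile, cutoff_eq_zero hL h]; simp

theorem profile_eq {κ L M v : ℝ} (hL : 0 < L) (h0 : 0 ≤ v) (h : v ≤ L) :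
    profile κ L M v = M * Real.exp ((κ - 1) * v) := by
  rw [profile, cutoff_eq_one hL h0 h, one_mul]

/-- On [0, L] the weight has v-derivative M e^{κv}/2, at least M/2. -/
theorem le_profileWeight_sub {κ L M a b : ℝ} (hκ : 0 ≤ κ) (hL : 0 < L) (hM : 0 ≤ M) (ha : 0 ≤ a)
    (hab : a ≤ b) (hb : b ≤ L) (T : ℝ) :
    M / 2 * (b - a) ≤ profileWeight (profile κ L M) T b - profileWeight (profile κ L M) T a := by
  refine mul_sub_le_profileWeight (contDiff_profile κ L M).continuous T hab fun s hs => ?_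
  have hs0 : 0 ≤ s := ha.trans hs.1
  rw [profile_eq hL hs0 (hs.2.trans hb)]
  have h1 : 1 ≤ Real.exp s * Real.exp ((κ - 1) * s) := by
    rw [← Real.exp_add]
    exact Real.one_le_exp (by nlinarith)
  nlinarith

/-- The squared gradient of the weight in the logarithmic variable. -/
noncomputable def profileSq (G : ℝ → ℝ) (v : ℝ) : ℝ := (Real.exp v - 1) * G v ^ 2

theorem contDiff_profileSq {G : ℝ → ℝ} (hG : ContDiff ℝ ∞ G) : ContDiff ℝ ∞ (profileSq G) := by
  unfold profileSq
  fun_prop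

theorem lrd_const_mul {H : ℝ → ℝ} (c v : ℝ) :
    lrd (fun v => c * H v) v = c * lrd H v := by
  rw [lrd, lrd, deriv_const_mul_field]
  ring

/-- Where the cutoff is one, differentiating e^v − 1 gives a nonnegative term, which is dropped;
differentiating the square of the exponential gives the bound. -/
theorem lrd_profileSq_ge {κ L v : ℝ} (hL : 0 < L) (h0 : 0 < v) (h : v < L) :
    4 * (κ - 1) * (1 - Real.exp (-v)) * profileSq (profile κ L 1) v ≤
      lrd (profileSq (profile κ L 1)) v := by
  have hev : profileSq (profile κ L 1) =ᶠ[𝓝 v] fun v =>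
      (Real.exp v - 1) * Real.exp ((κ - 1) * v) ^ 2 := by
    filter_upwards [Ioo_mem_nhds h0 h] with u hu
    rw [profileSq, profile_eq hL hu.1.le hu.2.le, one_mul]
  have hd : HasDerivAt (fun v => (Real.exp v - 1) * Real.exp ((κ - 1) * v) ^ 2)
      (Real.exp v * Real.exp ((κ - 1) * v) ^ 2 + (Real.exp v - 1) *
        (2 * Real.exp ((κ - 1) * v) * (Real.exp ((κ - 1) * v) * (κ - 1)))) v := by
    have h1 := ((hasDerivAt_id v).const_mul (κ - 1)).exp.pow 2
    have h2 := ((Real.hasDerivAt_exp v).sub_const 1).mul h1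
    refine h2.congr_deriv ?_
    simp
  rw [lrd, hev.deriv_eq, hd.deriv, hev.self_of_nhds]
  have h1 : Real.exp (-v) ≤ 1 := Real.exp_le_one_iff.2 (by linarith)
  have h2 : 0 ≤ 2 * (1 - Real.exp (-v)) := by linarith
  have h3 : 0 ≤ Real.exp v * Real.exp ((κ - 1) * v) ^ 2 := by positivity
  nlinarith [mul_nonneg h2 h3]

/-- With exponent 1/2 one has |x|²g² = M²(1−e^{−v})c², where c is the cutoff. This increases in v
except where the cutoff decreases, and there its slope is O(M²/L) because the cutoff varies on the
scale L in v. The slope g itself decays like e^{−v/2}, together with its logarithmic derivatives. -/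
theorem exists_profile_bounds : ∃ C : ℝ, 0 < C ∧ ∀ L M : ℝ, 1 ≤ L → 0 ≤ M → ∀ v, 0 ≤ v →
    lrd (lrd (profile (1 / 2) L M)) v ≤ C * M * Real.exp (-v / 2) ∧
    -(C * M ^ 2 / L) ≤ lrd (profileSq (profile (1 / 2) L M)) v := by
  have hs1 : ContDiff ℝ ∞ (deriv cutoff) := (contDiff_infty_iff_deriv.1 cutoff.contDiff).2
  have hs2 : ContDiff ℝ ∞ (deriv (deriv cutoff)) := (contDiff_infty_iff_deriv.1 hs1).2
  obtain ⟨K₁, hK₁⟩ := cutoff.hasCompactSupport.deriv.exists_bound_of_continuous hs1.continuous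
  obtain ⟨K₂, hK₂⟩ := cutoff.hasCompactSupport.deriv.deriv.exists_bound_of_continuous hs2.continuous
  set K := max K₁ K₂ with hK
  have hK0 : 0 ≤ K := (norm_nonneg _).trans ((hK₁ 0).trans (le_max_left _ _))
  -- K bounds the first two derivatives of the unscaled cutoff. The bracket in the first estimate is
  -- at most 3K + 1, with prefactor at most 4Me^{−v/2}.
  refine ⟨4 * (3 * K + 1), by positivity, fun L M hL hM v hv => ?_⟩
  have hL0 : 0 < L := by linarith
  have hdh : ∀ v, HasDerivAt (fun v => cutoff (v / L)) (deriv cutoff (v / L) / L) v := fun v => by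
    have h1 := ((show ContDiff ℝ ∞ cutoff from cutoff.contDiff).differentiable (by simp) (v / L)).hasDerivAt
    have h2 := h1.comp v ((hasDerivAt_id v).div_const L)
    simpa [Function.comp_def, div_eq_mul_inv] using h2
  have hdh' : ∀ v, HasDerivAt (fun v => deriv cutoff (v / L) / L)
      (deriv (deriv cutoff) (v / L) / L / L) v := fun v => by
    have h1 := (hs1.differentiable (by simp) (v / L)).hasDerivAt
    have h2 := (h1.comp v ((hasDerivAt_id v).div_const L)).div_const L
    simpa [Function.comp_def, div_eq_mul_inv] using h2
  have hexp : ∀ v, HasDerivAt (fun v => Real.exp ((1 / 2 - 1) * v))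
      (Real.exp ((1 / 2 - 1) * v) * (1 / 2 - 1)) v := fun v => by
    simpa using ((hasDerivAt_id v).const_mul (1 / 2 - 1 : ℝ)).exp
  have hexn : ∀ v : ℝ, HasDerivAt (fun v : ℝ => 2 * (1 - Real.exp (-v)))
      (2 * Real.exp (-v)) v := fun v => by
    simpa using (((hasDerivAt_id v).neg.exp).const_sub 1).const_mul 2
  have hdG : ∀ v, HasDerivAt (profile (1 / 2) L M)
      (M * ((deriv cutoff (v / L) / L - cutoff (v / L) / 2) * Real.exp ((1 / 2 - 1) * v))) v := by
    intro v
    refine (((hdh v).mul (hexp v)).const_mul M).congr_deriv ?_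
    ring
  have hlrd : lrd (profile (1 / 2) L M) = fun v => 2 * (1 - Real.exp (-v)) *
      (M * ((deriv cutoff (v / L) / L - cutoff (v / L) / 2) * Real.exp ((1 / 2 - 1) * v))) := by
    funext v
    rw [lrd, (hdG v).deriv]
  set c := cutoff (v / L) with hc
  set c₁ := deriv cutoff (v / L) / L with hc₁
  set c₂ := deriv (deriv cutoff) (v / L) / L / L with hc₂
  set y := Real.exp (-v) with hy
  set e := Real.exp ((1 / 2 - 1) * v) with he
  have hc0 : 0 ≤ c := cutoff.nonneg
  have hc1 : c ≤ 1 := cutoff.le_one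
  have hc₁L : |c₁| ≤ K / L := by
    rw [hc₁, abs_div, abs_of_pos hL0]
    exact div_le_div_of_nonneg_right ((hK₁ _).trans (le_max_left _ _)) hL0.le
  have hKL : K / L ≤ K := div_le_self hK0 hL
  have hc₁K : |c₁| ≤ K := hc₁L.trans hKL
  have hc₂K : |c₂| ≤ K := by
    rw [hc₂, abs_div, abs_div, abs_of_pos hL0]
    refine (div_le_self (by positivity) hL).trans ((div_le_self (by positivity) hL).trans ?_)
    exact (hK₂ _).trans (le_max_right _ _)
  have hy0 : 0 < y := Real.exp_pos _
  have hy1 : y ≤ 1 := Real.exp_le_one_iff.2 (by linarith)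
  have he0 : 0 < e := Real.exp_pos _
  constructor
  · have hd : HasDerivAt (lrd (profile (1 / 2) L M)) (2 * y * (M * ((c₁ - c / 2) * e)) +
        2 * (1 - y) * (M * ((c₂ - c₁ / 2) * e + (c₁ - c / 2) * (e * (1 / 2 - 1))))) v := by
      rw [hlrd]
      exact (hexn v).mul ((((hdh' v).sub ((hdh v).div_const 2)).mul (hexp v)).const_mul M)
    have hev : Real.exp (-v / 2) = e := by rw [he]; congr 1; ring
    rw [lrd, hd.deriv, hev]
    have hb : y * (c₁ - c / 2) + (1 - y) * (c₂ - c₁ / 2 - (c₁ - c / 2) / 2) ≤ 3 * K + 1 := by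
      have b1 := abs_le.1 hc₁K
      have b2 := abs_le.1 hc₂K
      have t1 : c₁ - c / 2 ≤ 3 * K + 1 := by linarith
      have t2 : c₂ - c₁ / 2 - (c₁ - c / 2) / 2 ≤ 3 * K + 1 := by linarith
      have := mul_le_mul_of_nonneg_left t1 hy0.le
      have := mul_le_mul_of_nonneg_left t2 (by linarith : 0 ≤ 1 - y)
      linarith
    have hMe : 0 ≤ M * e := by positivity
    have h1 : 2 * (1 - y) * (2 * y * (M * ((c₁ - c / 2) * e)) +
        2 * (1 - y) * (M * ((c₂ - c₁ / 2) * e + (c₁ - c / 2) * (e * (1 / 2 - 1))))) =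
        4 * (1 - y) * (M * e) *
          (y * (c₁ - c / 2) + (1 - y) * (c₂ - c₁ / 2 - (c₁ - c / 2) / 2)) := by ring
    rw [← hy, h1]
    have h2 := mul_le_mul_of_nonneg_left hb
      (mul_nonneg (mul_nonneg (by norm_num : (0 : ℝ) ≤ 4) (by linarith : 0 ≤ 1 - y)) hMe)
    have h3 : (1 - y) * (M * e) ≤ M * e := by nlinarith
    have h4 := mul_le_mul_of_nonneg_left h3 (by positivity : 0 ≤ 4 * (3 * K + 1))
    linarith
  · have hd : HasDerivAt (profileSq (profile (1 / 2) L M))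
        (Real.exp v * (M * (c * e)) ^ 2 + (Real.exp v - 1) *
          (2 * (M * (c * e)) * (M * ((c₁ - c / 2) * e)))) v := by
      have := ((Real.hasDerivAt_exp v).sub_const 1).mul ((hdG v).pow 2)
      refine this.congr_deriv ?_
      simp only [profile, ← hc, ← hc₁, ← he, Pi.pow_apply]
      push_cast
      ring
    have hve : Real.exp v * e ^ 2 = 1 := by
      rw [he, ← Real.exp_nat_mul, ← Real.exp_add]
      convert Real.exp_zero using 2
      push_cast
      ring
    have hye : e ^ 2 = y := by
      rw [he, hy, ← Real.exp_nat_mul]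
      congr 1
      push_cast
      ring
    rw [lrd, hd.deriv]
    -- This is the derivative of M²(1−e^{−v})c². Its first term is nonnegative; only the term with
    -- c₁, of size at most K/L, can be negative.
    have h1 : Real.exp v * (M * (c * e)) ^ 2 + (Real.exp v - 1) *
          (2 * (M * (c * e)) * (M * ((c₁ - c / 2) * e))) =
        M ^ 2 * (y * c ^ 2 + 2 * (1 - y) * (c * c₁)) := by
      linear_combination (M ^ 2 * c ^ 2 + 2 * M ^ 2 * c * (c₁ - c / 2)) * hve +
        (-2 * M ^ 2 * c * (c₁ - c / 2)) * hye
    rw [← hy, h1]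
    have h2 : -(K / L) ≤ c * c₁ := by
      have := (abs_le.1 (show |c * c₁| ≤ K / L by
        rw [abs_mul, abs_of_nonneg hc0]
        nlinarith [abs_nonneg c₁])).1
      exact this
    have hKL0 : 0 ≤ K / L := by positivity
    have h3 : -(2 * (K / L)) ≤ y * c ^ 2 + 2 * (1 - y) * (c * c₁) := by
      have a1 : 0 ≤ y * c ^ 2 := by positivity
      have a2 := mul_le_mul_of_nonneg_left h2 (by linarith : 0 ≤ 2 * (1 - y))
      nlinarith
    have h4 := mul_le_mul_of_nonneg_left h3 (by nlinarith [sq_nonneg M] : 0 ≤ 2 * (1 - y) * M ^ 2)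
    have h5 : 2 * (1 - y) * M ^ 2 * (2 * (K / L)) ≤ 4 * (3 * K + 1) * M ^ 2 / L := by
      have a1 : (1 - y) * (M ^ 2 * (K / L)) ≤ M ^ 2 * (K / L) := by
        have : 0 ≤ M ^ 2 * (K / L) := by positivity
        nlinarith
      have a2 : 4 * (3 * K + 1) * M ^ 2 / L - 4 * (M ^ 2 * (K / L)) =
        4 * (2 * K + 1) * M ^ 2 / L := by ring
      have a3 : 0 ≤ 4 * (2 * K + 1) * M ^ 2 / L := by positivity
      linarith
    linarith

/-! ### Estimates for weighted eigenfunctions -/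

theorem rd_rd_comp_lv {G : ℝ → ℝ} (hG : ContDiff ℝ ∞ G) (x : Plane) :
    rd (rd fun x => G (lv x)) x = lrd (lrd G) (lv x) := by
  have h : (rd fun x => G (lv x)) = fun x => lrd G (lv x) := funext (rd_comp_lv hG)
  rw [h, rd_comp_lv (contDiff_lrd hG)]

theorem sq_norm_mul_eq_profileSq (G : ℝ → ℝ) (x : Plane) :
    (‖x‖ * G (lv x)) ^ 2 = profileSq G (lv x) := sq_norm_mul_comp_lv G x

theorem rd_sq_norm_mul {G : ℝ → ℝ} (hG : ContDiff ℝ ∞ G) (x : Plane) :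
    rd (fun x => (‖x‖ * G (lv x)) ^ 2) x = lrd (profileSq G) (lv x) := by
  have h : (fun x : Plane => (‖x‖ * G (lv x)) ^ 2) = fun x => profileSq G (lv x) :=
    funext (sq_norm_mul_eq_profileSq G)
  rw [h, rd_comp_lv (contDiff_profileSq hG)]

theorem lv_pos {x : Plane} (hx : x ≠ 0) : 0 < lv x := Real.log_pos (by
  have := norm_pos_iff.2 hx
  nlinarith)

theorem potentialQuad_sq_nonneg (g : Plane → ℝ) (φ : L2) :
    0 ≤ potentialQuad (fun x => (‖x‖ * g x) ^ 2) φ :=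
  integral_nonneg fun x => by positivity

/-- Form smallness absorbs ⟨V⟩ in the energy identity. What matters is that the constant does not
depend on the weight. -/
theorem IsFormSmall.exists_momentum_le {V : Plane → ℝ} (hm : AEMeasurable V volume)
    (h : IsFormSmall B₀ V) (E : ℝ) : ∃ C : ℝ, 0 ≤ C ∧ ∀ {g : Plane → ℝ} {hg : IsCc g} {φ : Dom B₀},
      IsWeighted V E hg φ → ‖momentum B₀ φ‖ ^ 2 ≤
        C * (‖(φ : L2)‖ ^ 2 + potentialQuad (fun x => (‖x‖ * g x) ^ 2) φ) := by
  have hd : FormDomainContains B₀ V := h.1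
  obtain ⟨a, b, ha, hab⟩ := h.2
  have ha' : 0 < 1 - a := by linarith
  refine ⟨(|E| + |b| + 1) / (1 - a), by positivity, fun {g hg φ} hφ => ?_⟩
  have h1 := hφ.energy hm hd
  have h2 := (abs_le.1 (hab φ)).1
  have h3 := potentialQuad_sq_nonneg g φ
  rw [div_mul_eq_mul_div, le_div_iff₀ ha']
  have h4 := mul_le_mul_of_nonneg_right (le_abs_self E) (sq_nonneg ‖(φ : L2)‖)
  have h5 := mul_le_mul_of_nonneg_right (le_abs_self b) (sq_nonneg ‖(φ : L2)‖)
  have h6 : 0 ≤ (|E| + |b|) * potentialQuad (fun x => (‖x‖ * g x) ^ 2) φ := by positivity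
  nlinarith [sq_nonneg ‖(φ : L2)‖]

/-- Mass m of ψ beyond b forces ‖φ‖² ≥ e^{2F(b)}m, so whatever is weighted by at most e^{F(a)} is
smaller by an exponential in M(b−a). -/
theorem exp_weight_le {F : ℝ → ℝ} {M a b m : ℝ} {φ ψ : L2} (hm : 0 < m)
    (hF : M / 2 * (b - a) ≤ F b - F a) (h : Real.exp (2 * F b) * m ≤ ‖φ‖ ^ 2) :
    Real.exp (2 * F a) * ‖ψ‖ ^ 2 ≤ Real.exp (-(M * (b - a))) * (‖ψ‖ ^ 2 / m) * ‖φ‖ ^ 2 := by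
  have h1 : Real.exp (2 * F a) ≤ Real.exp (-(M * (b - a))) * Real.exp (2 * F b) := by
    rw [← Real.exp_add]
    exact Real.exp_le_exp.2 (by linarith)
  have h2 : Real.exp (2 * F b) ≤ ‖φ‖ ^ 2 / m := (le_div_iff₀ hm).2 h
  calc Real.exp (2 * F a) * ‖ψ‖ ^ 2
      ≤ Real.exp (-(M * (b - a))) * Real.exp (2 * F b) * ‖ψ‖ ^ 2 := by gcongr
    _ ≤ Real.exp (-(M * (b - a))) * (‖φ‖ ^ 2 / m) * ‖ψ‖ ^ 2 := by gcongr
    _ = _ := by ring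

theorem abs_le_sq_norm_of_gnorm {w : Dom B₀ → ℝ} {C : ℝ} (hC : 0 ≤ C)
    (h : ∀ φ, |w φ| ≤ C * gnorm B₀ φ ^ 2) (φ : Dom B₀) :
    w φ ≤ 2 * C * (‖(φ : L2)‖ ^ 2 + ‖momentum B₀ φ‖ ^ 2) := by
  refine (le_abs_self _).trans ((h φ).trans ?_)
  rw [gnorm_apply]
  nlinarith [mul_nonneg hC (sq_nonneg (‖(φ : L2)‖ - ‖momentum B₀ φ‖))]

theorem virial_apply_zero {V : Plane → ℝ} {w : Dom B₀ → ℝ}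
    (hw : ∀ φ η, Represents φ η → w φ = virialTest V η) : w 0 = 0 := by
  rw [hw 0 (fun _ => 0) ⟨IsTest.zero, Lp.coeFn_zero _ _ _⟩]
  simp [virialTest]

theorem profile_eq_mul (κ L M : ℝ) : profile κ L M = fun v => M * profile κ L 1 v := by
  funext v
  simp [profile]

theorem integrable_indicator_mul_sq (a : ℝ) (φ : L2) :
    Integrable (fun x => ({x : Plane | lv x < a}.indicator (fun _ => (1 : ℝ)) x) * ‖φ x‖ ^ 2) := by
  refine integrable_bdd_mul_sq (C := 1) (measurable_const.indicator
    (measurableSet_lt measurable_lv measurable_const)).aestronglyMeasurable (fun x => ?_) φ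
  by_cases hx : lv x < a <;> simp [Set.indicator, hx]

theorem integrable_norm_sq_one (φ : L2) : Integrable (fun x => (1 : ℝ) * ‖φ x‖ ^ 2) := by
  simpa using (Lp.memLp φ).norm.integrable_sq

theorem potentialQuad_combination {P : Plane → ℝ} {φ : L2}
    (hP : Integrable (fun x => P x * ‖φ x‖ ^ 2)) (α β γ a : ℝ) :
    Integrable (fun x => (α + β * P x + γ * {x : Plane | lv x < a}.indicator (fun _ => (1 : ℝ)) x) *
      ‖φ x‖ ^ 2) ∧
    potentialQuad (fun x => α + β * P x + γ * {x : Plane | lv x < a}.indicator (fun _ => (1 : ℝ)) x)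
      φ = α * ‖φ‖ ^ 2 + β * potentialQuad P φ +
        γ * potentialQuad ({x | lv x < a}.indicator fun _ => 1) φ := by
  have i1 := (integrable_norm_sq_one φ).const_mul α
  have i2 := hP.const_mul β
  have i3 := (integrable_indicator_mul_sq a φ).const_mul γ
  have e : (fun x => (α + β * P x + γ * {x : Plane | lv x < a}.indicator (fun _ => (1 : ℝ)) x) *
      ‖φ x‖ ^ 2) = fun x => α * (1 * ‖φ x‖ ^ 2) + β * (P x * ‖φ x‖ ^ 2) +
        γ * ({x : Plane | lv x < a}.indicator (fun _ => (1 : ℝ)) x * ‖φ x‖ ^ 2) := by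
    funext x
    ring
  have i12 : Integrable (fun x => α * (1 * ‖φ x‖ ^ 2) + β * (P x * ‖φ x‖ ^ 2)) := i1.add i2
  refine ⟨e ▸ i12.add i3, ?_⟩
  rw [potentialQuad, e, integral_add i12 i3, integral_add i1 i2, ← potentialQuad_one φ]
  simp only [integral_const_mul, potentialQuad]

/-! ### Eigenfunctions with compact support -/

/-- B and D come from compactness of [0, L], at strength M = 1. The indicator of v < a pays for the
region where 1 − e^{−v} and e^v − 1 degenerate. -/
theorem profileSq_estimates (κ : ℝ) (hκ : 1 ≤ κ) {a L : ℝ} (ha : 0 < a) (hL : a < L) :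
    ∃ B D : ℝ, 0 ≤ B ∧ 0 ≤ D ∧ ∀ v, 0 < v → v < L →
      lrd (lrd (profile κ L 1)) v ≤ D ∧
      4 * (κ - 1) * (1 - Real.exp (-a)) * profileSq (profile κ L 1) v -
        B * (Set.Iio a).indicator (fun _ => 1) v ≤ lrd (profileSq (profile κ L 1)) v ∧
      (Real.exp a - 1) - (Real.exp a - 1) * (Set.Iio a).indicator (fun _ => 1) v ≤
        profileSq (profile κ L 1) v := by
  have hG := contDiff_profile κ L 1
  obtain ⟨K, hK⟩ := (isCompact_Icc (a := 0) (b := L)).exists_bound_of_continuousOn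
    (contDiff_profileSq hG).continuous.continuousOn
  obtain ⟨D, hD⟩ := (isCompact_Icc (a := 0) (b := L)).exists_bound_of_continuousOn
    (contDiff_lrd (contDiff_lrd hG)).continuous.continuousOn
  have hL0 : 0 < L := ha.trans hL
  have h0 : (0 : ℝ) ∈ Set.Icc 0 L := ⟨le_rfl, hL0.le⟩
  have hK0 := (norm_nonneg _).trans (hK 0 h0)
  have hc : 0 ≤ 1 - Real.exp (-a) := by
    have : Real.exp (-a) ≤ 1 := Real.exp_le_one_iff.2 (by linarith)
    linarith
  have hκ' : 0 ≤ 4 * (κ - 1) := by linarith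
  refine ⟨4 * (κ - 1) * (1 - Real.exp (-a)) * K, D, by positivity,
    (norm_nonneg _).trans (hD 0 h0), fun v hv hvL => ⟨?_, ?_, ?_⟩⟩
  · exact (le_abs_self _).trans (hD v ⟨hv.le, hvL.le⟩)
  · have h1 := lrd_profileSq_ge (κ := κ) hL0 hv hvL
    have hP : 0 ≤ profileSq (profile κ L 1) v :=
      mul_nonneg (by linarith [Real.one_le_exp hv.le]) (sq_nonneg _)
    have hPK := (le_abs_self _).trans (hK v ⟨hv.le, hvL.le⟩)
    have hv1 : Real.exp (-v) ≤ 1 := Real.exp_le_one_iff.2 (by linarith)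
    by_cases hva : v < a
    · rw [Set.indicator_of_mem (by exact hva), mul_one]
      have h2 := mul_le_mul_of_nonneg_left hPK (mul_nonneg hκ' hc)
      have h3 : 0 ≤ 4 * (κ - 1) * (1 - Real.exp (-v)) * profileSq (profile κ L 1) v :=
        mul_nonneg (mul_nonneg hκ' (by linarith)) hP
      linarith
    · rw [Set.indicator_of_notMem (by exact hva), mul_zero, sub_zero]
      refine le_trans ?_ h1
      have h2 : Real.exp (-v) ≤ Real.exp (-a) := Real.exp_le_exp.2 (by linarith)
      gcongr
  · by_cases hva : v < a
    · rw [Set.indicator_of_mem (by exact hva), mul_one, sub_self]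
      exact mul_nonneg (by linarith [Real.one_le_exp hv.le]) (sq_nonneg _)
    · rw [Set.indicator_of_notMem (by exact hva), mul_zero, sub_zero, profileSq,
        profile_eq hL0 hv.le hvL.le, one_mul]
      have h2 : Real.exp a ≤ Real.exp v := Real.exp_le_exp.2 (by linarith)
      have h3 : 1 ≤ Real.exp ((κ - 1) * v) := Real.one_le_exp (by nlinarith)
      have h4 : 1 ≤ Real.exp ((κ - 1) * v) ^ 2 := one_le_pow₀ h3
      have h5 := Real.one_le_exp ha.le
      nlinarith

/-- A Carleman type argument. If ψ has mass beyond b > 0, then φ concentrates in v ≥ a as M grows.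
There ⟨|x|²g²⟩ is of order M²‖φ‖², while the terms it has to be balanced against are O(M)‖φ‖² or
carry an exponentially small factor. -/
theorem eq_zero_of_ae_eq_zero_outside {V : Plane → ℝ} (hm : AEMeasurable V volume)
    (h : IsFormSmall B₀ V) {w : Dom B₀ → ℝ} (hwl : IsQuadLip w)
    (hw : ∀ φ η, Represents φ η → w φ = virialTest V η) {E : ℝ} {ψ : Dom B₀}
    (heig : ∀ χ : Dom B₀, form B₀ V χ ψ = inner ℂ (χ : L2) ((E : ℂ) • (ψ : L2)))
    {T : ℝ} (hT : ∀ᵐ x : Plane, T ≤ lv x → (ψ : L2) x = 0) : (ψ : L2) = 0 := by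
  by_contra hψ
  obtain ⟨b, hb, hmb⟩ := exists_setIntegral_sq_pos hψ
  set m := ∫ x in {x | b ≤ lv x}, ‖(ψ : L2) x‖ ^ 2 with hmdef
  obtain ⟨C₁, hC₁, hp⟩ := h.exists_momentum_le hm E
  obtain ⟨C, hC, hCw⟩ := hwl.exists_abs_le (virial_apply_zero hw)
  set a := b / 2 with ha
  have ha0 : 0 < a := by positivity
  set c := 1 - Real.exp (-a) with hc
  have hc0 : 0 < c := by
    have : Real.exp (-a) < 1 := Real.exp_lt_one_iff.2 (by linarith)
    linarith
  -- κ is chosen so that x·∇(|x|²g²) yields 1 + 2CC₁ copies of |x|²g². Since w(φ) is at most 2C(‖φ‖²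
  -- + ‖(P−A)φ‖²) and C₁ controls the kinetic term, 2CC₁ copies absorb w and one is left.
  set κ := 1 + (1 + 2 * C * C₁) / (4 * c) with hκ
  have hκ1 : 1 ≤ κ := by
    have : 0 ≤ (1 + 2 * C * C₁) / (4 * c) := by positivity
    linarith
  have hκc : 4 * (κ - 1) * c = 1 + 2 * C * C₁ := by
    rw [hκ]
    field_simp
    ring
  -- The cutoff is one on the support of ψ, so its transition region never contributes.
  set L := max T b + 1 with hL
  have hbL : b < L := by linarith [le_max_right T b]
  have hTL : T < L := by linarith [le_max_left T b]
  have hL0 : 0 < L := hb.trans hbL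
  obtain ⟨B, D, hB, hD, hest⟩ := profileSq_estimates κ hκ1 ha0 (show a < L by linarith)
  rw [← hc, hκc] at hest
  set pa := Real.exp a - 1 with hpa
  have hpa0 : 0 < pa := by
    have := Real.add_one_lt_exp ha0.ne'
    linarith
  set δ : ℝ → ℝ := fun M => Real.exp (-(M * (b - a))) * (‖(ψ : L2)‖ ^ 2 / m) with hδ
  set K := 2 * C + 2 * C * C₁ with hK
  have key : ∀ M : ℝ, 0 < M → pa - pa * δ M ≤ K * M⁻¹ ^ 2 + D * M⁻¹ + B * δ M := by
    intro M hM
    set G := profile κ L M with hG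
    have hGs : ContDiff ℝ ∞ G := contDiff_profile κ L M
    have hG1 : G = fun v => M * profile κ L 1 v := profile_eq_mul κ L M
    have hWt := isWeight_profile hGs (T := 2 * L) fun v hv => profile_eq_zero hL0 hv
    set F := profileWeight G (2 * L) with hF
    have hFm : Monotone F := monotone_profileWeight hGs.continuous (fun v => profile_nonneg hM.le v) _
    obtain ⟨φ, hφ, hφw⟩ := exists_weighted heig hWt
    change IsWeighted V E hWt.slope φ at hφw
    have hF' : M / 2 * (b - a) ≤ F b - F a :=
      le_profileWeight_sub (by linarith) hL0 hM.le ha0.le (by linarith) hbL.le _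
    have hN := exp_mul_setIntegral_le hFm hφ b
    have hI := (potentialQuad_indicator_le hFm hφ a).trans (exp_weight_le hmb hF' hN)
    have hN0 : 0 < ‖(φ : L2)‖ ^ 2 := lt_of_lt_of_le (by positivity) hN
    have hpφ := hp hφw
    have hvir := hφw.virial_le hm h.isFormBounded hwl hw (fun x => profile_nonneg hM.le _)
    have hwφ := abs_le_sq_norm_of_gnorm hC hCw φ
    set N := ‖(φ : L2)‖ ^ 2 with hNdef
    set I := potentialQuad ({x | lv x < a}.indicator fun _ => 1) φ with hIdef
    set Q := potentialQuad (fun x => (‖x‖ * G (lv x)) ^ 2) φ with hQ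
    have hsup : ∀ᵐ x : Plane, (φ : L2) x ≠ 0 → 0 < lv x ∧ lv x < L := by
      filter_upwards [hφ, hT, Measure.ae_ne volume (0 : Plane)] with x h1 h2 h3 h4
      refine ⟨lv_pos h3, ?_⟩
      by_contra! hcon
      exact h4 (by rw [h1, h2 (hTL.le.trans hcon), mul_zero])
    have iQ := integrable_potentialQuad_of_isCc hWt.slope.sq_norm (φ : L2)
    have iR := integrable_potentialQuad_of_isCc hWt.slope.sq_norm.rd (φ : L2)
    have iS := integrable_potentialQuad_of_isCc hWt.slope.rd.rd (φ : L2)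
    have hsq : profileSq G = fun v => M ^ 2 * profileSq (profile κ L 1) v := by
      funext v
      rw [hG1, profileSq, profileSq]
      ring
    have hll : lrd (lrd G) = fun v => M * lrd (lrd (profile κ L 1)) v := by
      have : lrd G = fun v => M * lrd (profile κ L 1) v := by
        funext v
        rw [hG1, lrd_const_mul]
      funext v
      rw [this, lrd_const_mul]
    have q1 := potentialQuad_mono iS (potentialQuad_combination iQ (M * D) 0 0 a).1 (by
      filter_upwards [hsup] with x hx h0
      obtain ⟨h1, h2⟩ := hx h0
      rw [rd_rd_comp_lv hGs, hll, zero_mul, zero_mul, add_zero, add_zero]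
      exact mul_le_mul_of_nonneg_left (hest _ h1 h2).1 hM.le)
    have q2 := potentialQuad_mono (potentialQuad_combination iQ 0 (1 + 2 * C * C₁)
      (-(M ^ 2 * B)) a).1 iR (by
      filter_upwards [hsup] with x hx h0
      obtain ⟨h1, h2⟩ := hx h0
      have h3 := mul_le_mul_of_nonneg_left (hest _ h1 h2).2.1 (sq_nonneg M)
      rw [rd_sq_norm_mul hGs, sq_norm_mul_eq_profileSq, hsq, lrd_const_mul]
      refine le_trans (le_of_eq ?_) h3
      change _ = M ^ 2 * (_ - B * {x : Plane | lv x < a}.indicator (fun _ => (1 : ℝ)) x)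
      ring)
    have q3 := potentialQuad_mono (potentialQuad_combination iQ (M ^ 2 * pa) 0
      (-(M ^ 2 * pa)) a).1 iQ (by
      filter_upwards [hsup] with x hx h0
      obtain ⟨h1, h2⟩ := hx h0
      have h3 := mul_le_mul_of_nonneg_left (hest _ h1 h2).2.2 (sq_nonneg M)
      rw [sq_norm_mul_eq_profileSq, hsq]
      refine le_trans (le_of_eq ?_) h3
      change _ = M ^ 2 * (_ - pa * {x : Plane | lv x < a}.indicator (fun _ => (1 : ℝ)) x)
      ring)
    rw [(potentialQuad_combination iQ _ _ _ _).2] at q1 q2 q3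
    change I ≤ δ M * N at hI
    have hfin : M ^ 2 * (pa - pa * δ M) * N ≤ (K + D * M + M ^ 2 * B * δ M) * N := by
      have f1 := mul_le_mul_of_nonneg_left hpφ (mul_nonneg zero_le_two hC)
      have f2 := mul_le_mul_of_nonneg_left hI (mul_nonneg (sq_nonneg M) hB)
      have f3 := mul_le_mul_of_nonneg_left hI (mul_nonneg (sq_nonneg M) hpa0.le)
      have f4 := sq_nonneg ‖momentum B₀ φ‖
      have f5 : Q ≤ (K + D * M) * N + M ^ 2 * B * I := by linarith
      linarith
    have hfin := le_of_mul_le_mul_right hfin hN0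
    have hM2 : 0 < M ^ 2 := by positivity
    refine le_of_mul_le_mul_left (hfin.trans (le_of_eq ?_)) hM2
    field_simp
  have hlim : Tendsto δ atTop (𝓝 0) := by
    have h1 : Tendsto (fun M : ℝ => -(M * (b - a))) atTop atBot :=
      tendsto_neg_atTop_atBot.comp (tendsto_id.atTop_mul_const (by linarith))
    simpa using (Real.tendsto_exp_atBot.comp h1).mul_const (‖(ψ : L2)‖ ^ 2 / m)
  have hinv : Tendsto (fun M : ℝ => M⁻¹) atTop (𝓝 0) := tendsto_inv_atTop_zero
  have hle := le_of_tendsto_of_tendsto ((hlim.const_mul pa).const_sub pa)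
    ((((hinv.pow 2).const_mul K).add (hinv.const_mul D)).add (hlim.const_mul B))
    ((eventually_gt_atTop 0).mono key)
  simp at hle
  linarith

/-! ### Eigenfunctions vanish outside a ball -/

theorem exists_sq_mul_exp_neg_le {d ε : ℝ} (hd : 0 < d) (hε : 0 < ε) :
    ∃ M : ℝ, 1 ≤ M ∧ (1 + M) ^ 2 * Real.exp (-(M * d)) ≤ ε := by
  have h1 : Tendsto (fun M : ℝ => 4 / d ^ 2 * ((M * d) ^ 2 * Real.exp (-(M * d)))) atTop (𝓝 0) := by
    have h2 := (Real.tendsto_pow_mul_exp_neg_atTop_nhds_zero 2).comp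
      (tendsto_id.atTop_mul_const hd)
    simpa using h2.const_mul (4 / d ^ 2)
  obtain ⟨M, hM, hM1⟩ := ((h1.eventually (gt_mem_nhds hε)).and (eventually_ge_atTop 1)).exists
  refine ⟨M, hM1, le_trans ?_ hM.le⟩
  have : 4 / d ^ 2 * ((M * d) ^ 2 * Real.exp (-(M * d))) = 4 * M ^ 2 * Real.exp (-(M * d)) := by
    field_simp
  rw [this]
  refine mul_le_mul_of_nonneg_right ?_ (Real.exp_pos _).le
  nlinarith

/-- The weight with slope `g` applied to a function supported in a ball. -/
theorem gnorm_weighted_le {F g : Plane → ℝ} (hF : IsWeight F g) {M c : ℝ} (hM : 0 ≤ M) (hc : 0 ≤ c)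
    (hg : ∀ x, |g x| * ‖x‖ ≤ M) {ψ A : Dom B₀}
    (hA : (A : L2) =ᵐ[volume] fun x => (Real.exp (F x) : ℂ) * (ψ : L2) x)
    (hA' : momentum B₀ A =ᵐ[volume] fun x => (Real.exp (F x) : ℂ) • momentum B₀ ψ x +
      (ψ : L2) x • (-Complex.I • gradC (fun x => Real.exp (F x)) x))
    (hs : ∀ᵐ x : Plane, c < Real.exp (F x) → (ψ : L2) x = 0 ∧ momentum B₀ ψ x = 0) :
    gnorm B₀ A ≤ 3 * c * (1 + M) * gnorm B₀ ψ := by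
  have h1 : ‖(A : L2)‖ ≤ c * ‖(ψ : L2)‖ := by
    refine Lp.norm_le_mul_norm_of_ae_le_mul ?_
    filter_upwards [hA, hs] with x h1 h2
    rw [h1, norm_mul, Complex.norm_real, Real.norm_of_nonneg (Real.exp_pos _).le]
    by_cases hx : c < Real.exp (F x)
    · simp [(h2 hx).1]
    · exact mul_le_mul_of_nonneg_right (not_lt.1 hx) (norm_nonneg _)
  have h2 : ‖momentum B₀ A‖ ^ 2 ≤ 2 * c ^ 2 * ‖momentum B₀ ψ‖ ^ 2 +
      2 * c ^ 2 * M ^ 2 * ‖(ψ : L2)‖ ^ 2 := by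
    have i1 := ((Lp.memLp (momentum B₀ ψ)).norm.integrable_sq).const_mul (2 * c ^ 2)
    have i2 := ((Lp.memLp (ψ : L2)).norm.integrable_sq).const_mul (2 * c ^ 2 * M ^ 2)
    rw [norm_sq_eq_integral, norm_sq_eq_integral, norm_sq_eq_integral, ← integral_const_mul,
      ← integral_const_mul, ← integral_add i1 i2]
    refine integral_mono_ae (Lp.memLp _).norm.integrable_sq (i1.add i2) ?_
    filter_upwards [hA', hs] with x h1 h2
    have h3 : ‖momentum B₀ A x‖ ≤ c * (‖momentum B₀ ψ x‖ + M * ‖(ψ : L2) x‖) := by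
      rw [h1, hF.gradC_exp]
      refine (norm_add_le _ _).trans ?_
      rw [norm_smul, norm_smul, norm_smul, norm_smul, norm_posC, norm_neg, Complex.norm_I,
        Complex.norm_real, Complex.norm_real, Real.norm_of_nonneg (Real.exp_pos _).le, norm_mul,
        Real.norm_of_nonneg (Real.exp_pos _).le, Real.norm_eq_abs]
      by_cases hx : c < Real.exp (F x)
      · simp [h2 hx]
      · have hx := not_lt.1 hx
        have a1 := mul_le_mul_of_nonneg_right hx (norm_nonneg (momentum B₀ ψ x))
        have a2 := mul_le_mul hx (hg x) (by positivity) hc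
        have a3 := mul_le_mul_of_nonneg_right a2 (norm_nonneg ((ψ : L2) x))
        linarith
    have h4 := pow_le_pow_left₀ (norm_nonneg _) h3 2
    refine h4.trans ?_
    nlinarith [mul_nonneg (sq_nonneg c) (sq_nonneg (‖momentum B₀ ψ x‖ - M * ‖(ψ : L2) x‖))]
  have h3 : ‖momentum B₀ A‖ ≤ 2 * c * (1 + M) * gnorm B₀ ψ := by
    refine abs_le_of_sq_le_sq' (h2.trans ?_) (by positivity) |>.2
    have a1 := pow_le_pow_left₀ (norm_nonneg _) (norm_momentum_le_gnorm ψ) 2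
    have a2 := pow_le_pow_left₀ (norm_nonneg _) (norm_le_gnorm ψ) 2
    have a3 := mul_le_mul_of_nonneg_left a1 (by positivity : 0 ≤ 2 * c ^ 2)
    have a4 := mul_le_mul_of_nonneg_left a2 (by positivity : 0 ≤ 2 * c ^ 2 * M ^ 2)
    have a5 : 0 ≤ c ^ 2 * gnorm B₀ ψ ^ 2 * (2 + 8 * M + 2 * M ^ 2) := by positivity
    nlinarith
  have h4 : c * ‖(ψ : L2)‖ ≤ c * (1 + M) * gnorm B₀ ψ := by
    have := norm_le_gnorm ψ
    have a1 := mul_le_mul_of_nonneg_left this hc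
    have a2 : 0 ≤ c * M * gnorm B₀ ψ := mul_nonneg (mul_nonneg hc hM) (apply_nonneg _ _)
    linarith
  rw [gnorm_apply]
  linarith

theorem exists_ball_cutoff {R : ℝ} (hR : 0 < R) : ∃ χ : Plane → ℝ, IsCc χ ∧ (∀ x, 0 ≤ χ x) ∧
    (∀ x, χ x ≤ 1) ∧ (∀ x, ‖x‖ < R → χ x = 1) ∧ ∀ x, R + 1 < ‖x‖ → χ x = 0 ∧ gradC χ x = 0 := by
  let χ : ContDiffBump (0 : Plane) := ⟨R, R + 1, hR, by linarith⟩
  refine ⟨χ, ⟨χ.contDiff, χ.hasCompactSupport⟩, fun x => χ.nonneg, fun x => χ.le_one,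
    fun x hx => χ.one_of_mem_closedBall (by simpa using hx.le), fun x hx => ?_⟩
  have h1 : x ∉ tsupport χ := by
    rw [χ.tsupport_eq, mem_closedBall_zero_iff]
    exact not_le.2 hx
  refine ⟨image_eq_zero_of_notMem_tsupport h1, ?_⟩
  have h2 : fderiv ℝ χ x = 0 := by
    by_contra hcon
    exact h1 (support_fderiv_subset ℝ (Function.mem_support.2 hcon))
  ext j
  simp [gradC, h2]

theorem le_momentum_of_sq_le {p C M N : ℝ} (hC : 0 ≤ C) (hM : 0 ≤ M) (hN : 0 ≤ N)
    (h : p ^ 2 ≤ C * (N ^ 2 + M ^ 2 * N ^ 2)) : p ≤ (1 + C) * (1 + M) * N := by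
  refine abs_le_of_sq_le_sq' (h.trans ?_) (by positivity) |>.2
  have h1 : C ≤ (1 + C) ^ 2 := by nlinarith
  have h2 : 1 + M ^ 2 ≤ (1 + M) ^ 2 := by nlinarith
  have h3 := mul_le_mul h1 h2 (by positivity) (by positivity)
  have h4 := mul_le_mul_of_nonneg_right h3 (sq_nonneg N)
  nlinarith

/-- |x|e^{−v/2} = |x|/√(1+|x|²) is at most one, so M bounds the gradient of the weight. -/
theorem norm_mul_profile_le {L M : ℝ} (hM : 0 ≤ M) (x : Plane) :
    |profile (1 / 2) L M (lv x)| * ‖x‖ ≤ M := by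
  rw [abs_of_nonneg (profile_nonneg hM _), profile]
  have h1 : Real.exp ((1 / 2 - 1) * lv x) * ‖x‖ ≤ 1 := by
    refine abs_le_of_sq_le_sq' (?_ : _ ≤ (1 : ℝ) ^ 2) zero_le_one |>.2
    rw [mul_pow, ← Real.exp_nat_mul]
    have : ((2 : ℕ) : ℝ) * ((1 / 2 - 1) * lv x) = -lv x := by push_cast; ring
    rw [this, Real.exp_neg, exp_lv, inv_mul_le_iff₀ (by positivity)]
    linarith
  have h2 : cutoff (lv x / L) ≤ 1 := cutoff.le_one
  have h3 : 0 ≤ cutoff (lv x / L) := cutoff.nonneg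
  have h4 : cutoff (lv x / L) * (Real.exp ((1 / 2 - 1) * lv x) * ‖x‖) ≤ 1 :=
    mul_le_one₀ h2 (by positivity) h1
  nlinarith [mul_le_mul_of_nonneg_left h4 hM]

/-- The bounds on the profile with exponent `1 / 2` that hold with the constant `C`. -/
def IsProfileBound (C : ℝ) : Prop := ∀ L M : ℝ, 1 ≤ L → 0 ≤ M → ∀ v, 0 ≤ v →
  lrd (lrd (profile (1 / 2) L M)) v ≤ C * M * Real.exp (-v / 2) ∧
  -(C * M ^ 2 / L) ≤ lrd (profileSq (profile (1 / 2) L M)) v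

/-- Three zones. For v < a the indicator pays. For v > L the length L makes the exponential small.
In between, e^{−v/2} ≤ 1/R bounds the left side by sM, and sM ≤ s + sM²/2 while |x|²g² ≥ M²/2 there.
-/
theorem IsProfileBound.lrd_lrd_le {C : ℝ} (h : IsProfileBound C) (hC : 0 < C) {s R L M a v : ℝ}
    (hs : 0 < s) (hR : 1 ≤ R) (hCR : C ≤ s * R) (hL : 1 ≤ L) (hM : 0 ≤ M)
    (hML : C * M * Real.exp (-L / 2) ≤ s) (ha : 1 + R ^ 2 ≤ Real.exp a) (hv : 0 ≤ v) :
    lrd (lrd (profile (1 / 2) L M)) v ≤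
      s + s * profileSq (profile (1 / 2) L M) v + C * M * (Set.Iio a).indicator (fun _ => 1) v := by
  have h1 := (h L M hL hM v hv).1
  have hP : 0 ≤ profileSq (profile (1 / 2) L M) v :=
    mul_nonneg (by linarith [Real.one_le_exp hv]) (sq_nonneg _)
  have hsP := mul_nonneg hs.le hP
  have hCM : 0 ≤ C * M := by positivity
  refine h1.trans ?_
  by_cases hva : v < a
  · rw [Set.indicator_of_mem (by exact hva), mul_one]
    have : Real.exp (-v / 2) ≤ 1 := Real.exp_le_one_iff.2 (by linarith)
    have := mul_le_mul_of_nonneg_left this hCM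
    linarith
  · rw [Set.indicator_of_notMem (by exact hva), mul_zero, add_zero]
    by_cases hvL : v ≤ L
    · have he : 1 + R ^ 2 ≤ Real.exp v := ha.trans (Real.exp_le_exp.2 (not_lt.1 hva))
      have hee : Real.exp (-v) * Real.exp v = 1 := by rw [← Real.exp_add]; simp
      have hsq : Real.exp (-v / 2) ^ 2 = Real.exp (-v) := by
        rw [← Real.exp_nat_mul]
        congr 1
        push_cast
        ring
      have h2 : R * Real.exp (-v / 2) ≤ 1 := by
        refine abs_le_of_sq_le_sq' (?_ : _ ≤ (1 : ℝ) ^ 2) zero_le_one |>.2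
        rw [mul_pow, hsq]
        nlinarith [Real.exp_pos (-v)]
      have h3 : C * M * Real.exp (-v / 2) ≤ s * M := by
        have a1 := mul_le_mul_of_nonneg_right hCR
          (mul_nonneg hM (Real.exp_pos (-v / 2)).le)
        have a2 := mul_le_mul_of_nonneg_left h2 (mul_nonneg hs.le hM)
        linarith
      have h4 : M ^ 2 / 2 ≤ profileSq (profile (1 / 2) L M) v := by
        have hexp : Real.exp ((1 / 2 - 1) * v) ^ 2 = Real.exp (-v) := by
          rw [← hsq]
          congr 2
          ring
        rw [profileSq, profile_eq (by linarith) hv hvL, mul_pow, hexp]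
        have h5 : Real.exp (-v) ≤ 1 / 2 := by
          nlinarith [Real.exp_pos (-v)]
        nlinarith [sq_nonneg M]
      have h6 := mul_le_mul_of_nonneg_left h4 hs.le
      nlinarith [mul_nonneg hs.le (sq_nonneg (M - 1))]
    · have : Real.exp (-v / 2) ≤ Real.exp (-L / 2) := Real.exp_le_exp.2 (by linarith)
      have := mul_le_mul_of_nonneg_left this hCM
      linarith

theorem abs_sq_norm_momentum_sub_le (φ ψ : Dom B₀) :
    |‖momentum B₀ φ‖ ^ 2 - ‖momentum B₀ ψ‖ ^ 2| ≤
      gnorm B₀ (φ - ψ) * (gnorm B₀ φ + gnorm B₀ ψ) := by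
  have h1 := abs_norm_sub_norm_le (momentum B₀ φ) (momentum B₀ ψ)
  rw [← momentum_sub] at h1
  have h2 : ‖momentum B₀ φ‖ ^ 2 - ‖momentum B₀ ψ‖ ^ 2 =
      (‖momentum B₀ φ‖ - ‖momentum B₀ ψ‖) * (‖momentum B₀ φ‖ + ‖momentum B₀ ψ‖) := by ring
  rw [h2, abs_mul, abs_of_nonneg (by positivity : 0 ≤ ‖momentum B₀ φ‖ + ‖momentum B₀ ψ‖)]
  exact mul_le_mul (h1.trans (norm_momentum_le_gnorm _))
    (add_le_add (norm_momentum_le_gnorm _) (norm_momentum_le_gnorm _)) (by positivity)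
    (apply_nonneg _ _)

/-- Splitting off the part of a weighted function near the origin. -/
theorem exists_outer_part {R : ℝ} (hR : 0 < R) (ψ : Dom B₀) : ∃ K : ℝ, 0 ≤ K ∧
    ∀ {F g : Plane → ℝ}, IsWeight F g → ∀ {M c : ℝ}, 0 ≤ M → 0 ≤ c → (∀ x, |g x| * ‖x‖ ≤ M) →
      (∀ x, c < Real.exp (F x) → R + 1 < ‖x‖) →
      ∀ φ : Dom B₀, ((φ : L2) =ᵐ[volume] fun x => (Real.exp (F x) : ℂ) * (ψ : L2) x) →
        ∃ φ' : Dom B₀, SupportedOutside R φ' ∧ ‖(φ' : L2)‖ ≤ ‖(φ : L2)‖ ∧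
          gnorm B₀ (φ - φ') ≤ K * (c * (1 + M)) := by
  obtain ⟨χ, hχ, h0, h1, hin, hout⟩ := exists_ball_cutoff hR
  obtain ⟨ψ', hψ, hψ'⟩ := hχ.isMult.exists_mul ψ
  refine ⟨3 * gnorm B₀ ψ', mul_nonneg (by norm_num) (apply_nonneg _ _),
    fun {F g} hF {M c} hM hc hg hFc φ hφ => ?_⟩
  -- A = e^F χψ is the inner part. Since e^F ≤ c wherever χψ or its momentum is nonzero, its graph
  -- norm is at most a multiple of c(1+M), with a factor depending only on the fixed function χψ.
  obtain ⟨A, hA, hA'⟩ := hF.weight.exp.exists_mul ψ'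
  have hsub : ∀ᵐ x : Plane, ((φ - A : Dom B₀) : L2) x = ((1 - χ x : ℝ) : ℂ) * (φ : L2) x := by
    filter_upwards [Lp.coeFn_sub (φ : L2) A, hA, hψ, hφ] with x a1 a2 a3 a4
    rw [Submodule.coe_sub, a1, Pi.sub_apply, a2, a3, a4]
    push_cast
    ring
  refine ⟨φ - A, ?_, ?_, ?_⟩
  · filter_upwards [hsub] with x hx hxR
    rw [hx, hin x hxR]
    simp
  · have := Lp.norm_le_mul_norm_of_ae_le_mul (c := 1) (f := ((φ - A : Dom B₀) : L2))
      (g := (φ : L2)) ?_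
    · simpa using this
    filter_upwards [hsub] with x hx
    rw [hx, norm_mul, Complex.norm_real, Real.norm_of_nonneg (by linarith [h1 x])]
    exact mul_le_mul_of_nonneg_right (by linarith [h0 x]) (norm_nonneg _)
  · rw [sub_sub_cancel]
    refine (gnorm_weighted_le hF hM hc hg hA hA' ?_).trans (le_of_eq (by ring))
    filter_upwards [hψ, hψ'] with x a1 a2 hx
    obtain ⟨b1, b2⟩ := hout x (hFc x hx)
    rw [a1, a2, b1, b2]
    simp

/-! ### Choice of parameters and the numerical contradiction -/

theorem exists_profile_length {C M s : ℝ} (hC : 0 < C) (hM : 0 ≤ M) (hs : 0 < s) (b : ℝ) :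
    ∃ L : ℝ, 1 ≤ L ∧ b ≤ L ∧ C * M ^ 2 / L ≤ s ∧ C * M * Real.exp (-L / 2) ≤ s := by
  have h1 : 0 ≤ C * M ^ 2 / s := by positivity
  have h2 : 0 ≤ 2 * (C * M / s) := by positivity
  have h3 := abs_nonneg b
  set L := |b| + 1 + C * M ^ 2 / s + 2 * (C * M / s) with hL
  have hL1 : 1 ≤ L := by linarith
  refine ⟨L, hL1, by linarith [le_abs_self b], ?_, ?_⟩
  · rw [div_le_iff₀ (by linarith), ← div_le_iff₀' hs]
    linarith
  · have h4 : C * M / s ≤ Real.exp (L / 2) := by linarith [Real.add_one_le_exp (L / 2)]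
    rw [div_le_iff₀' hs] at h4
    have h5 : Real.exp (L / 2) * Real.exp (-L / 2) = 1 := by
      rw [← Real.exp_add, ← Real.exp_zero]
      congr 1
      ring
    have h6 := mul_le_mul_of_nonneg_right h4 (Real.exp_pos (-L / 2)).le
    rw [mul_assoc s, h5, mul_one] at h6
    exact h6

/-- Replacing φ by its outer part costs one factor e from the difference and at most two powers of 1
+ M from the graph norms. In the application e is exponentially small in M. -/
theorem abs_sub_le_of_gnorm_le {w : Dom B₀ → ℝ} {C k H f M e N : ℝ} (hC : 0 ≤ C)
    {φ φ' : Dom B₀} (hk : 0 ≤ k) (he0 : 0 ≤ e) (he : e ≤ 1) (hM : 0 ≤ M)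
    (hN : 0 ≤ N) (hf : f = (1 + M) ^ 2 * e)
    (hw : |w φ - w φ'| ≤ C * gnorm B₀ (φ - φ') * (gnorm B₀ φ + gnorm B₀ φ'))
    (h₁ : gnorm B₀ (φ - φ') ≤ k * (1 + M) * e * N) (h₂ : gnorm B₀ φ ≤ H * (1 + M) * N) :
    |w φ - w φ'| ≤ C * (2 * H * k + k ^ 2) * f * N ^ 2 := by
  have h3 : gnorm B₀ φ' ≤ gnorm B₀ φ + gnorm B₀ (φ - φ') := by
    have := map_sub_le_add (gnorm B₀) φ (φ - φ')
    rwa [sub_sub_cancel] at this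
  have h4 : gnorm B₀ φ + gnorm B₀ φ' ≤ 2 * (H * (1 + M) * N) + k * (1 + M) * e * N := by linarith
  have h5 := mul_le_mul h₁ h4 (add_nonneg (apply_nonneg _ _) (apply_nonneg _ _)) (by positivity)
  have h6 := mul_le_mul_of_nonneg_left h5 hC
  have h7 : 0 ≤ C * k ^ 2 * (1 + M) ^ 2 * N ^ 2 * (e * (1 - e)) :=
    mul_nonneg (by positivity) (mul_nonneg he0 (by linarith))
  rw [hf]
  linarith

/-- The number t₀ = (β₁ + √(β₁²+2β₂))/2 is the largest root of 2t² = β₂ + 2β₁t, and the hypothesis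
says t₀² < E. Without errors the first inequality forces t > t₀ and the second t ≤ t₀; strictness
leaves room for s. -/
theorem exists_margin {E β₁ β₂ : ℝ} (hβ₁ : 0 ≤ β₁) (hβ₂ : 0 ≤ β₂)
    (hE : 1 / 4 * (β₁ + Real.sqrt (β₁ ^ 2 + 2 * β₂)) ^ 2 < E) :
    ∃ s : ℝ, 0 < s ∧ s ≤ 1 ∧ ∀ t : ℝ, 0 ≤ t → E ≤ t ^ 2 + 20 * s * (1 + t ^ 2) →
      2 * t ^ 2 ≤ β₂ + 2 * β₁ * t + 20 * s * (1 + t ^ 2) → False := by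
  have hr := Real.sqrt_nonneg (β₁ ^ 2 + 2 * β₂)
  have hr2 := Real.sq_sqrt (by positivity : 0 ≤ β₁ ^ 2 + 2 * β₂)
  set r := Real.sqrt (β₁ ^ 2 + 2 * β₂) with hrdef
  have hrβ : β₁ ≤ r := Real.le_sqrt_of_sq_le (by linarith)
  set t₀ := (β₁ + r) / 2 with ht₀
  have ht₀0 : 0 ≤ t₀ := by positivity
  have hE0 : t₀ ^ 2 < E := by
    rw [ht₀]
    linarith
  -- t₁² lies midway between t₀² and E: half of the gap is spent on showing t ≥ t₁, and t₁ > t₀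
  -- makes t − t₀ at least ut.
  set t₁ := Real.sqrt ((t₀ ^ 2 + E) / 2) with ht₁
  have ht₁2 : t₁ ^ 2 = (t₀ ^ 2 + E) / 2 := Real.sq_sqrt (by nlinarith [sq_nonneg t₀])
  have ht₁0 : 0 < t₁ := Real.sqrt_pos.2 (by nlinarith [sq_nonneg t₀])
  have ht : t₀ < t₁ := Real.lt_sqrt_of_sq_lt (by linarith)
  set u := 1 - t₀ / t₁ with hu
  have hu0 : 0 < u := by
    rw [hu, sub_pos, div_lt_one ht₁0]
    exact ht
  set A := (E - t₀ ^ 2) / 2 with hA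
  have hA0 : 0 < A := by linarith
  -- The first quotient forces t ≥ t₁; the second makes the error at most ut² for such t, against a
  -- gap of 2ut².
  refine ⟨min 1 (min (A / (20 * (1 + t₁ ^ 2) + 1)) (u * t₁ ^ 2 / (20 * (1 + t₁ ^ 2)))),
    by positivity, min_le_left _ _, fun t ht0 h1 h2 => ?_⟩
  set s := min 1 (min (A / (20 * (1 + t₁ ^ 2) + 1)) (u * t₁ ^ 2 / (20 * (1 + t₁ ^ 2)))) with hs
  have hs0 : 0 < s := by positivity
  have hsA : s * (20 * (1 + t₁ ^ 2) + 1) ≤ A :=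
    (le_div_iff₀ (by positivity)).1 ((min_le_right _ _).trans (min_le_left _ _))
  have hsu : s * (20 * (1 + t₁ ^ 2)) ≤ u * t₁ ^ 2 :=
    (le_div_iff₀ (by positivity)).1 ((min_le_right _ _).trans (min_le_right _ _))
  have htt : t₁ ≤ t := by
    by_contra! hcon
    have : t ^ 2 ≤ t₁ ^ 2 := pow_le_pow_left₀ ht0 hcon.le 2
    have := mul_le_mul_of_nonneg_left this hs0.le
    nlinarith
  have htpos : 0 < t := ht₁0.trans_le htt
  have h3 : 20 * s * (1 + t ^ 2) ≤ u * t ^ 2 := by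
    have a1 : (1 + t ^ 2) * t₁ ^ 2 ≤ (1 + t₁ ^ 2) * t ^ 2 := by
      have := pow_le_pow_left₀ ht₁0.le htt 2
      linarith
    have a2 := mul_le_mul_of_nonneg_left a1 (by positivity : 0 ≤ 20 * s)
    have a3 := mul_le_mul_of_nonneg_right hsu (sq_nonneg t)
    have a4 : 0 < t₁ ^ 2 := by positivity
    refine le_of_mul_le_mul_right (a := t₁ ^ 2) ?_ a4
    linarith
  have h4 : 2 * t ^ 2 - 2 * β₁ * t - β₂ = 2 * (t - t₀) * (t + t₀ - β₁) := by
    rw [ht₀]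
    linarith
  have h5 : u * t ≤ t - t₀ := by
    have : t₀ ≤ t₀ / t₁ * t := by
      rw [div_mul_eq_mul_div, le_div_iff₀ ht₁0]
      exact mul_le_mul_of_nonneg_left htt ht₀0
    rw [hu]
    linarith
  have h6 : t ≤ t + t₀ - β₁ := by
    rw [ht₀]
    linarith
  have h7 := mul_le_mul h5 h6 ht0 (le_trans (by positivity) h5)
  have h8 : 0 < u * t ^ 2 := by positivity
  linarith

/-- Here q is the squared kinetic norm of φ, v and z its potential and virial forms, Q the value of
⟨|x|²g²⟩; p, n, v' and z' belong to the outer part. Q ≥ 0 only helps in the energy identity, which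
in turn bounds Q by 4(p² + N²), so that sQ is a small error in the virial inequality. Then t = p/N
contradicts `hnum`. -/
theorem false_of_virial_bounds {E s β₁ β₂ N n p q v v' z z' Q X : ℝ} (hE : 0 ≤ E) (hs : 0 < s)
    (hs1 : s ≤ 1) (hβ₁ : 0 ≤ β₁) (hβ₂ : 0 ≤ β₂) (hN : 0 < N) (hp : 0 ≤ p) (hn : 0 ≤ n)
    (hnN : n ≤ N) (hQ : 0 ≤ Q)
    (hnum : ∀ t : ℝ, 0 ≤ t → E ≤ t ^ 2 + 20 * s * (1 + t ^ 2) →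
      2 * t ^ 2 ≤ β₂ + 2 * β₁ * t + 20 * s * (1 + t ^ 2) → False)
    (hen : q + v = E * N ^ 2 + Q) (hvir : 2 * q - z ≤ 2 * s * N ^ 2 + s * Q + X) (hX : X ≤ s * N ^ 2) (hz : |z - z'| ≤ s * N ^ 2)
    (hv : |v - v'| ≤ s * N ^ 2) (hq : |q - p ^ 2| ≤ s * N ^ 2) (hv' : v' ≤ s * (p ^ 2 + n ^ 2))
    (hz' : z' ≤ β₂ * n ^ 2 + 2 * β₁ * n * p + 10 * s * (p ^ 2 + n ^ 2)) : False := by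
  have hnN2 : n ^ 2 ≤ N ^ 2 := pow_le_pow_left₀ hn hnN 2
  have d1 := (abs_le.1 hz).2
  have d2 := (abs_le.1 hv).2
  have d3 := abs_le.1 hq
  have v1 : v' ≤ s * (p ^ 2 + N ^ 2) := hv'.trans (mul_le_mul_of_nonneg_left (by linarith) hs.le)
  have v2 : z' ≤ β₂ * N ^ 2 + 2 * β₁ * N * p + 10 * s * (p ^ 2 + N ^ 2) := by
    refine hz'.trans ?_
    gcongr
  have hEN : 0 ≤ E * N ^ 2 := by positivity
  have hsp : 0 ≤ s * p ^ 2 := by positivity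
  have hsN : 0 ≤ s * N ^ 2 := by positivity
  have r0 : s * (p ^ 2 + N ^ 2) ≤ p ^ 2 + N ^ 2 := mul_le_of_le_one_left (by positivity) hs1
  have r5 : s * N ^ 2 ≤ N ^ 2 := mul_le_of_le_one_left (by positivity) hs1
  have r1 : Q ≤ 4 * (p ^ 2 + N ^ 2) := by linarith [sq_nonneg p, d3.2]
  have r2 := mul_le_mul_of_nonneg_left r1 hs.le
  have r3 : E * N ^ 2 ≤ p ^ 2 + 20 * s * (p ^ 2 + N ^ 2) := by linarith [d3.2]
  have r4 : 2 * p ^ 2 ≤ β₂ * N ^ 2 + 2 * β₁ * N * p + 20 * s * (p ^ 2 + N ^ 2) := by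
    linarith [d3.1]
  have hN2 : 0 < N ^ 2 := by positivity
  refine hnum (p / N) (by positivity) ?_ ?_
  · refine le_of_mul_le_mul_right (r3.trans (le_of_eq ?_)) hN2
    field_simp
    ring
  · refine le_of_mul_le_mul_right (le_trans (le_of_eq ?_) (r4.trans (le_of_eq ?_))) hN2
    · field_simp
    · field_simp
      ring

/-- All error terms carry (1+M)²e^{−Md}, so a single large M beats every constant at once. -/
theorem exists_strength {s Z Y Cw Cv d : ℝ} (hs : 0 < s) (hZ : 0 ≤ Z) (hY : 0 ≤ Y) (hCw : 0 ≤ Cw)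
    (hCv : 0 ≤ Cv) (hd : 0 < d) : ∃ M : ℝ, 0 ≤ M ∧ Real.exp (-(M * d)) ≤ 1 ∧
      M * Real.exp (-(M * d)) ^ 2 ≤ (1 + M) ^ 2 * Real.exp (-(M * d)) ∧
      1 * Z * ((1 + M) ^ 2 * Real.exp (-(M * d))) ≤ s ∧
      Cw * Z * ((1 + M) ^ 2 * Real.exp (-(M * d))) ≤ s ∧
      Cv * Z * ((1 + M) ^ 2 * Real.exp (-(M * d))) ≤ s ∧
      Y * ((1 + M) ^ 2 * Real.exp (-(M * d))) ≤ s := by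
  obtain ⟨M, hM1, hMf⟩ := exists_sq_mul_exp_neg_le (d := d) (ε := s / ((1 + Cw + Cv) * Z + Y + 1))
    hd (by positivity)
  have hM0 : 0 ≤ M := by linarith
  have he0 : 0 ≤ Real.exp (-(M * d)) := (Real.exp_pos _).le
  have he1 : Real.exp (-(M * d)) ≤ 1 := Real.exp_le_one_iff.2 (by
    have : 0 ≤ M * d := by positivity
    linarith)
  set e := Real.exp (-(M * d))
  rw [le_div_iff₀ (by positivity)] at hMf
  have hf0 : 0 ≤ (1 + M) ^ 2 * e := by positivity
  set f := (1 + M) ^ 2 * e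
  have a1 : 0 ≤ Z * f := by positivity
  have a2 : 0 ≤ Cw * (Z * f) := by positivity
  have a3 : 0 ≤ Cv * (Z * f) := by positivity
  have a4 : 0 ≤ Y * f := by positivity
  refine ⟨M, hM0, he1, ?_, by linarith, by linarith, by linarith, by linarith⟩
  have a5 : e ^ 2 ≤ e := by nlinarith
  exact mul_le_mul (by nlinarith) a5 (sq_nonneg e) (by positivity)

/-! ### Vanishing of eigenfunctions at infinity -/

theorem exists_weighted_profile {V : Plane → ℝ} (hm : AEMeasurable V volume)
    (h : IsFormSmall B₀ V) {w : Dom B₀ → ℝ} (hwl : IsQuadLip w)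
    (hw : ∀ φ η, Represents φ η → w φ = virialTest V η) {E : ℝ} {ψ : Dom B₀}
    (heig : ∀ χ : Dom B₀, form B₀ V χ ψ = inner ℂ (χ : L2) ((E : ℂ) • (ψ : L2)))
    {C₀ s R : ℝ} (hC₀ : 0 < C₀) (hprof : IsProfileBound C₀) (hs : 0 < s)
    (hR : 1 ≤ R) (hCR : C₀ ≤ s * R) {L M a : ℝ} (hM : 0 ≤ M) (hL : 1 ≤ L)
    (hL2 : C₀ * M ^ 2 / L ≤ s) (hL3 : C₀ * M * Real.exp (-L / 2) ≤ s)
    (ha : 1 + R ^ 2 ≤ Real.exp a) :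
    ∃ (φ : Dom B₀) (F : ℝ → ℝ), Monotone F ∧
      ((φ : L2) =ᵐ[volume] fun x => (Real.exp (F (lv x)) : ℂ) * (ψ : L2) x) ∧
      IsWeight (fun x => F (lv x)) (fun x => profile (1 / 2) L M (lv x)) ∧
      (∀ a b, 0 ≤ a → a ≤ b → b ≤ L → M / 2 * (b - a) ≤ F b - F a) ∧
      ∃ g : Plane → ℝ, ∃ hg : IsCc g, IsWeighted V E hg φ ∧
        potentialQuad (fun x => (‖x‖ * g x) ^ 2) φ ≤ M ^ 2 * ‖(φ : L2)‖ ^ 2 ∧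
        2 * ‖momentum B₀ φ‖ ^ 2 - w φ ≤ 2 * s * ‖(φ : L2)‖ ^ 2 +
          s * potentialQuad (fun x => (‖x‖ * g x) ^ 2) φ +
          C₀ * M * potentialQuad ({x | lv x < a}.indicator fun _ => 1) φ := by
  have hL0 : 0 < L := by linarith
  have hGs : ContDiff ℝ ∞ (profile (1 / 2) L M) := contDiff_profile _ L M
  have hWt := isWeight_profile hGs (T := 2 * L) fun v hv => profile_eq_zero hL0 hv
  obtain ⟨φ, hφ, hφw⟩ := exists_weighted heig hWt
  change IsWeighted V E hWt.slope φ at hφw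
  have hvir := hφw.virial_le hm h.isFormBounded hwl hw (fun x => profile_nonneg hM _)
  have iQ := integrable_potentialQuad_of_isCc hWt.slope.sq_norm (φ : L2)
  have iR := integrable_potentialQuad_of_isCc hWt.slope.sq_norm.rd (φ : L2)
  have iS := integrable_potentialQuad_of_isCc hWt.slope.rd.rd (φ : L2)
  have hQM := potentialQuad_mono iQ (potentialQuad_combination iQ (M ^ 2) 0 0 a).1
    (Eventually.of_forall fun x _ => by
      have h1 := norm_mul_profile_le (L := L) hM x
      rw [zero_mul, zero_mul, add_zero, add_zero, mul_pow,
        ← sq_abs (profile (1 / 2) L M (lv x)), ← mul_pow, mul_comm]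
      exact pow_le_pow_left₀ (by positivity) h1 2)
  have hq1 := potentialQuad_mono iS (potentialQuad_combination iQ s s (C₀ * M) a).1
    (Eventually.of_forall fun x _ => by
      rw [rd_rd_comp_lv hGs, sq_norm_mul_eq_profileSq]
      exact hprof.lrd_lrd_le hC₀ hs hR hCR hL hM hL3 ha (lv_nonneg x))
  have hq2 := potentialQuad_mono (potentialQuad_combination iQ (-s) 0 0 a).1 iR
    (Eventually.of_forall fun x _ => by
      rw [rd_sq_norm_mul hGs, zero_mul, zero_mul, add_zero, add_zero]
      refine le_trans ?_ (hprof L M hL hM _ (lv_nonneg x)).2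
      linarith)
  rw [(potentialQuad_combination iQ _ _ _ _).2] at hQM hq1 hq2
  refine ⟨φ, _, monotone_profileWeight hGs.continuous (fun v => profile_nonneg hM v) _, hφ, hWt,
    fun a b h0 hab hb => le_profileWeight_sub (by norm_num) hL0 hM h0 hab hb _,
    _, hWt.slope, hφw, by linarith, by linarith⟩

/-- If ψ had mass beyond radius R + 2, a weight of large fixed strength M would make φ negligible
inside radius R + 1, so the estimates available at infinity would apply to φ up to small errors. The
strength M is fixed before the length L, hence nothing is required of the decay of ψ. -/
theorem ae_eq_zero_outside {V : Plane → ℝ} (hm : AEMeasurable V volume)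
    (h : IsFormSmall B₀ V) {w : Dom B₀ → ℝ} (hwl : IsQuadLip w)
    (hw : ∀ φ η, Represents φ η → w φ = virialTest V η) {E : ℝ} {ψ : Dom B₀}
    (heig : ∀ χ : Dom B₀, form B₀ V χ ψ = inner ℂ (χ : L2) ((E : ℂ) • (ψ : L2)))
    {C₀ s R β₁ β₂ : ℝ} (hC₀ : 0 < C₀) (hprof : IsProfileBound C₀) (hE : 0 ≤ E) (hs : 0 < s)
    (hs1 : s ≤ 1) (hR : 1 ≤ R) (hCR : C₀ ≤ s * R) (hβ₁ : 0 ≤ β₁) (hβ₂ : 0 ≤ β₂)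
    (hVR : ∀ φ : Dom B₀, SupportedOutside R φ →
      potentialQuad V φ ≤ s * (‖momentum B₀ φ‖ ^ 2 + ‖(φ : L2)‖ ^ 2))
    (hwR : ∀ φ : Dom B₀, SupportedOutside R φ →
      w φ ≤ β₂ * ‖(φ : L2)‖ ^ 2 + 2 * β₁ * ‖(φ : L2)‖ * ‖momentum B₀ φ‖ +
        10 * s * (‖momentum B₀ φ‖ ^ 2 + ‖(φ : L2)‖ ^ 2))
    (hnum : ∀ t : ℝ, 0 ≤ t → E ≤ t ^ 2 + 20 * s * (1 + t ^ 2) →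
      2 * t ^ 2 ≤ β₂ + 2 * β₁ * t + 20 * s * (1 + t ^ 2) → False) :
    ∀ᵐ x : Plane, Real.log (1 + (R + 2) ^ 2) ≤ lv x → (ψ : L2) x = 0 := by
  -- a and b are the logarithmic variables of the radii R + 1, where the inner cutoff ends, and R +
  -- 2, beyond which ψ is supposed to have mass.
  set a := Real.log (1 + (R + 1) ^ 2) with ha
  set b := Real.log (1 + (R + 2) ^ 2) with hb
  have hea : Real.exp a = 1 + (R + 1) ^ 2 := Real.exp_log (by positivity)
  have ha0 : 0 ≤ a := Real.log_nonneg (by nlinarith)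
  have hab : a < b := Real.log_lt_log (by positivity) (by nlinarith)
  refine (setIntegral_sq_pos_or b).resolve_left fun hmb => ?_
  set m := ∫ x in {x | b ≤ lv x}, ‖(ψ : L2) x‖ ^ 2 with hmdef
  obtain ⟨C₁, hC₁, hp⟩ := h.exists_momentum_le hm E
  obtain ⟨K, hK, hcut⟩ := exists_outer_part (by linarith : 0 < R) ψ
  obtain ⟨Cw, hCw, hwq⟩ := hwl
  obtain ⟨Cv, hCv, hvq⟩ := h.isFormBounded.isQuadLip hm
  set k := K / Real.sqrt m with hk
  have hk0 : 0 ≤ k := by positivity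
  set H := 2 + C₁ with hH
  set Z := 2 * H * k + k ^ 2 with hZ
  have hZ0 : 0 ≤ Z := by positivity
  set Y := C₀ * (‖(ψ : L2)‖ ^ 2 / m) with hY
  have hY0 : 0 ≤ Y := by positivity
  -- Halved because e = e^{−Md} bounds the amplitude ratio e^{F(a)−F(b)}, whereas the mass inside a
  -- carries e².
  set d := (b - a) / 2 with hd
  obtain ⟨M, hM0, he1, hMe, hf1, hfw, hfv, hfY⟩ :=
    exists_strength hs hZ0 hY0 hCw hCv (by linarith : 0 < d)
  set e := Real.exp (-(M * d)) with he
  have he0 : 0 ≤ e := (Real.exp_pos _).le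
  obtain ⟨f, hf⟩ : ∃ f, f = (1 + M) ^ 2 * e := ⟨_, rfl⟩
  rw [← hf] at hMe hf1 hfw hfv hfY
  obtain ⟨L, hL1, hbL, hL2, hL3⟩ := exists_profile_length hC₀ hM0 hs b
  obtain ⟨φ, F, hFm, hφ, hWt, hFab, g, hg, hφw, hQM, hvir⟩ := exists_weighted_profile hm h
    ⟨Cw, hCw, hwq⟩ hw heig hC₀ hprof hs hR hCR hM0 hL1 hL2 hL3
    (show 1 + R ^ 2 ≤ Real.exp a by rw [hea]; linarith [add_sq R 1])
  have hF' := hFab a b ha0 hab.le hbL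
  have hN := exp_mul_setIntegral_le hFm hφ b
  rw [← hmdef] at hN
  have hI := (potentialQuad_indicator_le hFm hφ a).trans (exp_weight_le hmb hF' hN)
  have hpφ := hp hφw
  have hen := hφw.energy hm h.1
  have hN0 : 0 < ‖(φ : L2)‖ := by
    have : 0 < ‖(φ : L2)‖ ^ 2 := lt_of_lt_of_le (by positivity) hN
    exact (norm_nonneg _).lt_of_ne fun h0 => by simp [← h0] at this
  obtain ⟨φ', hφ'R, hφ'N, hφ'g⟩ := hcut hWt hM0 (Real.exp_pos (F a)).le (norm_mul_profile_le hM0)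
    (fun x hx => by
      have h1 : a < lv x := hFm.reflect_lt (Real.exp_lt_exp.1 hx)
      have h2 := Real.exp_lt_exp.2 h1
      rw [hea, exp_lv] at h2
      exact lt_of_pow_lt_pow_left₀ 2 (norm_nonneg _) (by linarith)) φ hφ
  set N := ‖(φ : L2)‖ with hNdef
  have hcN : Real.exp (F a) ≤ e * (N / Real.sqrt m) := by
    have h1 : Real.exp (F b) * Real.sqrt m ≤ N := by
      refine abs_le_of_sq_le_sq' ?_ hN0.le |>.2
      rw [mul_pow, Real.sq_sqrt hmb.le, ← Real.exp_nat_mul]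
      exact_mod_cast hN
    have h2 : Real.exp (F b) ≤ N / Real.sqrt m := (le_div_iff₀ (Real.sqrt_pos.2 hmb)).2 h1
    refine le_trans ?_ (mul_le_mul_of_nonneg_left h2 he0)
    rw [he, ← Real.exp_add]
    exact Real.exp_le_exp.2 (by rw [hd]; linarith)
  have hg1 : gnorm B₀ (φ - φ') ≤ k * (1 + M) * e * N := by
    refine hφ'g.trans ?_
    have h1 := mul_le_mul_of_nonneg_left hcN (mul_nonneg hK (by linarith : 0 ≤ 1 + M))
    refine le_trans (by linarith) (h1.trans (le_of_eq ?_))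
    rw [hk]
    ring
  have hQ0 := potentialQuad_sq_nonneg g (φ : L2)
  have hg2 : gnorm B₀ φ ≤ H * (1 + M) * N := by
    have h1 := le_momentum_of_sq_le (p := ‖momentum B₀ φ‖) hC₁ hM0 hN0.le
      (hpφ.trans (mul_le_mul_of_nonneg_left (by linarith) hC₁))
    rw [gnorm_apply, hH]
    linarith [mul_nonneg hM0 hN0.le]
  have d1 := abs_sub_le_of_gnorm_le hCw hk0 he0 he1 hM0 hN0.le hf (hwq φ φ') hg1 hg2
  have d2 := abs_sub_le_of_gnorm_le (w := fun φ => potentialQuad V φ) hCv hk0 he0 he1 hM0 hN0.le hf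
    (hvq φ φ') hg1 hg2
  have d3 := abs_sub_le_of_gnorm_le (w := fun φ => ‖momentum B₀ φ‖ ^ 2) zero_le_one hk0 he0 he1
    hM0 hN0.le hf (by rw [one_mul]; exact abs_sq_norm_momentum_sub_le φ φ') hg1 hg2
  have hN2 := sq_nonneg N
  have hCI : C₀ * M * potentialQuad ({x | lv x < a}.indicator fun _ => 1) φ ≤ s * N ^ 2 := by
    have h1 : Real.exp (-(M * (b - a))) = e ^ 2 := by
      rw [he, ← Real.exp_nat_mul]
      congr 1
      rw [hd]
      push_cast
      ring
    rw [h1] at hI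
    have h3 := mul_le_mul_of_nonneg_left hI (by positivity : 0 ≤ C₀ * M)
    have h4 := mul_le_mul_of_nonneg_left hMe hY0
    have h5 := mul_le_mul_of_nonneg_right (h4.trans hfY) hN2
    refine h3.trans (le_trans (le_of_eq ?_) h5)
    rw [hY]
    ring
  exact false_of_virial_bounds hE hs hs1 hβ₁ hβ₂ hN0 (norm_nonneg _) (norm_nonneg _) hφ'N hQ0 hnum
    hen hvir hCI (d1.trans (mul_le_mul_of_nonneg_right hfw hN2))
    (d2.trans (mul_le_mul_of_nonneg_right hfv hN2)) (d3.trans (mul_le_mul_of_nonneg_right hf1 hN2))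
    (hVR φ' hφ'R) (hwR φ' hφ'R)

/-! ### Absence of large eigenvalues -/

theorem LocInt.of_add {V V₁ V₂ : Plane → ℝ} (h : LocInt (fun x => (V x : ℂ)))
    (h₁ : LocInt (fun x => (V₁ x : ℂ))) (hV : ∀ x, V x = V₁ x + V₂ x) :
    LocInt (fun x => (V₂ x : ℂ)) := fun K hK h0 =>
  ((h K hK h0).sub (h₁ K hK h0)).congr (Eventually.of_forall fun x => by simp [hV x])

/-- The requirement ε ≤ s² makes √y ≤ sp + (β₁+s)n, so the cross term 2√y·p contributes 2β₁np plus
errors of order s. -/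
theorem virial_le_of_bounds {ε s z y a β₁ β₂ b₁ b₂ p n : ℝ} (hs : 0 < s) (hs1 : s ≤ 1)
    (hε : ε ≤ s ^ 2) (hb₁ : 0 ≤ b₁) (h₁ : b₁ ≤ β₁ + s) (h₂ : b₂ ≤ β₂ + s) (hp : 0 ≤ p) (hn : 0 ≤ n)
    (hz : z ≤ ε * p ^ 2 + b₂ * n ^ 2) (hy : y ≤ ε * p ^ 2 + b₁ ^ 2 * n ^ 2)
    (ha : a ≤ s * p ^ 2 + s * n ^ 2) :
    z + 2 * a + 2 * Real.sqrt y * p ≤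
      β₂ * n ^ 2 + 2 * β₁ * n * p + 10 * s * (p ^ 2 + n ^ 2) := by
  have h3 : Real.sqrt y ≤ s * p + (β₁ + s) * n := by
    refine Real.sqrt_le_iff.2 ⟨by nlinarith [mul_nonneg hs.le hp], hy.trans ?_⟩
    have a1 := mul_le_mul_of_nonneg_right hε (sq_nonneg p)
    have a2 := mul_le_mul_of_nonneg_right (pow_le_pow_left₀ hb₁ h₁ 2) (sq_nonneg n)
    have a3 : 0 ≤ s * p * ((β₁ + s) * n) :=
      mul_nonneg (mul_nonneg hs.le hp) (mul_nonneg (hb₁.trans h₁) hn)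
    linarith
  have h4 := mul_le_mul_of_nonneg_right h3 hp
  have h5 : ε ≤ s := hε.trans (by nlinarith)
  have h6 := mul_le_mul_of_nonneg_right h5 (sq_nonneg p)
  have h7 := mul_le_mul_of_nonneg_right h₂ (sq_nonneg n)
  have h8 := mul_nonneg hs.le (sq_nonneg (p - n))
  have h9 := mul_nonneg hs.le (sq_nonneg p)
  have h10 := mul_nonneg hs.le (sq_nonneg n)
  linarith

theorem not_isEigenvalue {V V₁ V₂ : Plane → ℝ} (hVm : AEMeasurable V volume)
    (hV : IsFormSmall B₀ V) (hm₁ : AEMeasurable V₁ volume) (hsum : ∀ x, V x = V₁ x + V₂ x)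
    (h₁ : IsFormBounded B₀ V₁) (hx : IsFormBounded B₀ (fun x => (‖x‖ * V₁ x) ^ 2))
    (hvV : VanishesAtInfinity B₀ V) (hvV₁ : VanishesAtInfinity B₀ V₁)
    {W₂ : Dom B₀ →ₗ⋆[ℂ] Dom B₀ →ₗ[ℂ] ℂ} (hW : IsVirial B₀ V₂ W₂) {β₁ β₂ : ℝ}
    (hasym : HasAsymptoticBounds B₀ V₁ W₂ β₁ β₂) {E : ℝ}
    (hE : (1 / 4) * (β₁ + Real.sqrt (β₁ ^ 2 + 2 * β₂)) ^ 2 < E) : ¬ IsEigenvalue B₀ V E := by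
  rintro ⟨ψ, hψ, hdom, heig⟩
  obtain ⟨ε, R, b₁, b₂, hpos, hε, hR, hb₁, hb₂, hbd⟩ := hasym
  obtain ⟨R₀, α, γ, -, hα, hγ, hvV⟩ := hvV
  obtain ⟨R₀', α', γ', -, hα', hγ', hvV₁⟩ := hvV₁
  have hβ₁ : 0 ≤ β₁ := ge_of_tendsto' hb₁ fun j => (hpos j).2.2.1.le
  have hβ₂ : 0 ≤ β₂ := ge_of_tendsto' hb₂ fun j => (hpos j).2.2.2.le
  have hE0 : 0 ≤ E := le_trans (by positivity) hE.le
  obtain ⟨s, hs, hs1, hnum⟩ := exists_margin hβ₁ hβ₂ hE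
  obtain ⟨C₀, hC₀, hprof⟩ := exists_profile_bounds
  obtain ⟨w, hwl, hw, hwle⟩ := exists_virial_add hm₁ h₁ hx
    (LocInt.of_add (FormDomainContains.locInt hV.1) h₁.1.locInt hsum) hW
  have hVeq : V = fun x => V₁ x + V₂ x := funext hsum
  rw [← hVeq] at hw
  have hs2 : 0 < s ^ 2 := by positivity
  -- One index j must serve all bounds at infinity, and R_j ≥ C₀/s is needed as well to absorb the
  -- second radial derivative of the slope.
  have hev := ((hε.eventually (ge_mem_nhds hs2)).and
    ((hb₁.eventually (ge_mem_nhds (by linarith : β₁ < β₁ + s))).and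
    (hb₂.eventually (ge_mem_nhds (by linarith : β₂ < β₂ + s))))).and
    ((hR.eventually_ge_atTop (max (max R₀ R₀') (max 1 (C₀ / s)))).and
    ((((hα.comp hR).eventually (ge_mem_nhds hs)).and ((hγ.comp hR).eventually (ge_mem_nhds hs))).and
    (((hα'.comp hR).eventually (ge_mem_nhds hs)).and
      ((hγ'.comp hR).eventually (ge_mem_nhds hs)))))
  obtain ⟨j, ⟨hj1, hj2, hj3⟩, hjR, ⟨hj4, hj5⟩, hj6, hj7⟩ := hev.exists
  simp only [Function.comp_apply, max_le_iff] at hjR hj4 hj5 hj6 hj7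
  obtain ⟨⟨hR1, hR2⟩, hR3, hR4⟩ := hjR
  have hvan := ae_eq_zero_outside hVm hV hwl hw (ψ := ⟨ψ, hdom⟩) heig hC₀ hprof hE0 hs hs1 hR3
    ((div_le_iff₀' hs).1 hR4) hβ₁ hβ₂ (fun φ hφ => ?_) (fun φ hφ => ?_) hnum
  · exact hψ (eq_zero_of_ae_eq_zero_outside hVm hV hwl hw heig hvan)
  · have h2 := (le_abs_self _).trans ((hvV _ hR1).2.2 φ hφ).2
    have h3 := mul_le_mul_of_nonneg_right hj4 (sq_nonneg ‖momentum B₀ φ‖)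
    have h4 := mul_le_mul_of_nonneg_right hj5 (sq_nonneg ‖(φ : L2)‖)
    linarith
  · have h2 := ((hvV₁ _ hR2).2.2 φ hφ).2
    have h3 := mul_le_mul_of_nonneg_right hj6 (sq_nonneg ‖momentum B₀ φ‖)
    have h4 := mul_le_mul_of_nonneg_right hj7 (sq_nonneg ‖(φ : L2)‖)
    obtain ⟨h5, h6⟩ := hbd j φ hφ
    exact (hwle φ).trans (virial_le_of_bounds hs hs1 hj1 (hpos j).2.2.1.le hj2 hj3 (norm_nonneg _)
      (norm_nonneg _) h6 h5 (by linarith))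

theorem exists_tendsto_form_iD {V : Plane → ℝ} (hm : AEMeasurable V volume) (h : IsFormSmall B₀ V)
    {W : Dom B₀ →ₗ⋆[ℂ] Dom B₀ →ₗ[ℂ] ℂ} (hW : IsVirial B₀ V W) (φ : Dom B₀) :
    ∃ h : ∀ t : ℝ, iD t (φ : L2) ∈ Dom B₀,
      Tendsto (fun t : ℝ => 2 * (form B₀ V φ ⟨iD t (φ : L2), h t⟩).re) (𝓝[≠] 0)
        (𝓝 (2 * ‖momentum B₀ φ‖ ^ 2 - (W φ φ).re)) :=
  ⟨fun t => iD_mem t φ, tendsto_re_form_iDDom hm h.isFormBounded hW.isQuadLip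
    (fun φ η hφ => by rw [hW.extend η hφ.test φ hφ.ae_eq, Complex.ofReal_re]) φ⟩

end AharonovBohm

theorem theorem5 (B₀ : ℝ) (V : AharonovBohm.Plane → ℝ) (hVm : AEMeasurable V volume)
    (hV : AharonovBohm.IsFormSmall B₀ V) :
    (∀ W : AharonovBohm.Dom B₀ →ₗ⋆[ℂ] AharonovBohm.Dom B₀ →ₗ[ℂ] ℂ,
      AharonovBohm.IsVirial B₀ V W →
      ∀ φ : AharonovBohm.Dom B₀,
        ∃ h : ∀ t : ℝ, AharonovBohm.iD t (φ : AharonovBohm.L2) ∈ AharonovBohm.Dom B₀,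
          Tendsto
            (fun t : ℝ =>
              2 * (AharonovBohm.form B₀ V φ ⟨AharonovBohm.iD t (φ : AharonovBohm.L2), h t⟩).re)
            (𝓝[≠] 0)
            (𝓝 (2 * ‖AharonovBohm.momentum B₀ φ‖ ^ 2 - (W φ φ).re))) ∧
    (∀ V₁ V₂ : AharonovBohm.Plane → ℝ, AEMeasurable V₁ volume → (∀ x, V x = V₁ x + V₂ x) →
      AharonovBohm.IsFormBounded B₀ V₁ →
      AharonovBohm.IsFormBounded B₀ (fun x => (‖x‖ * V₁ x) ^ 2) →
      AharonovBohm.VanishesAtInfinity B₀ V →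
      AharonovBohm.VanishesAtInfinity B₀ V₁ →
      ∀ W₂ : AharonovBohm.Dom B₀ →ₗ⋆[ℂ] AharonovBohm.Dom B₀ →ₗ[ℂ] ℂ,
        AharonovBohm.IsVirial B₀ V₂ W₂ →
        ∀ ω₁ ω₂ : ℝ, AharonovBohm.HasAsymptoticBounds B₀ V₁ W₂ ω₁ ω₂ →
          ∀ E : ℝ, (1 / 4) * (ω₁ + Real.sqrt (ω₁ ^ 2 + 2 * ω₂)) ^ 2 < E →
            ¬ AharonovBohm.IsEigenvalue B₀ V E) := by
  exact ⟨fun W hW φ => AharonovBohm.exists_tendsto_form_iD hVm hV hW φ,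
    fun V₁ V₂ hm₁ hsum h₁ hx hvV hvV₁ W₂ hW ω₁ ω₂ hasym E hE =>
      AharonovBohm.not_isEigenvalue hVm hV hm₁ hsum h₁ hx hvV hvV₁ hW hasym hE⟩
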